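/- **Theorem (global error of the SDG methods).** Let $p,K\ge 0$ be integers, let $f:\mathbb R\times\mathbb R\to\mathbb R$ be of class $C^{2p+1}$, let $T>0$, and let $u:[0,T]\to\mathbb R$ be a solution of $u'=f(t,u)$, $u(0)=u_0$. *The methods.* Let $-1<x_0<\dots<x_p=1$ and $\omega_0,\dots,\omega_p$ be the nodes and weights of the right Gauss–Radau quadrature rule on $[-1,1]$ (exact for polynomials of degree $\le 2p$), $\ell_0,\dots,\ell_p$ the Lagrange polynomials at these nodes, $L_{ij}=\int_{-1}^1\ell_i'\ell_j\,dt-\delta_{ip}\delta_{jp}$, and let $\tilde L=(\tilde l_{ij})_{0\le i,j\le p}$ be given by $\tilde l_{0j}=-(L^{-1})_{0j}$ and $\tilde l_{m+1,j}=(L^{-1})_{mj}-(L^{-1})_{m+1,j}$. On a mesh $0=t_0<\dots<t_N=T$ put $\Delta t_n=t_{n+1}-t_n$, $h=\max_n\Delta t_n$ and $t_{n,m}=t_n+\frac{\Delta t_n}{2}(x_m+1)$. Given $u_n$, a start vector $(u^0_{n,m})_{m=0}^p$ is computed by marching from $(t_n,u_n)$ through $t_{n,0},\dots,t_{n,p}$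 with the explicit or the implicit Euler method. Write $f^k_{n,m}=f(t_{n,m},u^k_{n,m})$ and $q^k_{n,m}=\frac{\Delta t_n}{2}\sum_{j=0}^p\tilde l_{mj}\,\omega_j f^k_{n,j}$. For $0\le k<K$ and $0\le m\le p-1$ the explicit SDG method iterates $$u^{k+1}_{n,0}=u_n+q^k_{n,0},\qquad u^{k+1}_{n,m+1}=u^{k+1}_{n,m}+\tfrac{\Delta t_n}{2}\,\omega_m\,(f^{k+1}_{n,m}-f^k_{n,m})+q^k_{n,m+1},$$ and the implicit SDG method iterates $$u^{k+1}_{n,0}=u_n+\tfrac{\Delta t_n}{2}\,\omega_0\,(f^{k+1}_{n,0}-f^k_{n,0})+q^k_{n,0},\qquad u^{k+1}_{n,m+1}=u^{k+1}_{n,m}+\tfrac{\Delta t_n}{2}\,\omega_{m+1}\,(f^{k+1}_{n,m+1}-f^k_{n,m+1})+q^k_{n,m+1}.$$ Finally $u_{n+1}=u^K_{n,p}$. *Claim.* Both methods are accurate of global order $r=\min\{2p+1,K+1\}$: 1. For the explicit SDG method with explicit Euler start there are $C$ and $h_0>0$ such that on every mesh with $h\le h_0$ the method defines unique values, and $\max_{0\le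 n\le N}|u_n-u(t_n)|\le C\,h^{r}$. 2. For the explicit and for the implicit SDG method, each with explicit or implicit Euler start, there is $C$ such that for every $R>\max_{[0,T]}|u|$ there is $h_0>0$ with the following property. On every mesh with $h\le h_0$ the equations of the method have exactly one solution with all values $u^k_{n,m}$ ($0\le k\le K$, $0\le m\le p$, $0\le n<N$) in $[-R,R]$, and it satisfies $\max_{0\le n\le N}|u_n-u(t_n)|\le C\,h^{r}$. -/

import Mathlib

namespace SDG

open Polynomial

/-- Nodes `x` and weights `ω` of the right Gauss-Radau quadrature rule with `p + 1` points on
`[-1, 1]`: increasing nodes in `(-1, 1]`, the last one equal to `1`, and exactness on all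
polynomials of degree at most `2 p`. These properties determine `x` and `ω`. -/
structure IsRightGaussRadau (p : ℕ) (x ω : Fin (p + 1) → ℝ) : Prop where
  strictMono : StrictMono x
  neg_one_lt : ∀ i, -1 < x i
  last : x (Fin.last p) = 1
  quadrature : ∀ q : ℝ[X], q.natDegree ≤ 2 * p →
    ∫ s in (-1 : ℝ)..1, q.eval s = ∑ i, ω i * q.eval (x i)

/-- Polynomials are interval integrable. -/
lemma polyInt (q : ℝ[X]) (a b : ℝ) :
    IntervalIntegrable (fun s => q.eval s) MeasureTheory.volume a b :=
  q.continuous.intervalIntegrable a b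

/-- The polynomial whose `p`-th derivative is a multiple of the right Radau polynomial. -/
noncomputable def radauGen (p : ℕ) : ℝ[X] := (X - C 1) ^ (p + 1) * (X - C (-1)) ^ p

lemma radauGen_natDegree (p : ℕ) : (radauGen p).natDegree = 2 * p + 1 := by
  unfold radauGen
  rw [Monic.natDegree_mul ((monic_X_sub_C _).pow _) ((monic_X_sub_C _).pow _)]
  rw [natDegree_pow, natDegree_pow, natDegree_X_sub_C, natDegree_X_sub_C]
  ring

lemma radauGen_monic (p : ℕ) : (radauGen p).Monic :=
  ((monic_X_sub_C _).pow _).mul ((monic_X_sub_C _).pow _)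

lemma radauGen_iter_ne_zero (p j : ℕ) (hj : j ≤ p) : derivative^[j] (radauGen p) ≠ 0 := by
  intro h
  have h1 := congrArg (fun q : ℝ[X] => q.coeff (2 * p + 1 - j)) h
  simp only [coeff_iterate_derivative, coeff_zero] at h1
  rw [Nat.sub_add_cancel (by omega)] at h1
  have h2 : (radauGen p).coeff (2 * p + 1) = 1 := by
    have := radauGen_monic p
    rwa [Monic, leadingCoeff, radauGen_natDegree] at this
  rw [h2] at h1
  have h3 : (2 * p + 1).descFactorial j ≠ 0 := by
    rw [Ne, Nat.descFactorial_eq_zero_iff_lt]; omega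
  simp at h1
  omega

lemma radauGen_iter_one (p j : ℕ) (hj : j ≤ p) : (derivative^[j] (radauGen p)).eval 1 = 0 := by
  have h : (X - C (1 : ℝ)) ^ (p + 1) ∣ radauGen p := Dvd.intro _ rfl
  obtain ⟨q, hq⟩ := pow_sub_dvd_iterate_derivative_of_pow_dvd j h
  rw [hq]
  have : p + 1 - j ≠ 0 := by omega
  simp [this]

lemma radauGen_iter_neg_one (p j : ℕ) (hj : j < p) :
    (derivative^[j] (radauGen p)).eval (-1) = 0 := by
  have h : (X - C (-1 : ℝ)) ^ p ∣ radauGen p := Dvd.intro_left _ rfl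
  obtain ⟨q, hq⟩ := pow_sub_dvd_iterate_derivative_of_pow_dvd j h
  rw [hq]
  have : p - j ≠ 0 := by omega
  simp [this]

lemma radauGen_orth (p j : ℕ) (hj : j ≤ p) (q : ℝ[X]) (hq : q.degree < j) :
    ∫ s in (-1 : ℝ)..1, (derivative^[j] (radauGen p)).eval s * q.eval s = 0 := by
  induction j generalizing q with
  | zero =>
    have : q = 0 := by simpa using hq
    simp [this]
  | succ j ih =>
    have key := intervalIntegral.integral_mul_deriv_eq_deriv_mul (a := (-1 : ℝ)) (b := 1)
      (u := fun s => q.eval s) (v := fun s => (derivative^[j] (radauGen p)).eval s)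
      (u' := fun s => (derivative q).eval s)
      (v' := fun s => (derivative (derivative^[j] (radauGen p))).eval s)
      (fun s _ => q.hasDerivAt s) (fun s _ => Polynomial.hasDerivAt _ s)
      (polyInt _ _ _) (polyInt _ _ _)
    have h0 : ∫ s in (-1 : ℝ)..1,
        (derivative^[j] (radauGen p)).eval s * (derivative q).eval s = 0 := by
      by_cases hq0 : q = 0
      · simp [hq0]
      · apply ih (by omega)
        have h1 := degree_derivative_lt hq0
        have h2 : q.degree ≤ j := by
          rw [degree_eq_natDegree hq0] at hq ⊢
          have h3 : q.natDegree < j + 1 := by exact_mod_cast hq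
          exact_mod_cast Nat.lt_succ_iff.mp h3
        exact lt_of_lt_of_le h1 h2
    rw [radauGen_iter_one p j (by omega), radauGen_iter_neg_one p j (by omega)] at key
    simp only [mul_comm ((derivative q).eval _)] at key
    rw [h0] at key
    rw [Function.iterate_succ_apply']
    simp only [mul_comm (q.eval _)] at key
    simpa using key

lemma radauGen_card (p : ℕ) : p + 1 ≤ (derivative^[p] (radauGen p)).roots.toFinset.card := by
  have mem1 : ∀ j ≤ p, (1 : ℝ) ∈ (derivative^[j] (radauGen p)).roots.toFinset := fun j hj => by
    simp only [Multiset.mem_toFinset, mem_roots (radauGen_iter_ne_zero p j hj), IsRoot.def]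
    exact radauGen_iter_one p j hj
  have mem2 : ∀ j < p, (-1 : ℝ) ∈ (derivative^[j] (radauGen p)).roots.toFinset := fun j hj => by
    simp only [Multiset.mem_toFinset, mem_roots (radauGen_iter_ne_zero p j hj.le), IsRoot.def]
    exact radauGen_iter_neg_one p j hj
  have step : ∀ (A B E : Finset ℝ), E ⊆ A → E ⊆ B → A.card ≤ (B \ A).card + 1 →
      A.card + E.card ≤ B.card + 1 := fun A B E hA hB h => by
    have h1 := Finset.card_sdiff_add_card_inter B A
    have h2 := Finset.card_le_card (Finset.subset_inter hB hA)
    omega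
  have main : ∀ j, j < p → j + 2 ≤ (derivative^[j] (radauGen p)).roots.toFinset.card := by
    intro j
    induction j with
    | zero =>
      intro hj
      have := Finset.card_le_card (Finset.insert_subset (mem2 0 hj)
        (Finset.singleton_subset_iff.mpr (mem1 0 hj.le)))
      rwa [Finset.card_pair (by norm_num)] at this
    | succ j ih =>
      intro hj
      have h1 := card_roots_toFinset_le_card_roots_derivative_sdiff_roots_succ
        (derivative^[j] (radauGen p))
      rw [← Function.iterate_succ_apply' (f := derivative)] at h1
      have h2 := step _ _ {-1, 1}
        (Finset.insert_subset (mem2 j (by omega)) (Finset.singleton_subset_iff.mpr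
          (mem1 j (by omega))))
        (Finset.insert_subset (mem2 (j + 1) hj) (Finset.singleton_subset_iff.mpr
          (mem1 (j + 1) (by omega)))) h1
      rw [Finset.card_pair (by norm_num)] at h2
      have h3 := ih (by omega)
      omega
  rcases p with _ | p
  · exact Finset.card_pos.mpr ⟨1, mem1 0 le_rfl⟩
  · have h1 := card_roots_toFinset_le_card_roots_derivative_sdiff_roots_succ
      (derivative^[p] (radauGen (p + 1)))
    rw [← Function.iterate_succ_apply' (f := derivative)] at h1
    have h2 := step _ _ {1} (Finset.singleton_subset_iff.mpr (mem1 p (by omega)))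
      (Finset.singleton_subset_iff.mpr (mem1 (p + 1) le_rfl)) h1
    have h3 := main p (by omega)
    simp only [Finset.card_singleton] at h2
    omega

/-- Existence of the right Gauss-Radau rule. -/
theorem exists_rightGaussRadau (p : ℕ) :
    ∃ xω : (Fin (p + 1) → ℝ) × (Fin (p + 1) → ℝ), IsRightGaussRadau p xω.1 xω.2 := by
  set D := derivative^[p] (radauGen p) with hD
  have hD0 : D ≠ 0 := radauGen_iter_ne_zero p p le_rfl
  have hdeg : D.natDegree ≤ p + 1 :=
    (natDegree_iterate_derivative _ _).trans (by rw [radauGen_natDegree]; omega)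
  have hcard : D.roots.toFinset.card = p + 1 := le_antisymm
    ((Multiset.toFinset_card_le _).trans ((card_roots' D).trans hdeg)) (radauGen_card p)
  have hdeg' : D.natDegree = p + 1 := le_antisymm hdeg
    (hcard.symm.le.trans ((Multiset.toFinset_card_le _).trans (card_roots' D)))
  set x : Fin (p + 1) → ℝ := fun i => D.roots.toFinset.orderEmbOfFin hcard i with hx
  have hmono : StrictMono x := (D.roots.toFinset.orderEmbOfFin hcard).strictMono
  have hroot : ∀ i, D.eval (x i) = 0 := fun i => by
    have := Finset.orderEmbOfFin_mem D.roots.toFinset hcard i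
    rw [Multiset.mem_toFinset, mem_roots hD0] at this
    exact this
  have hinj : Set.InjOn x (Finset.univ : Finset (Fin (p + 1))) := hmono.injective.injOn
  set ω : Fin (p + 1) → ℝ := fun i =>
    ∫ s in (-1 : ℝ)..1, (Lagrange.basis Finset.univ x i).eval s with hω
  have hexact : ∀ q : ℝ[X], q.natDegree ≤ 2 * p →
      ∫ s in (-1 : ℝ)..1, q.eval s = ∑ i, ω i * q.eval (x i) := by
    intro q hq
    have hdiv : D * (q / D) + q % D = q := EuclideanDomain.div_add_mod q D
    have hmod : (q % D).degree < (p + 1 : ℕ) := by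
      have := degree_mod_lt q hD0
      rwa [degree_eq_natDegree hD0, hdeg'] at this
    have hquot : (q / D).degree < p := by
      by_cases h0 : q / D = 0
      · rw [h0, degree_zero]; exact WithBot.bot_lt_coe p
      · have h1 : q.natDegree = D.natDegree + (q / D).natDegree := by
          have := natDegree_add_eq_left_of_degree_lt (p := D * (q / D)) (q := q % D) (by
            rw [degree_mul]
            refine (degree_mod_lt q hD0).trans_le ?_
            rw [degree_eq_natDegree hD0, degree_eq_natDegree h0]
            exact_mod_cast Nat.le_add_right _ _)
          rw [hdiv, natDegree_mul hD0 h0] at this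
          exact this
        rw [degree_eq_natDegree h0]
        have : (q / D).natDegree < p := by omega
        exact_mod_cast this
    have hval : ∀ i, q.eval (x i) = (q % D).eval (x i) := fun i => by
      conv_lhs => rw [← hdiv]
      simp [hroot i]
    have hint : ∫ s in (-1 : ℝ)..1, q.eval s = ∫ s in (-1 : ℝ)..1, (q % D).eval s := by
      have h1 : ∀ s, q.eval s = D.eval s * (q / D).eval s + (q % D).eval s := fun s => by
        conv_lhs => rw [← hdiv]
        simp
      simp only [h1]
      rw [intervalIntegral.integral_add _ (polyInt _ _ _), radauGen_orth p p le_rfl _ hquot,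
        zero_add]
      exact (D.continuous.mul (q / D).continuous).intervalIntegrable _ _
    have hinterp := Lagrange.eq_interpolate (s := Finset.univ) hinj
      (f := q % D) (by simpa using hmod)
    rw [hint]
    simp only [hval]
    conv_lhs => rw [hinterp]
    simp only [Lagrange.interpolate_apply, eval_finsetSum, eval_mul, eval_C]
    rw [intervalIntegral.integral_finsetSum]
    · simp only [intervalIntegral.integral_const_mul, hω]
      exact Finset.sum_congr rfl fun i _ => mul_comm _ _
    · exact fun i _ => ((polyInt _ _ _).const_mul _)
  -- a node different from `1` lies in `(-1, 1)`
  have hloc : ∀ i, x i ≠ 1 → -1 < x i ∧ x i < 1 := by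
    intro i hi
    obtain ⟨k, hk⟩ : ∃ k, x k = 1 := by
      have h1 : (1 : ℝ) ∈ D.roots.toFinset := by
        rw [Multiset.mem_toFinset, mem_roots hD0]; exact radauGen_iter_one p p le_rfl
      have := Finset.range_orderEmbOfFin D.roots.toFinset hcard
      have h2 : (1 : ℝ) ∈ Set.range (D.roots.toFinset.orderEmbOfFin hcard) := by
        rw [this]; exact h1
      exact h2
    have hik : i ≠ k := fun h => hi (h ▸ hk)
    have hki : k ∈ Finset.univ.erase i := by simp [hik.symm]
    set J := (Finset.univ.erase i).erase k with hJ
    have hJcard : J.card + 1 = p := by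
      have h1 := Finset.card_erase_add_one hki
      have h2 := Finset.card_erase_add_one (Finset.mem_univ i)
      rw [Finset.card_univ, Fintype.card_fin] at h2
      rw [hJ]
      omega
    set S : ℝ[X] := ∏ j ∈ J, (X - C (x j)) with hS
    have hSdeg : S.natDegree = J.card := by
      rw [hS, natDegree_prod_of_monic _ _ (fun j _ => monic_X_sub_C _)]; simp
    have contra : ∀ c : ℝ, (∀ s ∈ Set.Ioo (-1 : ℝ) 1, 0 < c * (s - x i)) → False := by
      intro c hc
      set Q : ℝ[X] := C c * (X - C (x i)) * (C 1 - X) * S ^ 2 with hQ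
      have hQdeg : Q.natDegree ≤ 2 * p := by
        have h1 : (C c * (X - C (x i))).natDegree ≤ 1 :=
          (natDegree_C_mul_le _ _).trans (natDegree_X_sub_C_le _)
        have h2 : (C (1 : ℝ) - X).natDegree ≤ 1 := by
          refine (natDegree_sub_le _ _).trans ?_
          simp
        have h3 : (S ^ 2).natDegree ≤ 2 * J.card := by rw [natDegree_pow, hSdeg]
        have h4 := natDegree_mul_le (p := C c * (X - C (x i))) (q := C 1 - X)
        have h5 := natDegree_mul_le (p := C c * (X - C (x i)) * (C 1 - X)) (q := S ^ 2)
        rw [hQ]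
        omega
      have hz : ∑ j, ω j * Q.eval (x j) = 0 := by
        refine Finset.sum_eq_zero fun j _ => ?_
        by_cases hji : j = i
        · simp [hQ, hji]
        by_cases hjk : j = k
        · simp [hQ, hjk, hk]
        · have : S.eval (x j) = 0 := by
            rw [hS, eval_prod]
            exact Finset.prod_eq_zero (i := j) (by simp [hJ, hji, hjk]) (by simp)
          simp [hQ, this]
      have hzero := hexact Q hQdeg
      rw [hz] at hzero
      -- replace positivity off finitely many points by nonnegativity and one positive point
      have hnn : ∀ s ∈ Set.Ioc (-1 : ℝ) 1, 0 ≤ Q.eval s := by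
        intro s hs
        simp only [hQ, eval_mul, eval_C, eval_sub, eval_X, eval_pow]
        rcases eq_or_lt_of_le hs.2 with h | h
        · simp [h]
        · have := hc s ⟨hs.1, h⟩
          have h2 : 0 ≤ 1 - s := by linarith
          positivity
      obtain ⟨s0, hs0, hs0J⟩ : ∃ s ∈ Set.Ioo (-1 : ℝ) 1, s ∉ (D.roots.toFinset : Set ℝ) :=
        ((Set.Ioo_infinite (by norm_num : (-1 : ℝ) < 1)).sdiff
          (Finset.finite_toSet _)).nonempty
      have hpos : 0 < Q.eval s0 := by
        simp only [hQ, eval_mul, eval_C, eval_sub, eval_X, eval_pow]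
        have h1 := hc s0 hs0
        have h2 : 0 < 1 - s0 := by linarith [hs0.2]
        have h3 : S.eval s0 ≠ 0 := by
          rw [hS, eval_prod, Finset.prod_ne_zero_iff]
          intro j _ h
          apply hs0J
          have : s0 = x j := by simpa [sub_eq_zero] using h
          rw [this]
          exact Finset.orderEmbOfFin_mem D.roots.toFinset hcard j
        positivity
      have := intervalIntegral.integral_pos (by norm_num : (-1 : ℝ) < 1)
        Q.continuous.continuousOn hnn ⟨s0, ⟨hs0.1.le, hs0.2.le⟩, hpos⟩
      linarith
    constructor
    · by_contra h
      exact contra 1 fun s hs => by linarith [hs.1]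
    · by_contra h
      exact contra (-1) fun s hs => by linarith [hs.2]
  refine ⟨(x, ω), hmono, ?_, ?_, hexact⟩
  · intro i
    by_cases h : x i = 1
    · simp only [h]; norm_num
    · exact (hloc i h).1
  · have h1 : (1 : ℝ) ∈ D.roots.toFinset := by
      rw [Multiset.mem_toFinset, mem_roots hD0]; exact radauGen_iter_one p p le_rfl
    obtain ⟨k, hk⟩ : (1 : ℝ) ∈ Set.range x := by
      have h3 := Finset.range_orderEmbOfFin D.roots.toFinset hcard
      have h4 : (1 : ℝ) ∈ Set.range (D.roots.toFinset.orderEmbOfFin hcard) := by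
        rw [h3]; exact h1
      exact h4
    have h2 : 1 ≤ x (Fin.last p) := hk ▸ hmono.monotone (Fin.le_last k)
    by_contra h
    exact absurd (hloc _ h).2 (not_lt.mpr h2)

/-- The right Gauss-Radau nodes on `[-1, 1]`. -/
noncomputable def radauNode (p : ℕ) : Fin (p + 1) → ℝ :=
  (Classical.choose (exists_rightGaussRadau p)).1

/-- The right Gauss-Radau weights on `[-1, 1]`. -/
noncomputable def radauWeight (p : ℕ) : Fin (p + 1) → ℝ :=
  (Classical.choose (exists_rightGaussRadau p)).2

theorem radau_spec (p : ℕ) : IsRightGaussRadau p (radauNode p) (radauWeight p) :=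
  Classical.choose_spec (exists_rightGaussRadau p)

/-- The nodal basis `ℓ_0, …, ℓ_p` of Lagrange polynomials at the Gauss-Radau nodes. -/
noncomputable def nodalBasis (p : ℕ) (i : Fin (p + 1)) : ℝ[X] :=
  Lagrange.basis Finset.univ (radauNode p) i

/-- The DG matrix `L_{ij} = ∫_{-1}^{1} ℓ_i' ℓ_j - δ_{ip} δ_{jp}` on the reference interval. -/
noncomputable def dgMatrix (p : ℕ) : Matrix (Fin (p + 1)) (Fin (p + 1)) ℝ :=
  Matrix.of fun i j =>
    (∫ s in (-1 : ℝ)..1, (derivative (nodalBasis p i)).eval s * (nodalBasis p j).eval s)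
      - if i = Fin.last p ∧ j = Fin.last p then 1 else 0

/-- The matrix `L̃`: its row `0` is minus row `0` of `L⁻¹`, and its row `m + 1` is row `m` minus
row `m + 1` of `L⁻¹`. It is `L_Δ L⁻¹` for the bidiagonal approximation `L_Δ` of `L` with `-1` on the
diagonal and `1` below it. -/
noncomputable def sweepMatrix (p : ℕ) : Matrix (Fin (p + 1)) (Fin (p + 1)) ℝ :=
  Matrix.of fun i j =>
    Fin.cases (motive := fun _ => ℝ) (-((dgMatrix p)⁻¹ 0 j))
      (fun m : Fin p => (dgMatrix p)⁻¹ m.castSucc j - (dgMatrix p)⁻¹ m.succ j) i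

/-- The Gauss-Radau points of the time step `[a, a + Δ]`. -/
noncomputable def stepNode (p : ℕ) (a Δ : ℝ) (m : Fin (p + 1)) : ℝ :=
  a + Δ / 2 * (radauNode p m + 1)

/-- The two versions of a method. -/
inductive Version
  | explicit
  | implicit

/-- `V` is the initial guess at the Gauss-Radau points of the step `[a, a + Δ]` that is obtained from
the value `y` at `a` by marching with the explicit or implicit Euler method from each point to the
next. -/
def IsEulerGuess (p : ℕ) (f : ℝ → ℝ → ℝ) (a Δ y : ℝ) (V : Fin (p + 1) → ℝ) : Version → Prop
  | .explicit =>
      V 0 = y + (stepNode p a Δ 0 - a) * f a y ∧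
      ∀ m : Fin p, V m.succ = V m.castSucc
        + (stepNode p a Δ m.succ - stepNode p a Δ m.castSucc)
          * f (stepNode p a Δ m.castSucc) (V m.castSucc)
  | .implicit =>
      V 0 = y + (stepNode p a Δ 0 - a) * f (stepNode p a Δ 0) (V 0) ∧
      ∀ m : Fin p, V m.succ = V m.castSucc
        + (stepNode p a Δ m.succ - stepNode p a Δ m.castSucc)
          * f (stepNode p a Δ m.succ) (V m.succ)

/-- The quadrature term `(Δ / 2) ∑_j L̃_{ij} ω_j f(t_j, V_j)`. -/
noncomputable def sweepTerm (p : ℕ) (f : ℝ → ℝ → ℝ) (a Δ : ℝ) (V : Fin (p + 1) → ℝ)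
    (i : Fin (p + 1)) : ℝ :=
  Δ / 2 * ∑ j, sweepMatrix p i j * radauWeight p j * f (stepNode p a Δ j) (V j)

/-- `W` arises from the iterate `V` by one iteration of the explicit or implicit SDG scheme on the
step `[a, a + Δ]` with value `y` at `a`. -/
def IsSDGIteration (p : ℕ) (f : ℝ → ℝ → ℝ) (a Δ y : ℝ) (V W : Fin (p + 1) → ℝ) : Version → Prop
  | .explicit =>
      W 0 = y + sweepTerm p f a Δ V 0 ∧
      ∀ m : Fin p, W m.succ = W m.castSucc
        + Δ / 2 * radauWeight p m.castSucc
          * (f (stepNode p a Δ m.castSucc) (W m.castSucc)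
            - f (stepNode p a Δ m.castSucc) (V m.castSucc))
        + sweepTerm p f a Δ V m.succ
  | .implicit =>
      W 0 = y
        + Δ / 2 * radauWeight p 0 * (f (stepNode p a Δ 0) (W 0) - f (stepNode p a Δ 0) (V 0))
        + sweepTerm p f a Δ V 0 ∧
      ∀ m : Fin p, W m.succ = W m.castSucc
        + Δ / 2 * radauWeight p m.succ
          * (f (stepNode p a Δ m.succ) (W m.succ) - f (stepNode p a Δ m.succ) (V m.succ))
        + sweepTerm p f a Δ V m.succ

/-- The values `u_0, …, u_N` at the mesh points, read off from the iterates: `u_{n+1}` is the value of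
the last iterate of step `n` at its last node. -/
def meshValue {p K N : ℕ} (u₀ : ℝ) (U : Fin N → Fin (K + 1) → Fin (p + 1) → ℝ) :
    Fin (N + 1) → ℝ :=
  Fin.cases u₀ fun n => U n (Fin.last K) (Fin.last p)

/-- `U n k m` is the value at node `m` of the `k`-th iterate on step `n`, when the SDG method of the
version `v` with degree `p` and `K` iterations per step, started in each step by the Euler method of
the version `g`, is applied on the mesh `t`. -/
structure IsSDGRun (g v : Version) (p K : ℕ) (f : ℝ → ℝ → ℝ) (u₀ : ℝ) {N : ℕ}
    (t : Fin (N + 1) → ℝ) (U : Fin N → Fin (K + 1) → Fin (p + 1) → ℝ) : Prop where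
  guess : ∀ n : Fin N, IsEulerGuess p f (t n.castSucc) (t n.succ - t n.castSucc)
    (meshValue u₀ U n.castSucc) (U n 0) g
  iteration : ∀ (n : Fin N) (k : Fin K), IsSDGIteration p f (t n.castSucc)
    (t n.succ - t n.castSucc) (meshValue u₀ U n.castSucc) (U n k.castSucc) (U n k.succ) v

/-- A partition `0 = t_0 < t_1 < ⋯ < t_N = T`. -/
structure IsPartition (T : ℝ) {N : ℕ} (t : Fin (N + 1) → ℝ) : Prop where
  strictMono : StrictMono t
  first : t 0 = 0
  last : t (Fin.last N) = T

/-- The largest step size of a mesh. -/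
noncomputable def meshWidth {N : ℕ} (t : Fin (N + 1) → ℝ) : ℝ :=
  ⨆ n : Fin N, (t n.succ - t n.castSucc)

end SDG

namespace SDG

open Polynomial

/-! Write `F(V)` for the vector of the values `f(t_j, V_j)`. Integration by parts, with a quadrature
rule that is exact on every product involved, gives `L A = -diag ω`, where `A` is the Radau IIA
collocation matrix (`dgMatrix_mul_collocMatrix`). Hence the rows of `L̃ diag ω` are differences of
rows of `A`, and summing a sweep along the nodes turns it into `W = y + Δ/2 B (F(W) - F(V)) + Δ/2 A
F(V)` with `B` lower triangular (`isSDGIteration_iff`). This is a preconditioned Picard iteration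
for the collocation equations; the explicit and implicit versions differ only in the diagonal of
`B`.

On a step that starts on the solution, a sweep multiplies the previous error by `O(Δ)` and adds the
collocation defect `O(Δ^(p+2))`. Starting from the Euler error `O(Δ^2)`, the stages after `k` sweeps
are accurate to `Δ^(min k p + 2)` (`exists_stage_error_le`), which settles the cases `K ≤ p` and `p
= 0`.

In the remaining case the endpoint is superconvergent. Differences of successive iterates do not see
the defect, so they keep gaining powers of `Δ`, and the last iterate solves the collocation
equations up to `O(Δ^(K+2))` (`exists_residual_le`). It extends to a polynomial curve whose defect
in the differential equation is small at the nodes. After linearisation along `u` and multiplication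
by an integrating factor, the endpoint error is the integral of factor times defect, up to a
quadratic remainder; the Radau rule, exact up to degree `2 p`, evaluates that integral up to
`O(Δ^(2p+2))` (`exists_superconvergence_le`). All constants must be uniform over the steps, which is
what `HasJet` keeps track of.

A step amplifies errors by at most `1 + O(Δ)` (`IsStep.abs_last_sub_le`), so the discrete Gronwall
inequality turns local order `r + 1` into global order `r`. Since `f` is only locally Lipschitz, all
this is done for `f` clamped to a box; runs of the clamped problem stay near `u`, hence inside the
box, where nothing was changed. -/

/-! ### Gauss-Radau quadrature, the DG matrix and collocation. -/

lemma radauNode_injective (p : ℕ) : Function.Injective (radauNode p) :=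
  (radau_spec p).strictMono.injective

lemma radauNode_le_one {p : ℕ} (m : Fin (p + 1)) : radauNode p m ≤ 1 :=
  (radau_spec p).last ▸ (radau_spec p).strictMono.monotone (Fin.le_last m)

lemma nodalBasis_eval_node {p : ℕ} (i j : Fin (p + 1)) :
    (nodalBasis p i).eval (radauNode p j) = if i = j then 1 else 0 := by
  split_ifs with h
  · subst h
    exact Lagrange.eval_basis_self (radauNode_injective p).injOn (Finset.mem_univ i)
  · exact Lagrange.eval_basis_of_ne h (Finset.mem_univ j)

lemma nodalBasis_natDegree {p : ℕ} (i : Fin (p + 1)) : (nodalBasis p i).natDegree = p := by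
  rw [nodalBasis, Lagrange.natDegree_basis (radauNode_injective p).injOn (Finset.mem_univ i)]
  simp

/-- A polynomial of degree at most `p` is its own interpolant at the Gauss-Radau nodes. -/
lemma eval_eq_sum_nodalBasis {p : ℕ} {q : ℝ[X]} (hq : q.natDegree ≤ p) (s : ℝ) :
    q.eval s = ∑ j, (nodalBasis p j).eval s * q.eval (radauNode p j) := by
  have hdeg : q.degree < (Finset.univ : Finset (Fin (p + 1))).card := by
    rw [Finset.card_univ, Fintype.card_fin]
    exact (degree_le_of_natDegree_le hq).trans_lt (by exact_mod_cast Nat.lt_succ_self p)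
  have h := Lagrange.eq_interpolate (radauNode_injective p).injOn hdeg
  conv_lhs => rw [h]
  simp only [Lagrange.interpolate_apply, eval_finsetSum, eval_mul, eval_C, nodalBasis]
  exact Finset.sum_congr rfl fun i _ => mul_comm _ _

/-- The collocation matrix `A_{mj} = ∫_{-1}^{x_m} ℓ_j` of the Radau IIA method on `[-1, 1]`. -/
noncomputable def collocMatrix (p : ℕ) : Matrix (Fin (p + 1)) (Fin (p + 1)) ℝ :=
  Matrix.of fun m j => ∫ s in (-1 : ℝ)..radauNode p m, (nodalBasis p j).eval s

lemma integral_eq_sum_collocMatrix {p : ℕ} {q : ℝ[X]} (hq : q.natDegree ≤ p) (m : Fin (p + 1)) :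
    ∫ s in (-1 : ℝ)..radauNode p m, q.eval s
      = ∑ j, collocMatrix p m j * q.eval (radauNode p j) := by
  simp_rw [collocMatrix, Matrix.of_apply, ← intervalIntegral.integral_mul_const]
  rw [← intervalIntegral.integral_finsetSum]
  · exact intervalIntegral.integral_congr fun s _ => eval_eq_sum_nodalBasis hq s
  · exact fun i _ => (polyInt _ _ _).mul_const _

/-- Every polynomial has a primitive that vanishes at `-1`. -/
lemma exists_primitive (q : ℝ[X]) :
    ∃ P : ℝ[X], derivative P = q ∧ P.natDegree ≤ q.natDegree + 1 ∧ P.eval (-1) = 0 := by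
  obtain ⟨P, hP, hdeg⟩ : ∃ P : ℝ[X], derivative P = q ∧ P.natDegree ≤ q.natDegree + 1 := by
    refine ⟨∑ k ∈ Finset.range (q.natDegree + 1), C (q.coeff k / (k + 1)) * X ^ (k + 1), ?_, ?_⟩
    · conv_rhs => rw [q.as_sum_range_C_mul_X_pow]
      rw [derivative_sum]
      refine Finset.sum_congr rfl fun k _ => ?_
      rw [derivative_C_mul_X_pow]
      have : (k : ℝ) + 1 ≠ 0 := by positivity
      congr 2
      push_cast
      field_simp
    · refine natDegree_sum_le_of_forall_le _ _ fun k hk => ?_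
      refine (natDegree_C_mul_X_pow_le _ _).trans ?_
      have := Finset.mem_range.mp hk
      omega
  refine ⟨P - C (P.eval (-1)), by simp [hP], ?_, by simp⟩
  rwa [natDegree_sub_C]

lemma integral_derivative (P : ℝ[X]) (a b : ℝ) :
    ∫ s in a..b, (derivative P).eval s = P.eval b - P.eval a :=
  intervalIntegral.integral_eq_sub_of_hasDerivAt (fun s _ => P.hasDerivAt s) (polyInt _ _ _)

/-- The square `ℓ_i²` has degree `2 p`, so the rule is still exact on it and gives `ω_i = ∫ ℓ_i²`.
-/
lemma radauWeight_pos {p : ℕ} (i : Fin (p + 1)) : 0 < radauWeight p i := by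
  have h := (radau_spec p).quadrature (nodalBasis p i ^ 2)
    (by rw [natDegree_pow, nodalBasis_natDegree])
  simp only [eval_pow, nodalBasis_eval_node] at h
  simp at h
  rw [← h]
  refine intervalIntegral.integral_pos (by norm_num)
    ((nodalBasis p i).continuous.pow 2).continuousOn (fun s _ => sq_nonneg _)
    ⟨radauNode p i, ⟨((radau_spec p).neg_one_lt i).le, radauNode_le_one i⟩, ?_⟩
  simp [nodalBasis_eval_node]

/-- Column `k` of `A` holds the nodal values of the primitive `P` of `ℓ_k` with `P(-1) = 0`.
Quadrature turns entry `(i, k)` of the product into `∫ ℓ_i' P` minus a boundary term. Integration by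
parts gives `-∫ ℓ_i ℓ_k = -ω_i δ_ik`; its contribution at `1` cancels the boundary term, and the one
at `-1` vanishes. -/
lemma dgMatrix_mul_collocMatrix (p : ℕ) :
    dgMatrix p * collocMatrix p = -Matrix.diagonal (radauWeight p) := by
  ext i k
  obtain ⟨P, hP, hPdeg, hP0⟩ := exists_primitive (nodalBasis p k)
  have hA : ∀ m, collocMatrix p m k = P.eval (radauNode p m) := fun m => by
    rw [collocMatrix, Matrix.of_apply, ← hP, integral_derivative, hP0, sub_zero]
  have hdeg : ∀ q : ℝ[X], q.natDegree ≤ p + 1 →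
      (derivative (nodalBasis p i) * q).natDegree ≤ 2 * p := by
    intro q hq
    -- For `p = 0` the degree count `(p - 1) + (p + 1)` fails because of truncated subtraction, but
    -- then `ℓ_i' = 0`.
    by_cases hp : p = 0
    · have : derivative (nodalBasis p i) = 0 :=
        derivative_of_natDegree_zero (by rw [nodalBasis_natDegree, hp])
      simp [this]
    · have h1 := natDegree_derivative_le (nodalBasis p i)
      have h2 := natDegree_mul_le (p := derivative (nodalBasis p i)) (q := q)
      rw [nodalBasis_natDegree] at h1
      omega
  -- the quadrature rule evaluates `∫ ℓ_i' P` exactly, as well as `∫ ℓ_i' ℓ_j`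
  have hquad : ∑ j, (∫ s in (-1 : ℝ)..1, (derivative (nodalBasis p i)).eval s
      * (nodalBasis p j).eval s) * P.eval (radauNode p j)
      = ∫ s in (-1 : ℝ)..1, (derivative (nodalBasis p i) * P).eval s := by
    rw [(radau_spec p).quadrature _ (hdeg P (hPdeg.trans (by rw [nodalBasis_natDegree])))]
    refine Finset.sum_congr rfl fun j _ => ?_
    have h := (radau_spec p).quadrature _ (hdeg (nodalBasis p j)
      (by rw [nodalBasis_natDegree]; omega))
    simp only [eval_mul, nodalBasis_eval_node] at h
    rw [h]
    simp
    ring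
  have hparts : ∫ s in (-1 : ℝ)..1, (derivative (nodalBasis p i) * P).eval s
      = (if i = Fin.last p then 1 else 0) * P.eval 1
        - if i = k then radauWeight p i else 0 := by
    have h1 := integral_derivative (nodalBasis p i * P) (-1) 1
    rw [derivative_mul, hP] at h1
    have h2 := (radau_spec p).quadrature (nodalBasis p i * nodalBasis p k)
      ((natDegree_mul_le).trans (by rw [nodalBasis_natDegree, nodalBasis_natDegree]; omega))
    simp only [eval_add] at h1
    rw [intervalIntegral.integral_add (polyInt _ _ _) (polyInt _ _ _), h2] at h1
    have h3 := nodalBasis_eval_node i (Fin.last p)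
    rw [(radau_spec p).last] at h3
    simp only [eval_mul, nodalBasis_eval_node, hP0, h3] at h1
    simp only [eval_mul] at h1 ⊢
    have h4 : ∑ j, radauWeight p j * ((if i = j then (1 : ℝ) else 0) * if k = j then 1 else 0)
        = if i = k then radauWeight p i else 0 := by
      by_cases h : i = k <;> simp [h]
    rw [h4] at h1
    linarith
  simp only [Matrix.mul_apply, hA, dgMatrix, Matrix.of_apply, sub_mul, Finset.sum_sub_distrib]
  rw [hquad, hparts]
  have h5 : ∑ j, (if i = Fin.last p ∧ j = Fin.last p then (1 : ℝ) else 0)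
      * P.eval (radauNode p j) = (if i = Fin.last p then 1 else 0) * P.eval 1 := by
    rw [← (radau_spec p).last]
    by_cases h : i = Fin.last p <;> simp [h]
  rw [h5, Matrix.neg_apply, Matrix.diagonal_apply]
  ring

/-- The preceding product exhibits `-A diag(ω)⁻¹` as a right inverse of `L`, so invertibility of `L`
needs no separate argument. -/
lemma dgMatrix_inv_mul_weight (p : ℕ) (m j : Fin (p + 1)) :
    (dgMatrix p)⁻¹ m j * radauWeight p j = -collocMatrix p m j := by
  have h : (dgMatrix p) * (-(collocMatrix p * Matrix.diagonal fun j => (radauWeight p j)⁻¹)) = 1 := by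
    rw [mul_neg, ← mul_assoc, dgMatrix_mul_collocMatrix, neg_mul, neg_neg,
      Matrix.diagonal_mul_diagonal, ← Matrix.diagonal_one]
    congr 1
    ext j
    exact mul_inv_cancel₀ (radauWeight_pos j).ne'
  rw [Matrix.inv_eq_right_inv h, Matrix.neg_apply, Matrix.mul_diagonal, neg_mul, mul_assoc,
    inv_mul_cancel₀ (radauWeight_pos j).ne', mul_one]

lemma sweepMatrix_zero_mul_weight (p : ℕ) (j : Fin (p + 1)) :
    sweepMatrix p 0 j * radauWeight p j = collocMatrix p 0 j := by
  simp [sweepMatrix, dgMatrix_inv_mul_weight]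

/-- These differences telescope when a sweep is summed along the nodes, leaving row `m` of `A`. -/
lemma sweepMatrix_succ_mul_weight (p : ℕ) (m : Fin p) (j : Fin (p + 1)) :
    sweepMatrix p m.succ j * radauWeight p j
      = collocMatrix p m.succ j - collocMatrix p m.castSucc j := by
  simp [sweepMatrix, sub_mul, dgMatrix_inv_mul_weight]
  ring

/-- A node of the step `[0, Δ]`. -/
noncomputable def relNode (p : ℕ) (Δ : ℝ) (m : Fin (p + 1)) : ℝ := Δ / 2 * (radauNode p m + 1)

lemma stepNode_eq (p : ℕ) (a Δ : ℝ) (m : Fin (p + 1)) : stepNode p a Δ m = a + relNode p Δ m := rfl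

lemma relNode_last (p : ℕ) (Δ : ℝ) : relNode p Δ (Fin.last p) = Δ := by
  rw [relNode, (radau_spec p).last]; ring

lemma relNode_mem {p : ℕ} {Δ : ℝ} (hΔ : 0 ≤ Δ) (m : Fin (p + 1)) :
    relNode p Δ m ∈ Set.Icc 0 Δ := by
  have h1 := (radau_spec p).neg_one_lt m
  have h2 := radauNode_le_one m
  constructor <;> unfold relNode <;> nlinarith

lemma integral_rescale (q : ℝ[X]) (Δ x : ℝ) :
    ∫ τ in (0 : ℝ)..Δ / 2 * (x + 1), q.eval τ
      = Δ / 2 * ∫ s in (-1 : ℝ)..x, (q.comp (C (Δ / 2) * X + C (Δ / 2))).eval s := by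
  have h := intervalIntegral.smul_integral_comp_mul_add (a := -1) (b := x)
    (fun s => q.eval s) (Δ / 2) (Δ / 2)
  simp only [eval_comp, eval_add, eval_mul, eval_C, eval_X]
  rw [smul_eq_mul] at h
  rw [h]
  congr 1 <;> ring

lemma natDegree_rescale_le (q : ℝ[X]) (c : ℝ) :
    (q.comp (C c * X + C c)).natDegree ≤ q.natDegree := by
  refine natDegree_comp_le.trans ?_
  have : (C c * X + C c : ℝ[X]).natDegree ≤ 1 := natDegree_linear_le
  nlinarith

lemma integral_relNode {p : ℕ} {q : ℝ[X]} (hq : q.natDegree ≤ p) (Δ : ℝ) (m : Fin (p + 1)) :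
    ∫ τ in (0 : ℝ)..relNode p Δ m, q.eval τ
      = Δ / 2 * ∑ j, collocMatrix p m j * q.eval (relNode p Δ j) := by
  rw [relNode, integral_rescale,
    integral_eq_sum_collocMatrix ((natDegree_rescale_le q _).trans hq)]
  simp [relNode, mul_add]

/-- Over the whole step the exactness reaches degree `2 p`, whereas `integral_relNode` stops at
degree `p`. This surplus is the source of superconvergence. -/
lemma integral_step {p : ℕ} {q : ℝ[X]} (hq : q.natDegree ≤ 2 * p) (Δ : ℝ) :
    ∫ τ in (0 : ℝ)..Δ, q.eval τ
      = Δ / 2 * ∑ j, radauWeight p j * q.eval (relNode p Δ j) := by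
  have h := integral_rescale q Δ 1
  rw [(radau_spec p).quadrature _ ((natDegree_rescale_le q _).trans hq)] at h
  rw [show Δ / 2 * ((1 : ℝ) + 1) = Δ by ring] at h
  rw [h]
  simp [relNode, mul_add]

/-! ### Summed form of the Euler guess and of the sweeps. -/

/-- The lower triangular matrix with constant columns `c` (below the diagonal for the explicit
version, up to the diagonal for the implicit version). -/
def lowerMatrix {p : ℕ} (c : Fin (p + 1) → ℝ) : Version → Matrix (Fin (p + 1)) (Fin (p + 1)) ℝ
  | .explicit => Matrix.of fun m j => if j < m then c j else 0
  | .implicit => Matrix.of fun m j => if j ≤ m then c j else 0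

/-- The weights with which the Euler method of the given version uses the values at the nodes. -/
noncomputable def gapWeight (p : ℕ) : Version → Fin (p + 1) → ℝ
  -- The last entry is a dummy: the strictly lower triangular `lowerMatrix` never uses its last
  -- column.
  | .explicit => Fin.lastCases 0 fun l => radauNode p l.succ - radauNode p l.castSucc
  | .implicit => Fin.cases (radauNode p 0 + 1) fun l => radauNode p l.succ - radauNode p l.castSucc

/-- The weight with which the Euler method of the given version uses the value at the left end. -/
noncomputable def startWeight (p : ℕ) : Version → ℝ
  | .explicit => radauNode p 0 + 1
  | .implicit => 0

lemma sum_lowerMatrix_explicit_zero {p : ℕ} (c d : Fin (p + 1) → ℝ) :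
    ∑ j, lowerMatrix c .explicit 0 j * d j = 0 := by
  simp [lowerMatrix]

lemma sum_lowerMatrix_explicit_succ {p : ℕ} (c d : Fin (p + 1) → ℝ) (m : Fin p) :
    ∑ j, lowerMatrix c .explicit m.succ j * d j
      = ∑ j, lowerMatrix c .explicit m.castSucc j * d j + c m.castSucc * d m.castSucc := by
  have h : ∀ j, lowerMatrix c .explicit m.succ j * d j
      = lowerMatrix c .explicit m.castSucc j * d j
        + if j = m.castSucc then c m.castSucc * d m.castSucc else 0 := by
    intro j
    simp only [lowerMatrix, Matrix.of_apply]
    rcases lt_trichotomy j m.castSucc with h | h | h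
    · have h1 : j < m.succ := h.trans m.castSucc_lt_succ
      simp [h, h1, h.ne]
    · subst h
      simp [m.castSucc_lt_succ]
    · have h1 : ¬ j < m.succ := not_lt.mpr (Fin.castSucc_lt_iff_succ_le.mp h)
      simp [h1, h.le, h.ne']
  simp only [h, Finset.sum_add_distrib, Finset.sum_ite_eq', Finset.mem_univ, if_true]

lemma sum_lowerMatrix_implicit_zero {p : ℕ} (c d : Fin (p + 1) → ℝ) :
    ∑ j, lowerMatrix c .implicit 0 j * d j = c 0 * d 0 := by
  simp [lowerMatrix]

lemma sum_lowerMatrix_implicit_succ {p : ℕ} (c d : Fin (p + 1) → ℝ) (m : Fin p) :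
    ∑ j, lowerMatrix c .implicit m.succ j * d j
      = ∑ j, lowerMatrix c .implicit m.castSucc j * d j + c m.succ * d m.succ := by
  have h : ∀ j, lowerMatrix c .implicit m.succ j * d j
      = lowerMatrix c .implicit m.castSucc j * d j
        + if j = m.succ then c m.succ * d m.succ else 0 := by
    intro j
    simp only [lowerMatrix, Matrix.of_apply]
    rcases lt_trichotomy j m.succ with h | h | h
    · have h1 : j ≤ m.castSucc := Fin.le_castSucc_iff.mpr h
      simp [h.le, h1, h.ne]
    · subst h
      simp
    · have h1 : ¬ j ≤ m.castSucc := not_le.mpr (m.castSucc_lt_succ.trans h)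
      simp [h, h1, h.ne']
  simp only [h, Finset.sum_add_distrib, Finset.sum_ite_eq', Finset.mem_univ, if_true]

/-- A recursion along the nodes, with its summed form. -/
lemma forall_eq_add_iff {p : ℕ} (y : ℝ) (X S : Fin (p + 1) → ℝ) :
    (∀ m, X m = y + S m) ↔
      X 0 = y + S 0 ∧ ∀ m : Fin p, X m.succ = X m.castSucc + (S m.succ - S m.castSucc) := by
  constructor
  · intro h
    refine ⟨h 0, fun m => ?_⟩
    rw [h, h]; ring
  · rintro ⟨h0, h⟩ m
    induction m using Fin.induction with
    | zero => exact h0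
    | succ m ih => rw [h, ih]; ring

/-- Summing the marching recursion gives one vector equation, in which explicit and implicit Euler
differ only by their weights; later estimates need no case distinction. -/
lemma isEulerGuess_iff {p : ℕ} {f : ℝ → ℝ → ℝ} {a Δ y : ℝ} {V : Fin (p + 1) → ℝ} {g : Version} :
    IsEulerGuess p f a Δ y V g ↔ ∀ m, V m = y + (Δ / 2 * (startWeight p g * f a y)
      + Δ / 2 * ∑ j, lowerMatrix (gapWeight p g) g m j * f (stepNode p a Δ j) (V j)) := by
  rw [forall_eq_add_iff y V fun m => Δ / 2 * (startWeight p g * f a y)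
      + Δ / 2 * ∑ j, lowerMatrix (gapWeight p g) g m j * f (stepNode p a Δ j) (V j)]
  cases g
  · simp only [IsEulerGuess, sum_lowerMatrix_explicit_zero, sum_lowerMatrix_explicit_succ,
      startWeight, gapWeight, Fin.lastCases_castSucc]
    refine and_congr (Eq.congr_right ?_) (forall_congr' fun m => Eq.congr_right ?_)
    · simp only [stepNode]; ring
    · simp only [stepNode]; ring
  · simp only [IsEulerGuess, sum_lowerMatrix_implicit_zero, sum_lowerMatrix_implicit_succ,
      startWeight, gapWeight, Fin.cases_succ, Fin.cases_zero]
    refine and_congr (Eq.congr_right ?_) (forall_congr' fun m => Eq.congr_right ?_)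
    · simp only [stepNode]; ring
    · simp only [stepNode]; ring

/-- Consistency of Euler's method: it is exact for a constant right-hand side. -/
lemma startWeight_add_sum (p : ℕ) (g : Version) (m : Fin (p + 1)) :
    startWeight p g + ∑ j, lowerMatrix (gapWeight p g) g m j = radauNode p m + 1 := by
  -- On the step `[0, 2]` with right-hand side `1` and start `0`, the Euler values are the shifted
  -- nodes themselves.
  have h : IsEulerGuess p (fun _ _ => 1) 0 2 0 (fun m => radauNode p m + 1) g := by
    cases g <;> simp [IsEulerGuess, stepNode] <;> intro m <;> ring
  have := isEulerGuess_iff.mp h m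
  simp only [mul_one] at this
  linarith

lemma sweepTerm_zero (p : ℕ) (f : ℝ → ℝ → ℝ) (a Δ : ℝ) (V : Fin (p + 1) → ℝ) :
    sweepTerm p f a Δ V 0 = Δ / 2 * ∑ j, collocMatrix p 0 j * f (stepNode p a Δ j) (V j) := by
  simp only [sweepTerm, sweepMatrix_zero_mul_weight]

lemma sweepTerm_succ (p : ℕ) (f : ℝ → ℝ → ℝ) (a Δ : ℝ) (V : Fin (p + 1) → ℝ) (m : Fin p) :
    sweepTerm p f a Δ V m.succ
      = Δ / 2 * ∑ j, collocMatrix p m.succ j * f (stepNode p a Δ j) (V j)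
        - Δ / 2 * ∑ j, collocMatrix p m.castSucc j * f (stepNode p a Δ j) (V j) := by
  simp only [sweepTerm, sweepMatrix_succ_mul_weight, sub_mul, Finset.sum_sub_distrib, mul_sub]

/-- The quadrature terms telescope to `A F(V)`. At a fixed point `W = V` the triangular part drops
out and the Radau IIA equations remain. -/
lemma isSDGIteration_iff {p : ℕ} {f : ℝ → ℝ → ℝ} {a Δ y : ℝ} {V W : Fin (p + 1) → ℝ}
    {v : Version} : IsSDGIteration p f a Δ y V W v ↔ ∀ m, W m = y
      + (Δ / 2 * ∑ j, lowerMatrix (radauWeight p) v m j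
          * (f (stepNode p a Δ j) (W j) - f (stepNode p a Δ j) (V j))
        + Δ / 2 * ∑ j, collocMatrix p m j * f (stepNode p a Δ j) (V j)) := by
  rw [forall_eq_add_iff y W fun m => Δ / 2 * ∑ j, lowerMatrix (radauWeight p) v m j
          * (f (stepNode p a Δ j) (W j) - f (stepNode p a Δ j) (V j))
        + Δ / 2 * ∑ j, collocMatrix p m j * f (stepNode p a Δ j) (V j)]
  cases v
  · simp only [IsSDGIteration, sum_lowerMatrix_explicit_zero, sum_lowerMatrix_explicit_succ,
      sweepTerm_zero, sweepTerm_succ]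
    refine and_congr (Eq.congr_right ?_) (forall_congr' fun m => Eq.congr_right ?_) <;> ring
  · simp only [IsSDGIteration, sum_lowerMatrix_implicit_zero, sum_lowerMatrix_implicit_succ,
      sweepTerm_zero, sweepTerm_succ]
    refine and_congr (Eq.congr_right ?_) (forall_congr' fun m => Eq.congr_right ?_) <;> ring

/-! ### Existence and uniqueness of steps and runs. -/

/-- `W` consists of the iterates of one step of the method on `[a, a + Δ]` with value `y` at `a`. -/
structure IsStep (g v : Version) (p K : ℕ) (f : ℝ → ℝ → ℝ) (a Δ y : ℝ)
    (W : Fin (K + 1) → Fin (p + 1) → ℝ) : Prop where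
  guess : IsEulerGuess p f a Δ y (W 0) g
  iteration : ∀ k : Fin K, IsSDGIteration p f a Δ y (W k.castSucc) (W k.succ) v

lemma isSDGRun_iff {g v : Version} {p K : ℕ} {f : ℝ → ℝ → ℝ} {u₀ : ℝ} {N : ℕ}
    {t : Fin (N + 1) → ℝ} {U : Fin N → Fin (K + 1) → Fin (p + 1) → ℝ} :
    IsSDGRun g v p K f u₀ t U ↔ ∀ n : Fin N, IsStep g v p K f (t n.castSucc)
      (t n.succ - t n.castSucc) (meshValue u₀ U n.castSucc) (U n) :=
  ⟨fun h n => ⟨h.guess n, h.iteration n⟩, fun h => ⟨fun n => (h n).guess, fun n => (h n).iteration⟩⟩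

/-- A step depends only on the values of the right-hand side at the values of the step. -/
lemma IsStep.congr {g v : Version} {p K : ℕ} {f f' : ℝ → ℝ → ℝ} {a Δ y : ℝ}
    {W : Fin (K + 1) → Fin (p + 1) → ℝ} (h : IsStep g v p K f a Δ y W) (ha : f a y = f' a y)
    (hW : ∀ k j, f (stepNode p a Δ j) (W k j) = f' (stepNode p a Δ j) (W k j)) :
    IsStep g v p K f' a Δ y W := by
  refine ⟨isEulerGuess_iff.mpr ?_, fun k => isSDGIteration_iff.mpr ?_⟩
  · simpa only [ha, hW] using isEulerGuess_iff.mp h.guess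
  · simpa only [hW] using isSDGIteration_iff.mp (h.iteration k)

/-- A sequence in which each term determines the next one. -/
lemma existsUnique_fin_sequence {α : Type*} {n : ℕ} {P : α → Prop} {Q : Fin n → α → α → Prop}
    (hP : ∃! a, P a) (hQ : ∀ k a, ∃! b, Q k a b) :
    ∃! W : Fin (n + 1) → α, P (W 0) ∧ ∀ k : Fin n, Q k (W k.castSucc) (W k.succ) := by
  obtain ⟨a₀, ha₀, ha₀'⟩ := hP
  choose F hF hF' using hQ
  refine ⟨fun k => Fin.induction (motive := fun _ => α) a₀ (fun k a => F k a) k,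
    ⟨ha₀, fun k => hF k _⟩, ?_⟩
  rintro W ⟨h0, hW⟩
  ext k
  induction k using Fin.induction with
  | zero => exact ha₀' _ h0
  | succ k ih =>
    rw [hF' k _ _ (hW k), ih]
    rfl

lemma existsUnique_isStep {g v : Version} {p K : ℕ} {f : ℝ → ℝ → ℝ} {a Δ y : ℝ}
    (hg : ∃! V, IsEulerGuess p f a Δ y V g)
    (hv : ∀ V, ∃! W, IsSDGIteration p f a Δ y V W v) :
    ∃! W : Fin (K + 1) → Fin (p + 1) → ℝ, IsStep g v p K f a Δ y W := by
  obtain ⟨W, ⟨h1, h2⟩, h3⟩ := existsUnique_fin_sequence (n := K) hg fun _ V => hv V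
  exact ⟨W, ⟨h1, h2⟩, fun W' h => h3 W' ⟨h.guess, h.iteration⟩⟩

lemma existsUnique_isSDGRun {g v : Version} {p K : ℕ} {f : ℝ → ℝ → ℝ} {N : ℕ}
    {t : Fin (N + 1) → ℝ} (u₀ : ℝ)
    (h : ∀ (n : Fin N) (y : ℝ), ∃! W : Fin (K + 1) → Fin (p + 1) → ℝ,
      IsStep g v p K f (t n.castSucc) (t n.succ - t n.castSucc) y W) :
    ∃! U : Fin N → Fin (K + 1) → Fin (p + 1) → ℝ, IsSDGRun g v p K f u₀ t U := by
  choose S hS hS' using h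
  -- The mesh values forced on every run, obtained by iterating the solution map `S` of a single
  -- step.
  set y : Fin (N + 1) → ℝ := fun n => Fin.induction (motive := fun _ => ℝ) u₀
    (fun n y => S n y (Fin.last K) (Fin.last p)) n with hy
  have hmesh : ∀ U : Fin N → Fin (K + 1) → Fin (p + 1) → ℝ, IsSDGRun g v p K f u₀ t U →
      ∀ n, meshValue u₀ U n = y n := by
    intro U hU n
    induction n using Fin.induction with
    | zero => rfl
    | succ n ih =>
      have h1 := hS' n _ _ (isSDGRun_iff.mp hU n)
      rw [ih] at h1
      change U n (Fin.last K) (Fin.last p) = S n (y n.castSucc) (Fin.last K) (Fin.last p)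
      rw [h1]
  refine ⟨fun n => S n (y n.castSucc), ?_, fun U hU => ?_⟩
  · have h0 : ∀ n, meshValue u₀ (fun n => S n (y n.castSucc)) n = y n := by
      intro n
      refine Fin.cases rfl (fun n => rfl) n
    refine isSDGRun_iff.mpr fun n => ?_
    rw [h0]
    exact hS n _
  · ext1 n
    have := hS' n _ _ (isSDGRun_iff.mp hU n)
    rwa [hmesh U hU] at this

/-- Each value is given by a formula in the preceding one, so neither a Lipschitz bound nor a small
step is needed. -/
lemma existsUnique_isEulerGuess_explicit (p : ℕ) (f : ℝ → ℝ → ℝ) (a Δ y : ℝ) :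
    ∃! V, IsEulerGuess p f a Δ y V .explicit :=
  existsUnique_fin_sequence (P := fun z => z = _) (Q := fun _ z z' => z' = z + _ * f _ z)
    existsUnique_eq fun _ _ => existsUnique_eq

lemma existsUnique_isSDGIteration_explicit (p : ℕ) (f : ℝ → ℝ → ℝ) (a Δ y : ℝ)
    (V : Fin (p + 1) → ℝ) : ∃! W, IsSDGIteration p f a Δ y V W .explicit :=
  existsUnique_fin_sequence (P := fun z => z = _)
    (Q := fun m z z' => z' = z + Δ / 2 * radauWeight p m.castSucc
      * (f (stepNode p a Δ m.castSucc) z - f (stepNode p a Δ m.castSucc) (V m.castSucc))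
      + sweepTerm p f a Δ V m.succ)
    existsUnique_eq fun _ _ => existsUnique_eq

/-! ### Perturbation estimates for Lipschitz right-hand sides. -/

/-- The sum of the absolute values of the entries of a matrix. -/
def absSum {p : ℕ} (M : Matrix (Fin (p + 1)) (Fin (p + 1)) ℝ) : ℝ := ∑ m, ∑ j, |M m j|

lemma absSum_nonneg {p : ℕ} (M : Matrix (Fin (p + 1)) (Fin (p + 1)) ℝ) : 0 ≤ absSum M :=
  Finset.sum_nonneg fun _ _ => Finset.sum_nonneg fun _ _ => abs_nonneg _

lemma abs_sum_mul_le {p : ℕ} (M : Matrix (Fin (p + 1)) (Fin (p + 1)) ℝ) (m : Fin (p + 1))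
    {d : Fin (p + 1) → ℝ} {δ : ℝ} (hd : ∀ j, |d j| ≤ δ) :
    |∑ j, M m j * d j| ≤ absSum M * δ := by
  have hδ : 0 ≤ δ := (abs_nonneg _).trans (hd 0)
  calc |∑ j, M m j * d j| ≤ ∑ j, |M m j * d j| := Finset.abs_sum_le_sum_abs _ _
    _ ≤ ∑ j, |M m j| * δ := by
        refine Finset.sum_le_sum fun j _ => ?_
        rw [abs_mul]
        exact mul_le_mul_of_nonneg_left (hd j) (abs_nonneg _)
    _ = (∑ j, |M m j|) * δ := by rw [Finset.sum_mul]
    _ ≤ absSum M * δ := by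
        refine mul_le_mul_of_nonneg_right ?_ hδ
        exact Finset.single_le_sum (f := fun m => ∑ j, |M m j|)
          (fun _ _ => Finset.sum_nonneg fun _ _ => abs_nonneg _) (Finset.mem_univ m)

/-- A bound for all coefficients of a method. -/
noncomputable def stepBound (p : ℕ) (g v : Version) : ℝ :=
  |startWeight p g| + absSum (lowerMatrix (gapWeight p g) g)
    + absSum (lowerMatrix (radauWeight p) v) + absSum (collocMatrix p)

lemma stepBound_nonneg (p : ℕ) (g v : Version) : 0 ≤ stepBound p g v := by
  have h1 := absSum_nonneg (lowerMatrix (gapWeight p g) g)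
  have h2 := absSum_nonneg (lowerMatrix (radauWeight p) v)
  have h3 := absSum_nonneg (collocMatrix p)
  have h4 := abs_nonneg (startWeight p g)
  unfold stepBound
  positivity

lemma abs_startWeight_le (p : ℕ) (g v : Version) : |startWeight p g| ≤ stepBound p g v := by
  have h1 := absSum_nonneg (lowerMatrix (gapWeight p g) g)
  have h2 := absSum_nonneg (lowerMatrix (radauWeight p) v)
  have h3 := absSum_nonneg (collocMatrix p)
  unfold stepBound
  linarith

lemma absSum_gap_le (p : ℕ) (g v : Version) :
    absSum (lowerMatrix (gapWeight p g) g) ≤ stepBound p g v := by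
  have h1 := abs_nonneg (startWeight p g)
  have h2 := absSum_nonneg (lowerMatrix (radauWeight p) v)
  have h3 := absSum_nonneg (collocMatrix p)
  unfold stepBound
  linarith

lemma absSum_weight_le (p : ℕ) (g v : Version) :
    absSum (lowerMatrix (radauWeight p) v) ≤ stepBound p g v := by
  have h1 := abs_nonneg (startWeight p g)
  have h2 := absSum_nonneg (lowerMatrix (gapWeight p g) g)
  have h3 := absSum_nonneg (collocMatrix p)
  unfold stepBound
  linarith

lemma absSum_colloc_le (p : ℕ) (g v : Version) : absSum (collocMatrix p) ≤ stepBound p g v := by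
  have h1 := abs_nonneg (startWeight p g)
  have h2 := absSum_nonneg (lowerMatrix (gapWeight p g) g)
  have h3 := absSum_nonneg (lowerMatrix (radauWeight p) v)
  unfold stepBound
  linarith

section Lipschitz

variable {p : ℕ} {G : Fin (p + 1) → ℝ → ℝ} {L : ℝ}

lemma abs_sum_mul_sub_le (hL : ∀ j y z, |G j y - G j z| ≤ L * |y - z|) (hL0 : 0 ≤ L)
    {Δ β : ℝ} (hΔ : 0 ≤ Δ) {M : Matrix (Fin (p + 1)) (Fin (p + 1)) ℝ} (hM : absSum M ≤ β)
    (W W' : Fin (p + 1) → ℝ) (m : Fin (p + 1)) :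
    |Δ / 2 * ∑ j, M m j * G j (W j) - Δ / 2 * ∑ j, M m j * G j (W' j)|
      ≤ L * β * Δ / 2 * ‖W - W'‖ := by
  have h1 : Δ / 2 * ∑ j, M m j * G j (W j) - Δ / 2 * ∑ j, M m j * G j (W' j)
      = Δ / 2 * ∑ j, M m j * (G j (W j) - G j (W' j)) := by
    simp only [mul_sub, Finset.sum_sub_distrib]
  have h2 : ∀ j, |G j (W j) - G j (W' j)| ≤ L * ‖W - W'‖ := fun j =>
    (hL j _ _).trans (mul_le_mul_of_nonneg_left
      (by simpa [Real.norm_eq_abs] using norm_le_pi_norm (W - W') j) hL0)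
  rw [h1, abs_mul, abs_of_nonneg (by positivity : 0 ≤ Δ / 2)]
  calc Δ / 2 * |∑ j, M m j * (G j (W j) - G j (W' j))|
      ≤ Δ / 2 * (absSum M * (L * ‖W - W'‖)) := by
        gcongr; exact abs_sum_mul_le M m h2
    _ ≤ Δ / 2 * (β * (L * ‖W - W'‖)) := by gcongr
    _ = L * β * Δ / 2 * ‖W - W'‖ := by ring

/-- Banach's fixed point theorem in the maximum norm, covering both the Euler guess and a sweep. -/
lemma existsUnique_eq_add_sum (hL : ∀ j y z, |G j y - G j z| ≤ L * |y - z|) (hL0 : 0 ≤ L)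
    {Δ β : ℝ} (hΔ : 0 ≤ Δ) {M : Matrix (Fin (p + 1)) (Fin (p + 1)) ℝ} (hM : absSum M ≤ β)
    (hsmall : L * β * Δ ≤ 1 / 2) (c : Fin (p + 1) → ℝ) :
    ∃! W : Fin (p + 1) → ℝ, ∀ m, W m = c m + Δ / 2 * ∑ j, M m j * G j (W j) := by
  set F : (Fin (p + 1) → ℝ) → Fin (p + 1) → ℝ :=
    fun W m => c m + Δ / 2 * ∑ j, M m j * G j (W j) with hF
  have hcontr : ContractingWith (1 / 2) F := by
    refine ⟨by
      rw [← NNReal.coe_lt_coe]; norm_num, LipschitzWith.of_dist_le_mul fun W W' => ?_⟩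
    rw [dist_pi_le_iff (by positivity)]
    intro m
    rw [Real.dist_eq, dist_eq_norm]
    have h := abs_sum_mul_sub_le hL hL0 hΔ hM W W' m
    have h2 : F W m - F W' m
        = Δ / 2 * ∑ j, M m j * G j (W j) - Δ / 2 * ∑ j, M m j * G j (W' j) := by
      simp only [hF]; ring
    rw [h2]
    refine h.trans ?_
    have h3 := norm_nonneg (W - W')
    push_cast
    nlinarith
  refine ⟨hcontr.fixedPoint, fun m => ?_, fun W hW => ?_⟩
  · exact (congrFun hcontr.fixedPoint_isFixedPt m).symm
  · exact hcontr.fixedPoint_unique (funext fun m => (hW m).symm)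

/-- Arbitrary vectors `c`, `c'` give the estimate two uses: different starting values yield
stability, and the exact solution with its defect absorbed into `c'` yields consistency. -/
lemma guess_sub_le (hL : ∀ j y z, |G j y - G j z| ≤ L * |y - z|) (hL0 : 0 ≤ L)
    {Δ β : ℝ} (hΔ : 0 ≤ Δ) {E : Matrix (Fin (p + 1)) (Fin (p + 1)) ℝ} (hE : absSum E ≤ β)
    (hsmall : L * β * Δ ≤ 1 / 2) {V V' c c' : Fin (p + 1) → ℝ}
    (hV : ∀ m, V m = c m + Δ / 2 * ∑ j, E m j * G j (V j))
    (hV' : ∀ m, V' m = c' m + Δ / 2 * ∑ j, E m j * G j (V' j)) :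
    ‖V - V'‖ ≤ 2 * ‖c - c'‖ := by
  have h : ‖V - V'‖ ≤ ‖c - c'‖ + 1 / 2 * ‖V - V'‖ := by
    rw [pi_norm_le_iff_of_nonneg (by positivity)]
    intro m
    have h1 := abs_sum_mul_sub_le hL hL0 hΔ hE V V' m
    have h2 : |c m - c' m| ≤ ‖c - c'‖ := by
      simpa [Real.norm_eq_abs] using norm_le_pi_norm (c - c') m
    have h3 : (V - V') m = (c m - c' m)
        + (Δ / 2 * ∑ j, E m j * G j (V j) - Δ / 2 * ∑ j, E m j * G j (V' j)) := by
      rw [Pi.sub_apply, hV m, hV' m]; ring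
    rw [Real.norm_eq_abs, h3]
    refine (abs_add_le _ _).trans (add_le_add h2 (h1.trans ?_))
    have := norm_nonneg (V - V')
    nlinarith
  linarith

/-- Subtracting `c - c'` isolates a contribution of size `O(Δ)`; without this a step would be stable
only with a constant such as `2` instead of `1 + O(Δ)`. -/
lemma abs_sweep_sub_sub_le (hL : ∀ j y z, |G j y - G j z| ≤ L * |y - z|) (hL0 : 0 ≤ L)
    {Δ β : ℝ} (hΔ : 0 ≤ Δ) {A B : Matrix (Fin (p + 1)) (Fin (p + 1)) ℝ} (hA : absSum A ≤ β)
    (hB : absSum B ≤ β) {V V' W W' c c' : Fin (p + 1) → ℝ}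
    (hW : ∀ m, W m = c m + (Δ / 2 * ∑ j, B m j * (G j (W j) - G j (V j))
      + Δ / 2 * ∑ j, A m j * G j (V j)))
    (hW' : ∀ m, W' m = c' m + (Δ / 2 * ∑ j, B m j * (G j (W' j) - G j (V' j))
      + Δ / 2 * ∑ j, A m j * G j (V' j))) (m : Fin (p + 1)) :
    |(W m - W' m) - (c m - c' m)|
      ≤ L * β * Δ / 2 * ‖W - W'‖ + L * β * Δ * ‖V - V'‖ := by
  have h1 := abs_sum_mul_sub_le hL hL0 hΔ hB W W' m
  have h2 := abs_sum_mul_sub_le hL hL0 hΔ hB V V' m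
  have h3 := abs_sum_mul_sub_le hL hL0 hΔ hA V V' m
  have h4 : (W m - W' m) - (c m - c' m)
      = (Δ / 2 * ∑ j, B m j * G j (W j) - Δ / 2 * ∑ j, B m j * G j (W' j))
        - (Δ / 2 * ∑ j, B m j * G j (V j) - Δ / 2 * ∑ j, B m j * G j (V' j))
        + (Δ / 2 * ∑ j, A m j * G j (V j) - Δ / 2 * ∑ j, A m j * G j (V' j)) := by
    rw [hW m, hW' m]
    simp only [mul_sub, Finset.sum_sub_distrib]
    ring
  rw [h4]
  refine (abs_add_le _ _).trans ?_
  have h5 := abs_sub (Δ / 2 * ∑ j, B m j * G j (W j) - Δ / 2 * ∑ j, B m j * G j (W' j))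
    (Δ / 2 * ∑ j, B m j * G j (V j) - Δ / 2 * ∑ j, B m j * G j (V' j))
  linarith

/-- The factor `Δ` in front of `‖V - V'‖` is why each sweep gains one order. -/
lemma sweep_sub_le (hL : ∀ j y z, |G j y - G j z| ≤ L * |y - z|) (hL0 : 0 ≤ L)
    {Δ β : ℝ} (hΔ : 0 ≤ Δ) {A B : Matrix (Fin (p + 1)) (Fin (p + 1)) ℝ} (hA : absSum A ≤ β)
    (hB : absSum B ≤ β) (hsmall : L * β * Δ ≤ 1 / 2) {V V' W W' c c' : Fin (p + 1) → ℝ}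
    (hW : ∀ m, W m = c m + (Δ / 2 * ∑ j, B m j * (G j (W j) - G j (V j))
      + Δ / 2 * ∑ j, A m j * G j (V j)))
    (hW' : ∀ m, W' m = c' m + (Δ / 2 * ∑ j, B m j * (G j (W' j) - G j (V' j))
      + Δ / 2 * ∑ j, A m j * G j (V' j))) :
    ‖W - W'‖ ≤ 2 * ‖c - c'‖ + 2 * (L * β * Δ) * ‖V - V'‖ := by
  have hβ : 0 ≤ β := (absSum_nonneg A).trans hA
  have h : ‖W - W'‖ ≤ ‖c - c'‖ + L * β * Δ * ‖V - V'‖ + 1 / 2 * ‖W - W'‖ := by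
    rw [pi_norm_le_iff_of_nonneg (by positivity)]
    intro m
    have h1 := abs_sweep_sub_sub_le hL hL0 hΔ hA hB hW hW' m
    have h2 : |c m - c' m| ≤ ‖c - c'‖ := by
      simpa [Real.norm_eq_abs] using norm_le_pi_norm (c - c') m
    have h3 : (W - W') m = (c m - c' m) + ((W m - W' m) - (c m - c' m)) := by
      rw [Pi.sub_apply]; ring
    rw [Real.norm_eq_abs, h3]
    refine (abs_add_le _ _).trans ?_
    have := norm_nonneg (W - W')
    nlinarith
  linarith

end Lipschitz

/-! ### Stability of a single step. -/

section Step

variable {p K : ℕ} {g v : Version} {f : ℝ → ℝ → ℝ} {L a Δ : ℝ}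

lemma existsUnique_isEulerGuess (hL : ∀ t y z, |f t y - f t z| ≤ L * |y - z|) (hL0 : 0 ≤ L)
    (hΔ : 0 ≤ Δ) (hsmall : L * stepBound p g v * Δ ≤ 1 / 2) (y : ℝ) :
    ∃! V, IsEulerGuess p f a Δ y V g := by
  have h := existsUnique_eq_add_sum (G := fun j => f (stepNode p a Δ j)) (fun j => hL _) hL0 hΔ
    (absSum_gap_le p g v) hsmall fun _ => y + Δ / 2 * (startWeight p g * f a y)
  simpa only [isEulerGuess_iff, ← add_assoc] using h

lemma existsUnique_isSDGIteration (hL : ∀ t y z, |f t y - f t z| ≤ L * |y - z|) (hL0 : 0 ≤ L)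
    (hΔ : 0 ≤ Δ) (hsmall : L * stepBound p g v * Δ ≤ 1 / 2) (y : ℝ) (V : Fin (p + 1) → ℝ) :
    ∃! W, IsSDGIteration p f a Δ y V W v := by
  have h := existsUnique_eq_add_sum (G := fun j => f (stepNode p a Δ j)) (fun j => hL _) hL0 hΔ
    (absSum_weight_le p g v) hsmall fun m => y
      + (Δ / 2 * ∑ j, collocMatrix p m j * f (stepNode p a Δ j) (V j)
        - Δ / 2 * ∑ j, lowerMatrix (radauWeight p) v m j * f (stepNode p a Δ j) (V j))
  convert h using 3 with W
  rw [isSDGIteration_iff]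
  refine forall_congr' fun m => Eq.congr_right ?_
  simp only [mul_sub, Finset.sum_sub_distrib]
  ring

lemma norm_const_le (x : ℝ) : ‖(fun _ : Fin (p + 1) => x)‖ ≤ |x| := by
  rw [pi_norm_le_iff_of_nonneg (abs_nonneg _)]
  exact fun _ => le_rfl

/-- The iterates of a step depend on its starting value in a Lipschitz continuous way. -/
lemma IsStep.norm_sub_le (hL : ∀ t y z, |f t y - f t z| ≤ L * |y - z|) (hL0 : 0 ≤ L)
    (hΔ : 0 ≤ Δ) (hsmall : L * stepBound p g v * Δ ≤ 1 / 2) {y y' : ℝ}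
    {W W' : Fin (K + 1) → Fin (p + 1) → ℝ} (h : IsStep g v p K f a Δ y W)
    (h' : IsStep g v p K f a Δ y' W') (k : Fin (K + 1)) :
    ‖W k - W' k‖ ≤ (3 + 2 * k) * |y - y'| := by
  have hc : ∀ m : Fin (p + 1), (fun _ : Fin (p + 1) => y) m - (fun _ : Fin (p + 1) => y') m
    = y - y' := fun _ => rfl
  -- The guess contributes at most `2 · 5/4 ≤ 3`; each sweep adds `2` and multiplies the previous
  -- bound by at most `1`.
  induction k using Fin.induction with
  | zero =>
    have h1 := guess_sub_le (G := fun j => f (stepNode p a Δ j)) (fun j => hL _) hL0 hΔ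
      (absSum_gap_le p g v) hsmall (V := W 0) (V' := W' 0)
      (c := fun _ => y + Δ / 2 * (startWeight p g * f a y))
      (c' := fun _ => y' + Δ / 2 * (startWeight p g * f a y'))
      (by simpa only [isEulerGuess_iff, ← add_assoc] using h.guess)
      (by simpa only [isEulerGuess_iff, ← add_assoc] using h'.guess)
    have h2 : |(y + Δ / 2 * (startWeight p g * f a y)) - (y' + Δ / 2 * (startWeight p g * f a y'))|
        ≤ 5 / 4 * |y - y'| := by
      rw [show (y + Δ / 2 * (startWeight p g * f a y)) - (y' + Δ / 2 * (startWeight p g * f a y'))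
        = (y - y') + Δ / 2 * (startWeight p g * (f a y - f a y')) by ring]
      refine (abs_add_le _ _).trans ?_
      rw [abs_mul, abs_mul, abs_of_nonneg (by positivity : 0 ≤ Δ / 2)]
      have h3 : Δ / 2 * (|startWeight p g| * |f a y - f a y'|)
          ≤ Δ / 2 * (stepBound p g v * (L * |y - y'|)) := by
        have := stepBound_nonneg p g v
        gcongr
        · exact abs_startWeight_le p g v
        · exact hL a y y'
      have := abs_nonneg (y - y')
      nlinarith
    have h4 := (norm_const_le (p := p) ((y + Δ / 2 * (startWeight p g * f a y))
      - (y' + Δ / 2 * (startWeight p g * f a y')))).trans h2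
    have h5 : ‖W 0 - W' 0‖ ≤ 2 * (5 / 4 * |y - y'|) := h1.trans (by gcongr; exact h4)
    have := abs_nonneg (y - y')
    simp only [Fin.val_zero, Nat.cast_zero]
    linarith
  | succ k ih =>
    have h1 := sweep_sub_le (G := fun j => f (stepNode p a Δ j)) (fun j => hL _) hL0 hΔ
      (absSum_colloc_le p g v) (absSum_weight_le p g v) hsmall (c := fun _ => y) (c' := fun _ => y')
      (isSDGIteration_iff.mp (h.iteration k)) (isSDGIteration_iff.mp (h'.iteration k))
    have h2 : ‖(fun _ : Fin (p + 1) => y) - (fun _ => y')‖ ≤ |y - y'| := norm_const_le _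
    have h3 := norm_nonneg (W k.castSucc - W' k.castSucc)
    have h4 : 2 * (L * stepBound p g v * Δ) * ‖W k.castSucc - W' k.castSucc‖
        ≤ 1 * ‖W k.castSucc - W' k.castSucc‖ := by gcongr; linarith
    simp only [Fin.val_castSucc] at ih
    simp only [Fin.val_succ]
    push_cast
    linarith

/-- Stability of a step. -/
lemma IsStep.abs_last_sub_le (hL : ∀ t y z, |f t y - f t z| ≤ L * |y - z|) (hL0 : 0 ≤ L)
    (hΔ : 0 ≤ Δ) (hsmall : L * stepBound p g v * Δ ≤ 1 / 2) {y y' : ℝ}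
    {W W' : Fin (K + 1) → Fin (p + 1) → ℝ} (h : IsStep g v p K f a Δ y W)
    (h' : IsStep g v p K f a Δ y' W') (m : Fin (p + 1)) :
    |W (Fin.last K) m - W' (Fin.last K) m|
      ≤ (1 + 2 * (3 + 2 * K) * (L * stepBound p g v) * Δ) * |y - y'| := by
  have hβ := stepBound_nonneg p g v
  have hy := abs_nonneg (y - y')
  have hLb : ∀ k, ‖W k - W' k‖ ≤ (3 + 2 * K) * |y - y'| := fun k =>
    (h.norm_sub_le hL hL0 hΔ hsmall h' k).trans (by
      have : (k : ℝ) ≤ K := by exact_mod_cast Nat.lt_succ_iff.mp k.2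
      gcongr)
  -- Gronwall needs the factor `1 + O(Δ)`, so the deviation from `y - y'` is estimated rather than
  -- the difference itself.
  suffices hmain : |(W (Fin.last K) m - W' (Fin.last K) m) - (y - y')|
      ≤ 2 * (3 + 2 * K) * (L * stepBound p g v) * Δ * |y - y'| by
    have := abs_add_le ((W (Fin.last K) m - W' (Fin.last K) m) - (y - y')) (y - y')
    rw [sub_add_cancel] at this
    linarith
  -- Without sweeps the last iterate is the Euler guess, which obeys a different equation.
  rcases K with _ | K
  · have h1 := isEulerGuess_iff.mp h.guess m
    have h2 := isEulerGuess_iff.mp h'.guess m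
    have h3 := abs_sum_mul_sub_le (G := fun j => f (stepNode p a Δ j)) (fun j => hL _) hL0 hΔ
      (absSum_gap_le p g v) (W 0) (W' 0) m
    have h4 : |Δ / 2 * (startWeight p g * (f a y - f a y'))|
        ≤ Δ / 2 * (stepBound p g v * (L * |y - y'|)) := by
      rw [abs_mul, abs_mul, abs_of_nonneg (by positivity : 0 ≤ Δ / 2)]
      gcongr
      · exact abs_startWeight_le p g v
      · exact hL a y y'
    have h5 : L * stepBound p g v * Δ / 2 * ‖W 0 - W' 0‖
        ≤ L * stepBound p g v * Δ / 2 * ((3 + 2 * (0 : ℕ)) * |y - y'|) := by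
      gcongr; exact hLb 0
    have h6 := abs_add_le (Δ / 2 * (startWeight p g * (f a y - f a y')))
      (Δ / 2 * ∑ j, lowerMatrix (gapWeight p g) g m j * f (stepNode p a Δ j) (W 0 j)
        - Δ / 2 * ∑ j, lowerMatrix (gapWeight p g) g m j * f (stepNode p a Δ j) (W' 0 j))
    have h7 : (W (Fin.last 0) m - W' (Fin.last 0) m) - (y - y')
      = Δ / 2 * (startWeight p g * (f a y - f a y'))
      + (Δ / 2 * ∑ j, lowerMatrix (gapWeight p g) g m j * f (stepNode p a Δ j) (W 0 j)
        - Δ / 2 * ∑ j, lowerMatrix (gapWeight p g) g m j * f (stepNode p a Δ j) (W' 0 j)) := by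
      change (W 0 m - W' 0 m) - (y - y') = _
      rw [h1, h2]; ring
    rw [h7]
    have h8 : 0 ≤ L * stepBound p g v * Δ * |y - y'| := by positivity
    push_cast at h5 ⊢
    nlinarith
  · have h1 := abs_sweep_sub_sub_le (G := fun j => f (stepNode p a Δ j)) (fun j => hL _) hL0 hΔ
      (absSum_colloc_le p g v) (absSum_weight_le p g v) (c := fun _ => y) (c' := fun _ => y')
      (isSDGIteration_iff.mp (h.iteration (Fin.last K)))
      (isSDGIteration_iff.mp (h'.iteration (Fin.last K))) m
    have h2 := hLb (Fin.last K).succ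
    have h3 := hLb (Fin.last K).castSucc
    have h4 : L * stepBound p g v * Δ / 2 * ‖W (Fin.last K).succ - W' (Fin.last K).succ‖
        ≤ L * stepBound p g v * Δ / 2 * ((3 + 2 * ((K + 1 : ℕ) : ℝ)) * |y - y'|) := by gcongr
    have h5 : L * stepBound p g v * Δ * ‖W (Fin.last K).castSucc - W' (Fin.last K).castSucc‖
        ≤ L * stepBound p g v * Δ * ((3 + 2 * ((K + 1 : ℕ) : ℝ)) * |y - y'|) := by gcongr
    have h8 : 0 ≤ L * stepBound p g v * Δ * ((3 + 2 * ((K + 1 : ℕ) : ℝ)) * |y - y'|) := by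
      positivity
    rw [← Fin.succ_last]
    refine h1.trans ?_
    linarith

end Step

/-! ### Uniform Taylor expansions of families of functions. -/

section Jet

variable {ι : Type*} {Δ : ι → ℝ}

/-- The functions `φ i` on `[0, Δ i]` have Taylor expansions of order `r` at `0` with coefficients
and remainders that are bounded uniformly in `i`. -/
def HasJet (Δ : ι → ℝ) (r : ℕ) (φ : ι → ℝ → ℝ) : Prop :=
  ∃ c : ℕ → ι → ℝ, (∀ k, ∃ B, ∀ i, |c k i| ≤ B) ∧
    ∃ C, ∀ i, ∀ τ ∈ Set.Icc 0 (Δ i), |φ i τ - ∑ k ∈ Finset.range r, c k i * τ ^ k| ≤ C * τ ^ r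

lemma hasJet_zero_iff {φ : ι → ℝ → ℝ} :
    HasJet Δ 0 φ ↔ ∃ C, ∀ i, ∀ τ ∈ Set.Icc 0 (Δ i), |φ i τ| ≤ C := by
  constructor
  · rintro ⟨c, -, C, hC⟩
    exact ⟨C, by simpa using hC⟩
  · rintro ⟨C, hC⟩
    exact ⟨fun _ _ => 0, fun _ => ⟨0, by simp⟩, C, by simpa using hC⟩

/-- Splitting off the constant term and dividing by `τ` lowers the order by one, which makes
induction on the order possible. -/
lemma hasJet_succ_iff {r : ℕ} {φ : ι → ℝ → ℝ} :
    HasJet Δ (r + 1) φ ↔ ∃ c : ι → ℝ, (∃ B, ∀ i, |c i| ≤ B) ∧ ∃ ψ, HasJet Δ r ψ ∧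
      ∀ i, ∀ τ ∈ Set.Icc 0 (Δ i), φ i τ = c i + τ * ψ i τ := by
  constructor
  · rintro ⟨c, hc, C, hC⟩
    have hsum : ∀ i τ, ∑ k ∈ Finset.range (r + 1), c k i * τ ^ k
        = c 0 i + τ * ∑ k ∈ Finset.range r, c (k + 1) i * τ ^ k := by
      intro i τ
      rw [Finset.sum_range_succ', Finset.mul_sum, pow_zero, mul_one, add_comm]
      congr 1
      exact Finset.sum_congr rfl fun k _ => by ring
    -- At `τ = 0` the quotient is `0` by convention. This is harmless, since the remainder bound
    -- forces `φ i 0 = c 0 i`.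
    refine ⟨c 0, hc 0, fun i τ => ∑ k ∈ Finset.range r, c (k + 1) i * τ ^ k
      + (φ i τ - ∑ k ∈ Finset.range (r + 1), c k i * τ ^ k) / τ,
      ⟨fun k => c (k + 1), fun k => hc (k + 1), |C|, fun i τ hτ => ?_⟩, fun i τ hτ => ?_⟩
    · rw [add_sub_cancel_left, abs_div, abs_of_nonneg hτ.1]
      rcases eq_or_lt_of_le hτ.1 with h | h
      · rw [← h]; simp; positivity
      · rw [div_le_iff₀ h, mul_assoc, ← pow_succ]
        exact (hC i τ hτ).trans (mul_le_mul_of_nonneg_right (le_abs_self C) (by positivity))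
    · have h := hC i τ hτ
      simp only [hsum] at h ⊢
      rcases eq_or_lt_of_le hτ.1 with h0 | h0
      · rw [← h0] at h ⊢
        simp only [zero_mul, add_zero, pow_succ, mul_zero, abs_nonpos_iff] at h
        simp only [zero_mul, add_zero]
        linarith
      · rw [mul_add, mul_div_cancel₀ _ h0.ne']
        ring
  · rintro ⟨c, hc, ψ, ⟨d, hd, C, hC⟩, h⟩
    refine ⟨fun k => Nat.casesOn k c d, fun k => by cases k <;> simp [hc, hd], C,
      fun i τ hτ => ?_⟩
    rw [Finset.sum_range_succ', h i τ hτ]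
    have h1 : c i + τ * ψ i τ - (∑ k ∈ Finset.range r, d k i * τ ^ (k + 1) + c i * τ ^ 0)
        = τ * (ψ i τ - ∑ k ∈ Finset.range r, d k i * τ ^ k) := by
      rw [mul_sub, Finset.mul_sum]
      have : ∑ k ∈ Finset.range r, d k i * τ ^ (k + 1)
          = ∑ k ∈ Finset.range r, τ * (d k i * τ ^ k) :=
        Finset.sum_congr rfl fun k _ => by ring
      rw [this]; ring
    change |c i + τ * ψ i τ - (∑ k ∈ Finset.range r, d k i * τ ^ (k + 1) + c i * τ ^ 0)| ≤ _
    rw [h1, abs_mul, abs_of_nonneg hτ.1, pow_succ]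
    have := mul_le_mul_of_nonneg_left (hC i τ hτ) hτ.1
    linarith

lemma HasJet.add {r : ℕ} {φ ψ : ι → ℝ → ℝ} (h : HasJet Δ r φ) (h' : HasJet Δ r ψ) :
    HasJet Δ r fun i τ => φ i τ + ψ i τ := by
  obtain ⟨c, hc, C, hC⟩ := h
  obtain ⟨d, hd, D, hD⟩ := h'
  refine ⟨fun k i => c k i + d k i, fun k => ?_, C + D, fun i τ hτ => ?_⟩
  · obtain ⟨B, hB⟩ := hc k
    obtain ⟨B', hB'⟩ := hd k
    exact ⟨B + B', fun i => (abs_add_le _ _).trans (add_le_add (hB i) (hB' i))⟩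
  · simp only [add_mul, Finset.sum_add_distrib]
    rw [add_sub_add_comm]
    exact (abs_add_le _ _).trans (add_le_add (hC i τ hτ) (hD i τ hτ))

lemma HasJet.neg {r : ℕ} {φ : ι → ℝ → ℝ} (h : HasJet Δ r φ) : HasJet Δ r fun i τ => -φ i τ := by
  obtain ⟨c, hc, C, hC⟩ := h
  refine ⟨fun k i => -c k i, fun k => ?_, C, fun i τ hτ => ?_⟩
  · simpa only [abs_neg] using hc k
  · simp only [neg_mul, Finset.sum_neg_distrib]
    rw [neg_sub_neg, abs_sub_comm]
    exact hC i τ hτ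

lemma HasJet.sub {r : ℕ} {φ ψ : ι → ℝ → ℝ} (h : HasJet Δ r φ) (h' : HasJet Δ r ψ) :
    HasJet Δ r fun i τ => φ i τ - ψ i τ := by
  simpa only [sub_eq_add_neg] using h.add h'.neg

lemma HasJet.of_succ (hΔ : ∀ i, Δ i ≤ 1) {r : ℕ} {φ : ι → ℝ → ℝ} (h : HasJet Δ (r + 1) φ) :
    HasJet Δ r φ := by
  obtain ⟨c, hc, C, hC⟩ := h
  obtain ⟨B, hB⟩ := hc r
  refine ⟨c, hc, |C| + B, fun i τ hτ => ?_⟩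
  have h1 := hC i τ hτ
  rw [Finset.sum_range_succ] at h1
  have h2 : |c r i * τ ^ r| ≤ B * τ ^ r := by
    rw [abs_mul, abs_of_nonneg (pow_nonneg hτ.1 r)]
    exact mul_le_mul_of_nonneg_right (hB i) (pow_nonneg hτ.1 r)
  have h3 : C * τ ^ (r + 1) ≤ |C| * τ ^ r := by
    have h4 : τ ^ (r + 1) ≤ τ ^ r := pow_le_pow_of_le_one hτ.1 (hτ.2.trans (hΔ i)) (by omega)
    have h5 : 0 ≤ τ ^ (r + 1) := pow_nonneg hτ.1 _
    have h6 := le_abs_self C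
    have h7 := abs_nonneg C
    nlinarith
  have h8 := abs_add_le (φ i τ - (∑ k ∈ Finset.range r, c k i * τ ^ k + c r i * τ ^ r))
    (c r i * τ ^ r)
  rw [show φ i τ - (∑ k ∈ Finset.range r, c k i * τ ^ k + c r i * τ ^ r) + c r i * τ ^ r
    = φ i τ - ∑ k ∈ Finset.range r, c k i * τ ^ k by ring] at h8
  linarith

lemma HasJet.mono (hΔ : ∀ i, Δ i ≤ 1) {r s : ℕ} (hrs : r ≤ s) {φ : ι → ℝ → ℝ}
    (h : HasJet Δ s φ) : HasJet Δ r φ := by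
  induction s, hrs using Nat.le_induction with
  | base => exact h
  | succ s _ ih => exact ih (h.of_succ hΔ)

lemma HasJet.bounded (hΔ : ∀ i, Δ i ≤ 1) {r : ℕ} {φ : ι → ℝ → ℝ} (h : HasJet Δ r φ) :
    ∃ C, ∀ i, ∀ τ ∈ Set.Icc 0 (Δ i), |φ i τ| ≤ C :=
  hasJet_zero_iff.mp (h.mono hΔ (Nat.zero_le r))

lemma HasJet.id_mul (hΔ : ∀ i, Δ i ≤ 1) {r : ℕ} {φ : ι → ℝ → ℝ} (h : HasJet Δ r φ) :
    HasJet Δ r fun i τ => τ * φ i τ :=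
  (hasJet_succ_iff.mpr ⟨fun _ => 0, ⟨0, by simp⟩, φ, h, fun i τ _ => by simp⟩).of_succ hΔ

lemma HasJet.const_mul {r : ℕ} {φ : ι → ℝ → ℝ} {c : ι → ℝ} (hc : ∃ B, ∀ i, |c i| ≤ B)
    (h : HasJet Δ r φ) : HasJet Δ r fun i τ => c i * φ i τ := by
  obtain ⟨d, hd, C, hC⟩ := h
  obtain ⟨B, hB⟩ := hc
  refine ⟨fun k i => c i * d k i, fun k => ?_, B * C, fun i τ hτ => ?_⟩
  · obtain ⟨B', hB'⟩ := hd k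
    refine ⟨B * B', fun i => ?_⟩
    rw [abs_mul]
    exact mul_le_mul (hB i) (hB' i) (abs_nonneg _) ((abs_nonneg _).trans (hB i))
  · simp only [mul_assoc]
    rw [← Finset.mul_sum, ← mul_sub, abs_mul]
    exact mul_le_mul (hB i) (hC i τ hτ) (abs_nonneg _) ((abs_nonneg _).trans (hB i))

lemma HasJet.mul (hΔ : ∀ i, Δ i ≤ 1) {r : ℕ} {φ ψ : ι → ℝ → ℝ} (h : HasJet Δ r φ)
    (h' : HasJet Δ r ψ) : HasJet Δ r fun i τ => φ i τ * ψ i τ := by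
  induction r generalizing φ ψ with
  | zero =>
    rw [hasJet_zero_iff] at *
    obtain ⟨C, hC⟩ := h
    obtain ⟨D, hD⟩ := h'
    refine ⟨C * D, fun i τ hτ => ?_⟩
    rw [abs_mul]
    exact mul_le_mul (hC i τ hτ) (hD i τ hτ) (abs_nonneg _) ((abs_nonneg _).trans (hC i τ hτ))
  | succ r ih =>
    obtain ⟨c, hc, φ', hφ', hφ⟩ := hasJet_succ_iff.mp h
    obtain ⟨d, hd, ψ', hψ', hψ⟩ := hasJet_succ_iff.mp h'
    -- `(c + τ φ') (d + τ ψ') = c d + τ (c ψ' + d φ' + τ φ' ψ')`; here primes denote the quotients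
    -- by `τ`, not derivatives.
    refine hasJet_succ_iff.mpr ⟨fun i => c i * d i, ?_, _, ((hψ'.const_mul hc).add
      (hφ'.const_mul hd)).add ((ih hφ' hψ').id_mul hΔ), fun i τ hτ => ?_⟩
    · obtain ⟨B, hB⟩ := hc
      obtain ⟨B', hB'⟩ := hd
      refine ⟨B * B', fun i => ?_⟩
      rw [abs_mul]
      exact mul_le_mul (hB i) (hB' i) (abs_nonneg _) ((abs_nonneg _).trans (hB i))
    · rw [hφ i τ hτ, hψ i τ hτ]; ring

/-- Polynomials with bounded coefficients have expansions of any order. -/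
lemma hasJet_polynomial (hΔ : ∀ i, Δ i ≤ 1) {n : ℕ} {c : ℕ → ι → ℝ}
    (hc : ∀ k < n, ∃ B, ∀ i, |c k i| ≤ B) (r : ℕ) :
    HasJet Δ r fun i τ => ∑ k ∈ Finset.range n, c k i * τ ^ k := by
  refine HasJet.mono hΔ (le_max_left r n) ⟨fun k i => if k < n then c k i else 0, fun k => ?_, 0,
    fun i τ _ => ?_⟩
  · by_cases h : k < n
    · simpa [h] using hc k h
    · exact ⟨0, by simp [h]⟩
  · simp only [ite_mul, zero_mul, abs_nonpos_iff, sub_eq_zero]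
    rw [← Finset.sum_filter]
    refine Finset.sum_congr ?_ fun _ _ => rfl
    ext k
    simp only [Finset.mem_range, Finset.mem_filter]
    omega

/-- Primitives gain one order. -/
lemma HasJet.of_hasDerivWithinAt {r : ℕ} {φ φ' : ι → ℝ → ℝ} (h : HasJet Δ r φ')
    (hφ : ∀ i, ∀ τ ∈ Set.Icc 0 (Δ i), HasDerivWithinAt (φ i) (φ' i τ) (Set.Icc 0 (Δ i)) τ)
    (h0 : ∃ B, ∀ i, |φ i 0| ≤ B) : HasJet Δ (r + 1) φ := by
  obtain ⟨c, hc, C, hC⟩ := h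
  refine ⟨fun k i => Nat.casesOn k (φ i 0) fun k => c k i / (k + 1), fun k => ?_, |C|,
    fun i τ hτ => ?_⟩
  · cases k with
    | zero => exact h0
    | succ k =>
      obtain ⟨B, hB⟩ := hc k
      refine ⟨B / (k + 1), fun i => ?_⟩
      change |c k i / (k + 1)| ≤ _
      rw [abs_div, abs_of_pos (by positivity : (0 : ℝ) < k + 1)]
      exact div_le_div_of_nonneg_right (hB i) (by positivity)
  · have hsub : Set.Icc 0 τ ⊆ Set.Icc 0 (Δ i) := Set.Icc_subset_Icc_right hτ.2
    have hder : ∀ σ ∈ Set.Icc 0 τ, HasDerivWithinAt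
        (fun σ => φ i σ - ∑ k ∈ Finset.range r, c k i / (k + 1) * σ ^ (k + 1))
        (φ' i σ - ∑ k ∈ Finset.range r, c k i * σ ^ k) (Set.Icc 0 τ) σ := by
      intro σ hσ
      refine ((hφ i σ (hsub hσ)).mono hsub).sub (HasDerivAt.hasDerivWithinAt ?_)
      refine HasDerivAt.fun_sum fun k _ => ?_
      refine ((hasDerivAt_pow (k + 1) σ).const_mul (c k i / (k + 1))).congr_deriv ?_
      have : (k : ℝ) + 1 ≠ 0 := by positivity
      push_cast
      field_simp
    have hmv := (convex_Icc 0 τ).norm_image_sub_le_of_norm_hasDerivWithin_le (C := |C| * τ ^ r)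
      hder (fun σ hσ => by
        rw [Real.norm_eq_abs]
        refine (hC i σ (hsub hσ)).trans ?_
        have h1 : σ ^ r ≤ τ ^ r := pow_le_pow_left₀ hσ.1 hσ.2 r
        have h2 : 0 ≤ σ ^ r := pow_nonneg hσ.1 r
        have h3 := le_abs_self C
        have h4 := abs_nonneg C
        nlinarith) ⟨le_rfl, hτ.1⟩ ⟨hτ.1, le_rfl⟩
    rw [Finset.sum_range_succ']
    simp only [Real.norm_eq_abs, sub_zero, abs_of_nonneg hτ.1, zero_pow (Nat.succ_ne_zero _),
      mul_zero, Finset.sum_const_zero] at hmv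
    rw [pow_succ, ← mul_assoc]
    change |φ i τ - (∑ k ∈ Finset.range r, c k i / (k + 1) * τ ^ (k + 1) + φ i 0 * τ ^ 0)| ≤ _
    rw [pow_zero, mul_one, sub_add_eq_sub_sub]
    exact hmv

/-- Smooth functions of a curve have expansions of one order more than its derivative. -/
lemma HasJet.comp (hΔ : ∀ i, Δ i ≤ 1) {a : ι → ℝ} (ha : ∃ B, ∀ i, |a i| ≤ B)
    {w w' : ι → ℝ → ℝ}
    (hw : ∀ i, ∀ τ ∈ Set.Icc 0 (Δ i), HasDerivWithinAt (w i) (w' i τ) (Set.Icc 0 (Δ i)) τ)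
    (hw0 : ∃ B, ∀ i, |w i 0| ≤ B) {r : ℕ} {F : ℝ × ℝ → ℝ} (hF : ContDiff ℝ r F)
    (hw' : HasJet Δ (r - 1) w') : HasJet Δ r fun i τ => F (a i + τ, w i τ) := by
  have hbdd : ∀ F : ℝ × ℝ → ℝ, Continuous F →
      ∃ C, ∀ i, ∀ τ ∈ Set.Icc 0 (Δ i), |F (a i + τ, w i τ)| ≤ C := by
    intro F hF
    obtain ⟨B, hB⟩ := ha
    obtain ⟨D, hD⟩ := (hw'.of_hasDerivWithinAt hw hw0).bounded hΔ
    obtain ⟨C, hC⟩ := (isCompact_Icc.prod isCompact_Icc).exists_bound_of_continuousOn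
      (s := Set.Icc (-B) (B + 1) ×ˢ Set.Icc (-D) D) hF.continuousOn
    refine ⟨C, fun i τ hτ => hC _ ⟨?_, abs_le.mp (hD i τ hτ)⟩⟩
    have h1 := abs_le.mp (hB i)
    constructor
    · simp only; linarith [hτ.1]
    · simp only; linarith [hτ.2, hΔ i]
  induction r generalizing F with
  | zero => exact hasJet_zero_iff.mpr (hbdd F hF.continuous)
  | succ r ih =>
    -- By the chain rule the derivative along the curve is `F_t + w' F_y`. It has an expansion of
    -- order `r` by induction, and its primitive gains one order.
    have hF1 : Differentiable ℝ F := hF.differentiable (by simp)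
    have hF' : ContDiff ℝ r (fderiv ℝ F) := hF.fderiv_right (by push_cast; rfl)
    have hFe : ∀ e : ℝ × ℝ, ContDiff ℝ r fun q => fderiv ℝ F q e :=
      fun e => hF'.clm_apply contDiff_const
    have h1 := ih (hFe (1, 0)) (hw'.mono hΔ (by omega))
    have h2 := ih (hFe (0, 1)) (hw'.mono hΔ (by omega))
    rw [Nat.add_sub_cancel] at hw'
    refine (h1.add (hw'.mul hΔ h2)).of_hasDerivWithinAt (fun i τ hτ => ?_) ?_
    · have h3 : HasDerivWithinAt (fun τ => (a i + τ, w i τ)) ((1 : ℝ), w' i τ)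
          (Set.Icc 0 (Δ i)) τ :=
        ((hasDerivWithinAt_id τ _).const_add (a i)).prodMk (hw i τ hτ)
      have h4 := (hF1 (a i + τ, w i τ)).hasFDerivAt.comp_hasDerivWithinAt τ h3
      refine h4.congr_deriv ?_
      rw [show ((1 : ℝ), w' i τ) = (1, 0) + w' i τ • ((0 : ℝ), (1 : ℝ)) by simp, map_add,
        map_smul, smul_eq_mul]
    · obtain ⟨B, hB⟩ := ha
      obtain ⟨D, hD⟩ := hw0
      obtain ⟨C, hC⟩ := (isCompact_Icc.prod isCompact_Icc).exists_bound_of_continuousOn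
        (s := Set.Icc (-B) B ×ˢ Set.Icc (-D) D) hF.continuous.continuousOn
      refine ⟨C, fun i => hC _ ⟨?_, abs_le.mp (hD i)⟩⟩
      simpa using abs_le.mp (hB i)

/-- A rule that is exact for polynomials of degree less than `n` integrates functions with
expansions of order `n` up to an error of order `n + 1`. -/
lemma HasJet.abs_integral_sub_le {J : Type*} [Fintype J] {n : ℕ} {φ : ι → ℝ → ℝ}
    (h : HasJet Δ n φ) (hφ : ∀ i, ContinuousOn (φ i) (Set.Icc 0 (Δ i))) (hΔ : ∀ i, 0 ≤ Δ i)
    {α : J → ℝ} {σ : ι → J → ℝ} (hσ : ∀ i j, σ i j ∈ Set.Icc 0 (Δ i))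
    {θ : ι → ℝ} (hθ : ∀ i, θ i ∈ Set.Icc 0 (Δ i))
    (hexact : ∀ i, ∀ q : ℝ[X], q.degree < n →
      ∫ τ in (0 : ℝ)..θ i, q.eval τ = Δ i * ∑ j, α j * q.eval (σ i j)) :
    ∃ C, ∀ i, |(∫ τ in (0 : ℝ)..θ i, φ i τ) - Δ i * ∑ j, α j * φ i (σ i j)|
      ≤ C * Δ i ^ (n + 1) := by
  obtain ⟨c, -, C, hC⟩ := h
  refine ⟨|C| + (∑ j, |α j|) * |C|, fun i => ?_⟩
  -- The rule is exact on the Taylor polynomial `q`, so only the remainder of size `Δ^n`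
  -- contributes, and integration adds one power.
  set q : ℝ[X] := ∑ k ∈ Finset.range n, Polynomial.C (c k i) * X ^ k with hq
  have hqe : ∀ τ, q.eval τ = ∑ k ∈ Finset.range n, c k i * τ ^ k := fun τ => by
    simp [hq, eval_finsetSum]
  have hqdeg : q.degree < n := by
    refine mem_degreeLT.mp (Submodule.sum_mem _ fun k hk => mem_degreeLT.mpr ?_)
    exact (degree_C_mul_X_pow_le _ _).trans_lt (by exact_mod_cast Finset.mem_range.mp hk)
  have hrem : ∀ τ ∈ Set.Icc 0 (Δ i), |φ i τ - q.eval τ| ≤ |C| * Δ i ^ n := by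
    intro τ hτ
    rw [hqe]
    refine (hC i τ hτ).trans ?_
    have h1 : τ ^ n ≤ Δ i ^ n := pow_le_pow_left₀ hτ.1 hτ.2 n
    have h2 : 0 ≤ τ ^ n := pow_nonneg hτ.1 n
    have h3 := le_abs_self C
    have h4 := abs_nonneg C
    nlinarith
  have hsub : Set.uIcc 0 (θ i) ⊆ Set.Icc 0 (Δ i) := by
    rw [Set.uIcc_of_le (hθ i).1]
    exact Set.Icc_subset_Icc_right (hθ i).2
  have hint : IntervalIntegrable (φ i) MeasureTheory.volume 0 (θ i) :=
    ((hφ i).mono hsub).intervalIntegrable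
  have h1 : |∫ τ in (0 : ℝ)..θ i, (φ i τ - q.eval τ)| ≤ |C| * Δ i ^ n * Δ i := by
    have h2 := intervalIntegral.norm_integral_le_of_norm_le_const (a := 0) (b := θ i)
      (f := fun τ => φ i τ - q.eval τ) (C := |C| * Δ i ^ n) fun τ hτ =>
        hrem τ (hsub (Set.uIoc_subset_uIcc hτ))
    rw [Real.norm_eq_abs, sub_zero, abs_of_nonneg (hθ i).1] at h2
    refine h2.trans ?_
    have := hΔ i
    have := (hθ i).2
    gcongr
  have h3 : |∑ j, α j * (q.eval (σ i j) - φ i (σ i j))| ≤ (∑ j, |α j|) * (|C| * Δ i ^ n) := by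
    rw [Finset.sum_mul]
    refine (Finset.abs_sum_le_sum_abs _ _).trans (Finset.sum_le_sum fun j _ => ?_)
    rw [abs_mul, abs_sub_comm]
    exact mul_le_mul_of_nonneg_left (hrem _ (hσ i j)) (abs_nonneg _)
  have h4 : (∫ τ in (0 : ℝ)..θ i, φ i τ) - Δ i * ∑ j, α j * φ i (σ i j)
      = (∫ τ in (0 : ℝ)..θ i, (φ i τ - q.eval τ))
        + Δ i * ∑ j, α j * (q.eval (σ i j) - φ i (σ i j)) := by
    rw [intervalIntegral.integral_sub hint (polyInt _ _ _), hexact i q hqdeg]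
    simp only [mul_sub, Finset.sum_sub_distrib]
    ring
  rw [h4]
  refine (abs_add_le _ _).trans ?_
  rw [abs_mul, abs_of_nonneg (hΔ i)]
  have h5 := mul_le_mul_of_nonneg_left h3 (hΔ i)
  rw [pow_succ]
  linarith

end Jet

lemma integral_eq_sub_of_hasDerivWithinAt {φ φ' : ℝ → ℝ} {θ : ℝ} (hθ : 0 ≤ θ)
    (h : ∀ τ ∈ Set.Icc 0 θ, HasDerivWithinAt φ (φ' τ) (Set.Icc 0 θ) τ)
    (hφ' : ContinuousOn φ' (Set.Icc 0 θ)) : ∫ τ in (0 : ℝ)..θ, φ' τ = φ θ - φ 0 := by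
  refine intervalIntegral.integral_eq_sub_of_hasDeriv_right_of_le hθ
    (fun τ hτ => (h τ hτ).continuousWithinAt) (fun τ hτ => ?_) ?_
  · exact ((h τ (Set.Ioo_subset_Icc_self hτ)).hasDerivAt
      (Icc_mem_nhds hτ.1 hτ.2)).hasDerivWithinAt
  · rw [← Set.uIcc_of_le hθ] at hφ'
    exact hφ'.intervalIntegrable

/-! ### Expansions and defects of the exact solution. -/

section Solution

variable {f : ℝ → ℝ → ℝ} {T : ℝ} {u : ℝ → ℝ}

lemma hasDerivWithinAt_solution
    (hu : ∀ s ∈ Set.Icc 0 T, HasDerivWithinAt u (f s (u s)) (Set.Icc 0 T) s) {a Δ : ℝ}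
    (ha : 0 ≤ a) (haΔ : a + Δ ≤ T) {τ : ℝ} (hτ : τ ∈ Set.Icc 0 Δ) :
    HasDerivWithinAt (fun τ => u (a + τ)) (f (a + τ) (u (a + τ))) (Set.Icc 0 Δ) τ := by
  have h1 := hu (a + τ) ⟨by linarith [hτ.1], by linarith [hτ.2]⟩
  have h2 := h1.scomp τ ((hasDerivWithinAt_id τ (Set.Icc 0 Δ)).const_add a)
    (fun σ hσ => ⟨by linarith [hσ.1], by linarith [hσ.2]⟩)
  exact h2.congr_deriv (by simp)

lemma continuousOn_solution
    (hu : ∀ s ∈ Set.Icc 0 T, HasDerivWithinAt u (f s (u s)) (Set.Icc 0 T) s) {a Δ : ℝ}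
    (ha : 0 ≤ a) (haΔ : a + Δ ≤ T) : ContinuousOn (fun τ => u (a + τ)) (Set.Icc 0 Δ) :=
  fun _ hτ => (hasDerivWithinAt_solution hu ha haΔ hτ).continuousWithinAt

lemma continuousOn_solution_comp {F : ℝ → ℝ → ℝ} (hF : Continuous (Function.uncurry F))
    (hu : ∀ s ∈ Set.Icc 0 T, HasDerivWithinAt u (f s (u s)) (Set.Icc 0 T) s) {a Δ : ℝ}
    (ha : 0 ≤ a) (haΔ : a + Δ ≤ T) :
    ContinuousOn (fun τ => F (a + τ) (u (a + τ))) (Set.Icc 0 Δ) :=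
  hF.comp_continuousOn ((continuousOn_const.add continuousOn_id).prodMk
    (continuousOn_solution hu ha haΔ))

lemma exists_abs_solution_le
    (hu : ∀ s ∈ Set.Icc 0 T, HasDerivWithinAt u (f s (u s)) (Set.Icc 0 T) s) :
    ∃ M, ∀ s ∈ Set.Icc 0 T, |u s| ≤ M :=
  isCompact_Icc.exists_bound_of_continuousOn fun s hs => (hu s hs).continuousWithinAt

section Family

variable {ι : Type*} {a Δ : ι → ℝ}

/-- Smooth functions along a solution have uniform Taylor expansions. -/
lemma hasJet_solution_comp {n : ℕ} (hf : ContDiff ℝ n (Function.uncurry f))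
    (hu : ∀ s ∈ Set.Icc 0 T, HasDerivWithinAt u (f s (u s)) (Set.Icc 0 T) s)
    (ha : ∀ i, 0 ≤ a i) (hΔ0 : ∀ i, 0 ≤ Δ i) (hΔ : ∀ i, Δ i ≤ 1) (haΔ : ∀ i, a i + Δ i ≤ T)
    {F : ℝ → ℝ → ℝ} {r : ℕ} (hr : r ≤ n + 1) (hF : ContDiff ℝ r (Function.uncurry F)) :
    HasJet Δ r fun i τ => F (a i + τ) (u (a i + τ)) := by
  have ha' : ∃ B, ∀ i, |a i| ≤ B :=
    ⟨T, fun i => by rw [abs_of_nonneg (ha i)]; linarith [hΔ0 i, haΔ i]⟩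
  obtain ⟨M, hM⟩ := exists_abs_solution_le hu
  have hu0 : ∃ B, ∀ i, |u (a i + 0)| ≤ B :=
    ⟨M, fun i => hM _ ⟨by simpa using ha i, by linarith [hΔ0 i, haΔ i]⟩⟩
  have hder : ∀ i, ∀ τ ∈ Set.Icc 0 (Δ i), HasDerivWithinAt (fun τ => u (a i + τ))
      (f (a i + τ) (u (a i + τ))) (Set.Icc 0 (Δ i)) τ :=
    fun i τ hτ => hasDerivWithinAt_solution hu (ha i) (haΔ i) hτ
  have hcont : Continuous (Function.uncurry f) := hf.continuous
  have h0 : HasJet Δ 0 fun i τ => f (a i + τ) (u (a i + τ)) := by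
    obtain ⟨C, hC⟩ := (isCompact_Icc.prod isCompact_Icc).exists_bound_of_continuousOn
      (s := Set.Icc 0 T ×ˢ Set.Icc (-M) M) hcont.continuousOn
    refine hasJet_zero_iff.mpr ⟨C, fun i τ hτ => ?_⟩
    have hmem : a i + τ ∈ Set.Icc 0 T :=
      ⟨by linarith [ha i, hτ.1], by linarith [haΔ i, hτ.2]⟩
    exact hC (a i + τ, u (a i + τ)) ⟨hmem, abs_le.mp (hM _ hmem)⟩
  -- Bootstrapping: the differential equation makes this composite the derivative of `u`, so an
  -- expansion of order `k` for it yields one of order `k + 1`.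
  have hder' : ∀ k ≤ n, HasJet Δ k fun i τ => f (a i + τ) (u (a i + τ)) := by
    intro k
    induction k with
    | zero => exact fun _ => h0
    | succ k ih =>
      intro hk
      exact HasJet.comp hΔ ha' hder hu0 (F := Function.uncurry f)
        (hf.of_le (by exact_mod_cast hk)) (ih (by omega))
  exact HasJet.comp hΔ ha' hder hu0 (F := Function.uncurry F) hF (hder' (r - 1) (by omega))

variable {p : ℕ}

/-- The left side is the error of interpolatory quadrature up to node `m`, which is exact up to
degree `p`; hence the order `p + 2`. -/
lemma exists_colloc_defect_le {n : ℕ} (hn : p + 1 ≤ n)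
    (hf : ContDiff ℝ n (Function.uncurry f))
    (hu : ∀ s ∈ Set.Icc 0 T, HasDerivWithinAt u (f s (u s)) (Set.Icc 0 T) s)
    (ha : ∀ i, 0 ≤ a i) (hΔ0 : ∀ i, 0 ≤ Δ i) (hΔ : ∀ i, Δ i ≤ 1) (haΔ : ∀ i, a i + Δ i ≤ T)
    (m : Fin (p + 1)) :
    ∃ C, ∀ i, |u (a i + relNode p (Δ i) m) - u (a i) - Δ i / 2 * ∑ j, collocMatrix p m j
      * f (a i + relNode p (Δ i) j) (u (a i + relNode p (Δ i) j))| ≤ C * Δ i ^ (p + 2) := by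
  have hjet := hasJet_solution_comp hf hu ha hΔ0 hΔ haΔ (F := f) (r := p + 1) (by omega)
    (hf.of_le (by exact_mod_cast hn))
  have hcont := fun i => continuousOn_solution_comp hf.continuous hu (ha i) (haΔ i)
  obtain ⟨C, hC⟩ := hjet.abs_integral_sub_le hcont hΔ0
    (α := fun j => collocMatrix p m j / 2) (σ := fun i j => relNode p (Δ i) j)
    (fun i j => relNode_mem (hΔ0 i) j) (fun i => relNode_mem (hΔ0 i) m) (fun i q hq => by
      rw [integral_relNode (natDegree_le_of_degree_le (Order.le_of_lt_succ (by exact_mod_cast hq)))]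
      simp only [div_mul_eq_mul_div, ← Finset.sum_div]
      ring)
  refine ⟨C, fun i => ?_⟩
  have h := hC i
  have hsub : Set.Icc 0 (relNode p (Δ i) m) ⊆ Set.Icc 0 (Δ i) :=
    Set.Icc_subset_Icc_right (relNode_mem (hΔ0 i) m).2
  rw [integral_eq_sub_of_hasDerivWithinAt (φ := fun τ => u (a i + τ)) (relNode_mem (hΔ0 i) m).1
    (fun τ hτ => (hasDerivWithinAt_solution hu (ha i) (haΔ i) (hsub hτ)).mono hsub)
    ((hcont i).mono hsub)] at h
  simp only [div_mul_eq_mul_div, ← Finset.sum_div, add_zero] at h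
  convert h using 3
  ring

/-- Euler marching is a quadrature rule exact only for constants; hence the order `2`. -/
lemma exists_guess_defect_le {n : ℕ} (hn : 1 ≤ n)
    (hf : ContDiff ℝ n (Function.uncurry f))
    (hu : ∀ s ∈ Set.Icc 0 T, HasDerivWithinAt u (f s (u s)) (Set.Icc 0 T) s)
    (ha : ∀ i, 0 ≤ a i) (hΔ0 : ∀ i, 0 ≤ Δ i) (hΔ : ∀ i, Δ i ≤ 1) (haΔ : ∀ i, a i + Δ i ≤ T)
    (g : Version) (m : Fin (p + 1)) :
    ∃ C, ∀ i, |u (a i + relNode p (Δ i) m) - u (a i)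
      - Δ i / 2 * (startWeight p g * f (a i) (u (a i)))
      - Δ i / 2 * ∑ j, lowerMatrix (gapWeight p g) g m j
      * f (a i + relNode p (Δ i) j) (u (a i + relNode p (Δ i) j))| ≤ C * Δ i ^ 2 := by
  have hjet := hasJet_solution_comp hf hu ha hΔ0 hΔ haΔ (F := f) (r := 1) (by omega)
    (hf.of_le (by exact_mod_cast hn))
  have hcont := fun i => continuousOn_solution_comp hf.continuous hu (ha i) (haΔ i)
  -- `none` stands for the left end of the step, an additional quadrature point beside the nodes.
  obtain ⟨C, hC⟩ := hjet.abs_integral_sub_le hcont hΔ0 (J := Option (Fin (p + 1)))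
    (α := fun j => j.elim (startWeight p g / 2) fun j => lowerMatrix (gapWeight p g) g m j / 2)
    (σ := fun i j => j.elim 0 fun j => relNode p (Δ i) j)
    (fun i j => by
      cases j with
      | none => exact ⟨le_rfl, hΔ0 i⟩
      | some j => exact relNode_mem (hΔ0 i) j)
    (fun i => relNode_mem (hΔ0 i) m) (fun i q hq => by
      obtain ⟨c, rfl⟩ : ∃ c, q = C c :=
        ⟨_, eq_C_of_degree_le_zero (Order.le_of_lt_succ (by exact_mod_cast hq))⟩
      have h := startWeight_add_sum p g m
      simp only [eval_C, Fintype.sum_option, Option.elim, ← Finset.sum_mul, ← Finset.sum_div,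
        intervalIntegral.integral_const, smul_eq_mul, relNode]
      rw [← h]
      ring)
  refine ⟨C, fun i => ?_⟩
  have h := hC i
  have hsub : Set.Icc 0 (relNode p (Δ i) m) ⊆ Set.Icc 0 (Δ i) :=
    Set.Icc_subset_Icc_right (relNode_mem (hΔ0 i) m).2
  rw [integral_eq_sub_of_hasDerivWithinAt (φ := fun τ => u (a i + τ)) (relNode_mem (hΔ0 i) m).1
    (fun τ hτ => (hasDerivWithinAt_solution hu (ha i) (haΔ i) (hsub hτ)).mono hsub)
    ((hcont i).mono hsub)] at h
  simp only [Fintype.sum_option, Option.elim, div_mul_eq_mul_div, ← Finset.sum_div, add_zero] at h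
  refine (le_of_eq (congrArg _ ?_)).trans h
  ring

end Family

/-- The steps of length at most `1` inside `[0, T]`. -/
structure IsSubstep (T a Δ : ℝ) : Prop where
  left : 0 ≤ a
  pos : 0 < Δ
  le_one : Δ ≤ 1
  right : a + Δ ≤ T

lemma IsSubstep.node_mem {a Δ : ℝ} (h : IsSubstep T a Δ) {p : ℕ} (m : Fin (p + 1)) :
    a + relNode p Δ m ∈ Set.Icc 0 T := by
  have h1 := relNode_mem h.pos.le m
  exact ⟨by linarith [h.left, h1.1], by linarith [h.right, h1.2]⟩

lemma exists_le_of_forall_fin {n : ℕ} {α : Type*} {x : Fin n → α → ℝ} {y : α → ℝ}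
    (hy : ∀ b, 0 ≤ y b) (h : ∀ m, ∃ C, ∀ b, x m b ≤ C * y b) :
    ∃ C, 0 ≤ C ∧ ∀ m b, x m b ≤ C * y b := by
  choose C hC using h
  refine ⟨∑ m, |C m|, Finset.sum_nonneg fun _ _ => abs_nonneg _, fun m b => (hC m b).trans ?_⟩
  refine mul_le_mul_of_nonneg_right ((le_abs_self _).trans ?_) (hy b)
  exact Finset.single_le_sum (f := fun m => |C m|) (fun _ _ => abs_nonneg _) (Finset.mem_univ m)

/-! ### Stage errors, increments and residuals of a step that starts on the solution. -/

section Stages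

variable {p K : ℕ} {g v : Version} {f' : ℝ → ℝ → ℝ} {L : ℝ}

/-- The stages of a step that starts on the solution. -/
lemma exists_stage_error_le {n : ℕ} (hn : p + 1 ≤ n) (hf : ContDiff ℝ n (Function.uncurry f))
    (hu : ∀ s ∈ Set.Icc 0 T, HasDerivWithinAt u (f s (u s)) (Set.Icc 0 T) s)
    (hL : ∀ t y z, |f' t y - f' t z| ≤ L * |y - z|) (hL0 : 0 ≤ L)
    (hf' : ∀ t ∈ Set.Icc 0 T, f' t (u t) = f t (u t)) :
    ∃ C, 0 ≤ C ∧ ∀ (k : Fin (K + 1)) (a Δ : ℝ) (W : Fin (K + 1) → Fin (p + 1) → ℝ),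
      IsSubstep T a Δ → L * stepBound p g v * Δ ≤ 1 / 2 → IsStep g v p K f' a Δ (u a) W →
      ‖W k - fun m => u (a + relNode p Δ m)‖ ≤ C * Δ ^ (min (k : ℕ) p + 2) := by
  have hβ := stepBound_nonneg p g v
  -- Indexing by all admissible steps makes the constants independent of position and length.
  set ι := {q : ℝ × ℝ // IsSubstep T q.1 q.2}
  have hι : ∀ i : ι, IsSubstep T i.1.1 i.1.2 := fun i => i.2
  obtain ⟨C₁, hC₁, hguess⟩ := exists_le_of_forall_fin
    (y := fun i : ι => i.1.2 ^ 2) (fun i => by positivity) fun m =>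
    exists_guess_defect_le (p := p) (by omega) hf hu (fun i => (hι i).left)
      (fun i => (hι i).pos.le) (fun i => (hι i).le_one) (fun i => (hι i).right) g m
  obtain ⟨C₂, hC₂, hcolloc⟩ := exists_le_of_forall_fin
    (y := fun i : ι => i.1.2 ^ (p + 2)) (fun i => pow_nonneg (hι i).pos.le _) fun m =>
    exists_colloc_defect_le (p := p) hn hf hu (fun i => (hι i).left)
      (fun i => (hι i).pos.le) (fun i => (hι i).le_one) (fun i => (hι i).right) m
  suffices h : ∀ k : Fin (K + 1), ∃ C, 0 ≤ C ∧ ∀ (a Δ : ℝ) (W : Fin (K + 1) → Fin (p + 1) → ℝ),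
      IsSubstep T a Δ → L * stepBound p g v * Δ ≤ 1 / 2 → IsStep g v p K f' a Δ (u a) W →
      ‖W k - fun m => u (a + relNode p Δ m)‖ ≤ C * Δ ^ (min (k : ℕ) p + 2) by
    choose C hC0 hC using h
    refine ⟨∑ k, C k, Finset.sum_nonneg fun k _ => hC0 k, fun k a Δ W h1 h2 h3 => ?_⟩
    refine (hC k a Δ W h1 h2 h3).trans (mul_le_mul_of_nonneg_right ?_ (pow_nonneg h1.pos.le _))
    exact Finset.single_le_sum (f := C) (fun k _ => hC0 k) (Finset.mem_univ k)
  intro k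
  induction k using Fin.induction with
  | zero =>
    refine ⟨2 * C₁, by positivity, fun a Δ W h hsmall hW => ?_⟩
    -- The exact solution satisfies the Euler equations with the inhomogeneity `c'`, so `c - c'` is
    -- minus the defect.
    have h1 := guess_sub_le (G := fun j => f' (stepNode p a Δ j)) (fun j => hL _) hL0 h.pos.le
      (absSum_gap_le p g v) hsmall (V := W 0) (V' := fun m => u (a + relNode p Δ m))
      (c := fun _ => u a + Δ / 2 * (startWeight p g * f' a (u a)))
      (c' := fun m => u (a + relNode p Δ m) - Δ / 2 * ∑ j, lowerMatrix (gapWeight p g) g m j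
        * f' (stepNode p a Δ j) (u (a + relNode p Δ j)))
      (by simpa only [isEulerGuess_iff, ← add_assoc] using hW.guess)
      (fun m => by ring)
    refine h1.trans ?_
    have h2 : ‖(fun _ => u a + Δ / 2 * (startWeight p g * f' a (u a))) - fun m =>
        u (a + relNode p Δ m) - Δ / 2 * ∑ j, lowerMatrix (gapWeight p g) g m j
        * f' (stepNode p a Δ j) (u (a + relNode p Δ j))‖ ≤ C₁ * Δ ^ 2 := by
      rw [pi_norm_le_iff_of_nonneg (by positivity)]
      intro m
      have h3 := hguess m ⟨(a, Δ), h⟩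
      simp only at h3
      rw [Real.norm_eq_abs, Pi.sub_apply, abs_sub_comm]
      simp only [stepNode_eq, hf' _ (h.node_mem _),
        hf' a ⟨h.left, by linarith [h.right, h.pos]⟩]
      refine (le_of_eq (congrArg _ ?_)).trans h3
      ring
    simp only [Fin.val_zero, Nat.zero_min, zero_add]
    linarith
  | succ k ih =>
    obtain ⟨C, hC0, hC⟩ := ih
    refine ⟨2 * C₂ + 2 * (L * stepBound p g v) * C, by positivity, fun a Δ W h hsmall hW => ?_⟩
    have h1 := sweep_sub_le (G := fun j => f' (stepNode p a Δ j)) (fun j => hL _) hL0 h.pos.le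
      (absSum_colloc_le p g v) (absSum_weight_le p g v) hsmall (c := fun _ => u a)
      (W' := fun m => u (a + relNode p Δ m)) (V' := fun m => u (a + relNode p Δ m))
      (c' := fun m => u (a + relNode p Δ m) - Δ / 2 * ∑ j, collocMatrix p m j
        * f' (stepNode p a Δ j) (u (a + relNode p Δ j)))
      (isSDGIteration_iff.mp (hW.iteration k)) (fun m => by simp)
    have h2 : ‖(fun _ => u a) - fun m =>
        u (a + relNode p Δ m) - Δ / 2 * ∑ j, collocMatrix p m j
        * f' (stepNode p a Δ j) (u (a + relNode p Δ j))‖ ≤ C₂ * Δ ^ (p + 2) := by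
      have := h.pos
      rw [pi_norm_le_iff_of_nonneg (by positivity)]
      intro m
      have h3 := hcolloc m ⟨(a, Δ), h⟩
      simp only at h3
      rw [Real.norm_eq_abs, Pi.sub_apply, abs_sub_comm]
      simp only [stepNode_eq, hf' _ (h.node_mem _)]
      convert h3 using 2
      ring
    have h4 := hC a Δ W h hsmall hW
    have hΔ := h.pos
    -- The exponent rises by one through the factor `Δ` of the sweep, until the collocation defect
    -- caps it at `p + 2`.
    have h5 : Δ ^ (p + 2) ≤ Δ ^ (min (k.succ : ℕ) p + 2) :=
      pow_le_pow_of_le_one hΔ.le h.le_one (by omega)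
    have h6 : Δ * Δ ^ (min (k.castSucc : ℕ) p + 2) ≤ Δ ^ (min (k.succ : ℕ) p + 2) := by
      rw [← pow_succ']
      refine pow_le_pow_of_le_one hΔ.le h.le_one ?_
      simp only [Fin.val_succ, Fin.val_castSucc]
      omega
    calc _ ≤ _ := h1
      _ ≤ 2 * (C₂ * Δ ^ (p + 2)) + 2 * (L * stepBound p g v * Δ)
          * (C * Δ ^ (min (k.castSucc : ℕ) p + 2)) := by gcongr
      _ = 2 * C₂ * Δ ^ (p + 2) + 2 * (L * stepBound p g v) * C
          * (Δ * Δ ^ (min (k.castSucc : ℕ) p + 2)) := by ring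
      _ ≤ 2 * C₂ * Δ ^ (min (k.succ : ℕ) p + 2) + 2 * (L * stepBound p g v) * C
          * Δ ^ (min (k.succ : ℕ) p + 2) := by gcongr
      _ = _ := by ring

/-- The iterates of a step that starts on the solution converge. -/
lemma exists_increment_le {n : ℕ} (hn : p + 1 ≤ n) (hf : ContDiff ℝ n (Function.uncurry f))
    (hu : ∀ s ∈ Set.Icc 0 T, HasDerivWithinAt u (f s (u s)) (Set.Icc 0 T) s)
    (hL : ∀ t y z, |f' t y - f' t z| ≤ L * |y - z|) (hL0 : 0 ≤ L)
    (hf' : ∀ t ∈ Set.Icc 0 T, f' t (u t) = f t (u t)) (k : Fin K) :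
    ∃ C, 0 ≤ C ∧ ∀ (a Δ : ℝ) (W : Fin (K + 1) → Fin (p + 1) → ℝ),
      IsSubstep T a Δ → L * stepBound p g v * Δ ≤ 1 / 2 → IsStep g v p K f' a Δ (u a) W →
      ‖W k.succ - W k.castSucc‖ ≤ C * Δ ^ ((k : ℕ) + 2) := by
  have hβ := stepBound_nonneg p g v
  obtain ⟨k, hk⟩ := k
  induction k with
  | zero =>
    obtain ⟨C, hC0, hC⟩ := exists_stage_error_le (K := K) (g := g) (v := v) hn hf hu hL hL0 hf'
    refine ⟨2 * C, by positivity, fun a Δ W h hsmall hW => ?_⟩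
    have h1 := hC (Fin.succ ⟨0, hk⟩) a Δ W h hsmall hW
    have h2 := hC (Fin.castSucc ⟨0, hk⟩) a Δ W h hsmall hW
    have h3 : Δ ^ (min ((Fin.succ ⟨0, hk⟩ : Fin (K + 1)) : ℕ) p + 2) ≤ Δ ^ 2 :=
      pow_le_pow_of_le_one h.pos.le h.le_one (by omega)
    have h4 := norm_sub_le_norm_sub_add_norm_sub (W (Fin.succ ⟨0, hk⟩))
      (fun m => u (a + relNode p Δ m)) (W (Fin.castSucc ⟨0, hk⟩))
    rw [norm_sub_rev (fun m => u (a + relNode p Δ m))] at h4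
    simp only [Fin.val_castSucc, Nat.zero_min, zero_add] at h2 ⊢
    have h5 := mul_le_mul_of_nonneg_left h3 hC0
    linarith
  | succ k ih =>
    obtain ⟨C, hC0, hC⟩ := ih (by omega)
    refine ⟨2 * (L * stepBound p g v) * C, by positivity, fun a Δ W h hsmall hW => ?_⟩
    -- Consecutive iterates satisfy equations with the same inhomogeneity `u a`, so no defect enters
    -- and the exponent does not saturate at `p + 2`.
    have h1 := sweep_sub_le (G := fun j => f' (stepNode p a Δ j)) (fun j => hL _) hL0 h.pos.le
      (absSum_colloc_le p g v) (absSum_weight_le p g v) hsmall (c := fun _ => u a)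
      (c' := fun _ => u a) (isSDGIteration_iff.mp (hW.iteration ⟨k + 1, hk⟩))
      (isSDGIteration_iff.mp (hW.iteration ⟨k, by omega⟩))
    have h2 := hC a Δ W h hsmall hW
    rw [sub_self, norm_zero, mul_zero, zero_add] at h1
    have hΔ := h.pos
    calc _ ≤ _ := h1
      _ ≤ 2 * (L * stepBound p g v * Δ) * (C * Δ ^ (k + 2)) := by gcongr; exact h2
      _ = _ := by ring

/-- The last iterate of a step that starts on the solution solves the collocation equations up to
a small residual. -/
lemma exists_residual_le {n : ℕ} (hn : p + 1 ≤ n) (hf : ContDiff ℝ n (Function.uncurry f))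
    (hu : ∀ s ∈ Set.Icc 0 T, HasDerivWithinAt u (f s (u s)) (Set.Icc 0 T) s)
    (hL : ∀ t y z, |f' t y - f' t z| ≤ L * |y - z|) (hL0 : 0 ≤ L)
    (hf' : ∀ t ∈ Set.Icc 0 T, f' t (u t) = f t (u t)) (hK : 0 < K) :
    ∃ C, 0 ≤ C ∧ ∀ (a Δ : ℝ) (W : Fin (K + 1) → Fin (p + 1) → ℝ),
      IsSubstep T a Δ → L * stepBound p g v * Δ ≤ 1 / 2 → IsStep g v p K f' a Δ (u a) W →
      ∀ m, |W (Fin.last K) m - u a - Δ / 2 * ∑ j, collocMatrix p m j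
        * f' (a + relNode p Δ j) (W (Fin.last K) j)| ≤ C * Δ ^ (K + 2) := by
  have hβ := stepBound_nonneg p g v
  obtain ⟨K, rfl⟩ : ∃ k, K = k + 1 := ⟨K - 1, by omega⟩
  obtain ⟨C, hC0, hC⟩ := exists_increment_le (g := g) (v := v) hn hf hu hL hL0 hf' (Fin.last K)
  refine ⟨L * stepBound p g v * C, by positivity, fun a Δ W h hsmall hW m => ?_⟩
  have h1 := hC a Δ W h hsmall hW
  rw [Fin.succ_last] at h1
  have h2 := isSDGIteration_iff.mp (hW.iteration (Fin.last K)) m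
  have h3 := abs_sum_mul_sub_le (G := fun j => f' (stepNode p a Δ j)) (fun j => hL _) hL0 h.pos.le
      (absSum_weight_le p g v) (W (Fin.last K).succ) (W (Fin.last K).castSucc) m
  have h4 := abs_sum_mul_sub_le (G := fun j => f' (stepNode p a Δ j)) (fun j => hL _) hL0 h.pos.le
      (absSum_colloc_le p g v) (W (Fin.last K).succ) (W (Fin.last K).castSucc) m
  rw [Fin.succ_last] at h2 h3 h4
  have hΔ := h.pos
  simp only [mul_sub, Finset.sum_sub_distrib] at h2
  -- The residual is `Δ/2 (B - A)` applied to the change of `F` in the last sweep. The increment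
  -- there is `O(Δ^(K+1))` for `K` sweeps, and the prefactor supplies one more power.
  have h5 := abs_sub
    (Δ / 2 * ∑ j, lowerMatrix (radauWeight p) v m j * f' (stepNode p a Δ j) (W (Fin.last (K + 1)) j)
      - Δ / 2 * ∑ j, lowerMatrix (radauWeight p) v m j
        * f' (stepNode p a Δ j) (W (Fin.last K).castSucc j))
    (Δ / 2 * ∑ j, collocMatrix p m j * f' (stepNode p a Δ j) (W (Fin.last (K + 1)) j)
      - Δ / 2 * ∑ j, collocMatrix p m j * f' (stepNode p a Δ j) (W (Fin.last K).castSucc j))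
  calc _ = _ := by
        congr 1
        simp only [← stepNode_eq]
        linarith
    _ ≤ _ := h5
    _ ≤ _ := add_le_add h3 h4
    _ = L * stepBound p g v * Δ * ‖W (Fin.last (K + 1)) - W (Fin.last K).castSucc‖ := by ring
    _ ≤ L * stepBound p g v * Δ * (C * Δ ^ ((Fin.last K : ℕ) + 2)) := by gcongr
    _ = _ := by rw [Fin.val_last]; ring

end Stages

end Solution

/-! ### Lipschitz and Taylor estimates on boxes, and primitives. -/

/-- The partial derivative in the second variable. -/
noncomputable def partialSnd (F : ℝ → ℝ → ℝ) (t y : ℝ) : ℝ :=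
  fderiv ℝ (Function.uncurry F) (t, y) (0, 1)

lemma contDiff_partialSnd {F : ℝ → ℝ → ℝ} {n : ℕ}
    (hF : ContDiff ℝ (n + 1 : ℕ) (Function.uncurry F)) :
    ContDiff ℝ n (Function.uncurry (partialSnd F)) :=
  (hF.fderiv_right (m := n) (by push_cast; rfl)).clm_apply contDiff_const

lemma hasDerivAt_partialSnd {F : ℝ → ℝ → ℝ} (hF : ContDiff ℝ (1 : ℕ) (Function.uncurry F))
    (t y : ℝ) : HasDerivAt (F t) (partialSnd F t y) y :=
  ((hF.differentiable (by simp)) (t, y)).hasFDerivAt.comp_hasDerivAt y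
    ((hasDerivAt_const y t).prodMk (hasDerivAt_id y))

lemma exists_lipschitz_on_box {F : ℝ → ℝ → ℝ} (hF : ContDiff ℝ (1 : ℕ) (Function.uncurry F))
    (T R : ℝ) : ∃ L, 0 ≤ L ∧ ∀ t ∈ Set.Icc 0 T, ∀ y ∈ Set.Icc (-R) R, ∀ z ∈ Set.Icc (-R) R,
      |F t y - F t z| ≤ L * |y - z| := by
  obtain ⟨L, hL⟩ := (isCompact_Icc.prod isCompact_Icc).exists_bound_of_continuousOn
    (s := Set.Icc 0 T ×ˢ Set.Icc (-R) R)
    (contDiff_partialSnd (n := 0) (by simpa using hF)).continuous.continuousOn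
  refine ⟨|L|, abs_nonneg L, fun t ht y hy z hz => ?_⟩
  exact (convex_Icc (-R) R).norm_image_sub_le_of_norm_hasDerivWithin_le (C := |L|)
    (fun x _ => (hasDerivAt_partialSnd hF t x).hasDerivWithinAt)
    (fun x hx => (hL (t, x) ⟨ht, hx⟩).trans (le_abs_self L)) hz hy

/-- The mean value inequality is applied to `x ↦ F t x - partialSnd F t y * x`, whose derivative is
small because `partialSnd F` is Lipschitz on the box. -/
lemma exists_taylor_on_box {F : ℝ → ℝ → ℝ} (hF : ContDiff ℝ (2 : ℕ) (Function.uncurry F))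
    (T R : ℝ) : ∃ L, 0 ≤ L ∧ ∀ t ∈ Set.Icc 0 T, ∀ y ∈ Set.Icc (-R) R, ∀ z ∈ Set.Icc (-R) R,
      |F t z - F t y - partialSnd F t y * (z - y)| ≤ L * |z - y| ^ 2 := by
  obtain ⟨L, hL0, hL⟩ := exists_lipschitz_on_box (contDiff_partialSnd hF) T R
  refine ⟨L, hL0, fun t ht y hy z hz => ?_⟩
  have hsub : Set.uIcc y z ⊆ Set.Icc (-R) R := Set.ordConnected_Icc.uIcc_subset hy hz
  have hF1 : ContDiff ℝ (1 : ℕ) (Function.uncurry F) := hF.of_le (by norm_num)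
  have h := (convex_uIcc y z).norm_image_sub_le_of_norm_hasDerivWithin_le
    (f := fun x => F t x - partialSnd F t y * x)
    (f' := fun x => partialSnd F t x - partialSnd F t y * 1) (C := L * |z - y|)
    (fun x _ => ((hasDerivAt_partialSnd hF1 t x).sub
      ((hasDerivAt_id x).const_mul _)).hasDerivWithinAt)
    (fun x hx => by
      rw [mul_one, Real.norm_eq_abs]
      refine (hL t ht x (hsub hx) y hy).trans (mul_le_mul_of_nonneg_left ?_ hL0)
      exact Set.abs_sub_left_of_mem_uIcc hx)
    Set.left_mem_uIcc Set.right_mem_uIcc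
  rw [Real.norm_eq_abs, Real.norm_eq_abs] at h
  convert h using 1
  · congr 1; ring
  · ring

lemma exists_primitive_of_continuousOn {φ : ℝ → ℝ} {Δ : ℝ} (hΔ : 0 ≤ Δ)
    (hφ : ContinuousOn φ (Set.Icc 0 Δ)) : ∃ Φ : ℝ → ℝ, Φ 0 = 0 ∧
      ∀ τ ∈ Set.Icc 0 Δ, HasDerivWithinAt Φ (φ τ) (Set.Icc 0 Δ) τ := by
  have hcont : Continuous (Set.IccExtend hΔ (Set.domRestrict (Set.Icc 0 Δ) φ)) :=
    hφ.domRestrict.Icc_extend'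
  refine ⟨fun τ => ∫ s in (0 : ℝ)..τ, Set.IccExtend hΔ (Set.domRestrict (Set.Icc 0 Δ) φ) s,
    by simp, fun τ hτ => ?_⟩
  have h := (hcont.integral_hasStrictDerivAt 0 τ).hasDerivAt.hasDerivWithinAt (s := Set.Icc 0 Δ)
  rwa [Set.IccExtend_of_mem _ _ hτ] at h

/-! ### Superconvergence at the end of a step. -/

section Superconvergence

variable {f : ℝ → ℝ → ℝ} {T : ℝ} {u : ℝ → ℝ} {p : ℕ} {ι : Type*} {a Δ : ι → ℝ}

/-- Approximate collocation solutions extend to polynomials near the solution. -/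
lemma exists_colloc_polynomial {n : ℕ} (hn : p + 1 ≤ n)
    (hf : ContDiff ℝ n (Function.uncurry f))
    (hu : ∀ s ∈ Set.Icc 0 T, HasDerivWithinAt u (f s (u s)) (Set.Icc 0 T) s)
    (hstep : ∀ i, IsSubstep T (a i) (Δ i)) {W : ι → Fin (p + 1) → ℝ} {C₁ : ℝ} (hC₁ : 0 ≤ C₁)
    (hW : ∀ i j, |W i j - u (a i + relNode p (Δ i) j)| ≤ C₁ * Δ i ^ (p + 2)) :
    ∃ w w' : ι → ℝ → ℝ, (∀ r, HasJet Δ r w') ∧ (∀ i, Continuous (w' i)) ∧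
      (∀ i, ∀ τ ∈ Set.Icc 0 (Δ i), HasDerivWithinAt (w i) (w' i τ) (Set.Icc 0 (Δ i)) τ) ∧
      (∀ i, w i 0 = u (a i)) ∧
      (∀ i j, w' i (relNode p (Δ i) j) = f (a i + relNode p (Δ i) j) (W i j)) ∧
      (∀ i m, w i (relNode p (Δ i) m) = u (a i) + Δ i / 2 * ∑ j, collocMatrix p m j
        * f (a i + relNode p (Δ i) j) (W i j)) ∧
      ∃ C, 0 ≤ C ∧ ∀ i, ∀ τ ∈ Set.Icc 0 (Δ i), |w i τ - u (a i + τ)| ≤ C * Δ i ^ (p + 2) := by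
  have hΔ0 : ∀ i, 0 ≤ Δ i := fun i => (hstep i).pos.le
  have hΔ : ∀ i, Δ i ≤ 1 := fun i => (hstep i).le_one
  obtain ⟨M, hM⟩ := exists_abs_solution_le hu
  obtain ⟨L, hL0, hL⟩ := exists_lipschitz_on_box
    (hf.of_le (by exact_mod_cast (by omega : 1 ≤ n))) T (M + C₁)
  obtain ⟨c, hc, C, hC⟩ := hasJet_solution_comp hf hu (fun i => (hstep i).left) hΔ0 hΔ
    (fun i => (hstep i).right) (F := f) (r := p + 1) (by omega) (hf.of_le (by exact_mod_cast hn))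
  -- `Q` is the Taylor polynomial of `u'`. The interpolant `w'` of the values `f(t_j, W_j)` is built
  -- as a correction of `Q`, since bounds on its coefficients are not visible from interpolation on
  -- a shrinking interval.
  set Q : ι → ℝ → ℝ := fun i τ => ∑ k ∈ Finset.range (p + 1), c k i * τ ^ k with hQ
  have hQU : ∀ i, ∀ τ ∈ Set.Icc 0 (Δ i),
      |f (a i + τ) (u (a i + τ)) - Q i τ| ≤ |C| * Δ i ^ (p + 1) := by
    intro i τ hτ
    refine (hC i τ hτ).trans ?_
    have h1 : τ ^ (p + 1) ≤ Δ i ^ (p + 1) := pow_le_pow_left₀ hτ.1 hτ.2 _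
    have h2 : 0 ≤ τ ^ (p + 1) := pow_nonneg hτ.1 _
    have h3 := le_abs_self C
    have h4 := abs_nonneg C
    nlinarith
  set d : ι → Fin (p + 1) → ℝ := fun i j =>
    f (a i + relNode p (Δ i) j) (W i j) - Q i (relNode p (Δ i) j) with hd
  set D : ℝ := L * C₁ + |C| with hD
  have hD0 : 0 ≤ D := by positivity
  have hdD : ∀ i j, |d i j| ≤ D * Δ i ^ (p + 1) := by
    intro i j
    have h1 := hM _ ((hstep i).node_mem j)
    have h2 : |W i j - u (a i + relNode p (Δ i) j)| ≤ C₁ * Δ i ^ (p + 1) :=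
      (hW i j).trans (mul_le_mul_of_nonneg_left
        (pow_le_pow_of_le_one (hΔ0 i) (hΔ i) (by omega)) hC₁)
    have h3 : |W i j - u (a i + relNode p (Δ i) j)| ≤ C₁ :=
      (hW i j).trans (mul_le_of_le_one_right hC₁ (pow_le_one₀ (hΔ0 i) (hΔ i)))
    have h4 := hL _ ((hstep i).node_mem j) (W i j) (by
      rw [abs_le] at h1 h3
      constructor <;> linarith [h1.1, h1.2, h3.1, h3.2]) (u (a i + relNode p (Δ i) j)) (by
      rw [abs_le] at h1
      constructor <;> linarith [h1.1, h1.2])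
    have h5 := hQU i _ (relNode_mem (hΔ0 i) j)
    have h6 := abs_add_le (f (a i + relNode p (Δ i) j) (W i j)
      - f (a i + relNode p (Δ i) j) (u (a i + relNode p (Δ i) j)))
      (f (a i + relNode p (Δ i) j) (u (a i + relNode p (Δ i) j)) - Q i (relNode p (Δ i) j))
    rw [sub_add_sub_cancel] at h6
    have h7 := mul_le_mul_of_nonneg_left h2 hL0
    simp only [hd, hD]
    linarith
  set Λ : Fin (p + 1) → ℝ[X] := fun j => (nodalBasis p j).comp (Polynomial.C 2 * X + Polynomial.C (-1)) with hΛ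
  have hΛdeg : ∀ j, (Λ j).natDegree < p + 1 := by
    intro j
    refine Nat.lt_succ_of_le (natDegree_comp_le.trans ?_)
    rw [nodalBasis_natDegree]
    have : (Polynomial.C 2 * X + Polynomial.C (-1) : ℝ[X]).natDegree ≤ 1 := natDegree_linear_le
    exact (Nat.mul_le_mul_left p this).trans (by rw [mul_one])
  have hΛnode : ∀ i j m, (Λ j).eval (relNode p (Δ i) m / Δ i) = if j = m then 1 else 0 := by
    intro i j m
    rw [← nodalBasis_eval_node j m]
    have := (hstep i).pos.ne'
    simp only [hΛ, eval_comp, eval_add, eval_mul, eval_C, eval_X, relNode]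
    congr 1
    field_simp
    ring
  -- Rescaling the basis from `[0, 1]` to `[0, Δ]` produces `Δ^(-k)` with `k ≤ p`, which is
  -- compensated by `d = O(Δ^(p+1))`.
  set c' : ℕ → ι → ℝ := fun k i => c k i + ∑ j, d i j * (Λ j).coeff k / Δ i ^ k with hc'
  set w' : ι → ℝ → ℝ := fun i τ => ∑ k ∈ Finset.range (p + 1), c' k i * τ ^ k with hw'
  have hw'Q : ∀ i τ, w' i τ = Q i τ + ∑ j, d i j * (Λ j).eval (τ / Δ i) := by
    intro i τ
    simp only [hw', hQ, hc', add_mul, Finset.sum_add_distrib, Finset.sum_mul]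
    congr 1
    rw [Finset.sum_comm]
    refine Finset.sum_congr rfl fun j _ => ?_
    rw [eval_eq_sum_range' (hΛdeg j), Finset.mul_sum]
    refine Finset.sum_congr rfl fun k _ => ?_
    rw [div_pow]
    ring
  have hc'bdd : ∀ k < p + 1, ∃ B, ∀ i, |c' k i| ≤ B := by
    intro k hk
    obtain ⟨B, hB⟩ := hc k
    refine ⟨B + ∑ j, D * |(Λ j).coeff k|, fun i => (abs_add_le _ _).trans (add_le_add (hB i) ?_)⟩
    refine (Finset.abs_sum_le_sum_abs _ _).trans (Finset.sum_le_sum fun j _ => ?_)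
    have hΔk : 0 < Δ i ^ k := pow_pos (hstep i).pos k
    rw [abs_div, abs_mul, abs_of_pos hΔk, div_le_iff₀ hΔk]
    have h1 : |d i j| ≤ D * Δ i ^ k := (hdD i j).trans (mul_le_mul_of_nonneg_left
      (pow_le_pow_of_le_one (hΔ0 i) (hΔ i) hk.le) hD0)
    calc |d i j| * |(Λ j).coeff k| ≤ D * Δ i ^ k * |(Λ j).coeff k| := by gcongr
      _ = _ := by ring
  have hw'poly : ∀ i, ∃ q : ℝ[X], q.natDegree ≤ p ∧ ∀ τ, q.eval τ = w' i τ := by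
    intro i
    refine ⟨∑ k ∈ Finset.range (p + 1), Polynomial.C (c' k i) * X ^ k, ?_, fun τ => by
      simp [hw', eval_finsetSum]⟩
    refine natDegree_sum_le_of_forall_le _ _ fun k hk => ?_
    have := Finset.mem_range.mp hk
    exact (natDegree_C_mul_X_pow_le _ _).trans (by omega)
  have hw'cont : ∀ i, Continuous (w' i) := fun i => by
    obtain ⟨q, -, hq⟩ := hw'poly i
    rw [show w' i = fun τ => q.eval τ from funext fun τ => (hq τ).symm]
    exact q.continuous
  have hw'node : ∀ i j, w' i (relNode p (Δ i) j) = f (a i + relNode p (Δ i) j) (W i j) := by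
    intro i j
    rw [hw'Q]
    simp [hΛnode, hd]
  obtain ⟨S, hS⟩ : ∃ S, ∀ j, ∀ x ∈ Set.Icc (0 : ℝ) 1, |(Λ j).eval x| ≤ S := by
    have h := fun j => isCompact_Icc.exists_bound_of_continuousOn (s := Set.Icc (0 : ℝ) 1)
      (Λ j).continuous.continuousOn
    choose S hS using h
    refine ⟨∑ j, |S j|, fun j x hx => (hS j x hx).trans ((le_abs_self _).trans ?_)⟩
    exact Finset.single_le_sum (f := fun j => |S j|) (fun _ _ => abs_nonneg _) (Finset.mem_univ j)
  have hS0 : 0 ≤ S := (abs_nonneg _).trans (hS 0 0 ⟨le_rfl, zero_le_one⟩)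
  set E : ℝ := |C| + (p + 1) * (D * S) with hE
  have hw'U : ∀ i, ∀ τ ∈ Set.Icc 0 (Δ i),
      |w' i τ - f (a i + τ) (u (a i + τ))| ≤ E * Δ i ^ (p + 1) := by
    intro i τ hτ
    have hx : τ / Δ i ∈ Set.Icc (0 : ℝ) 1 :=
      ⟨div_nonneg hτ.1 (hΔ0 i), (div_le_one (hstep i).pos).mpr hτ.2⟩
    have h1 : |∑ j, d i j * (Λ j).eval (τ / Δ i)| ≤ (p + 1) * (D * S) * Δ i ^ (p + 1) := by
      refine (Finset.abs_sum_le_sum_abs _ _).trans ?_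
      calc ∑ j, |d i j * (Λ j).eval (τ / Δ i)|
          ≤ ∑ _j : Fin (p + 1), D * Δ i ^ (p + 1) * S := by
            refine Finset.sum_le_sum fun j _ => ?_
            rw [abs_mul]
            exact mul_le_mul (hdD i j) (hS j _ hx) (abs_nonneg _) ((abs_nonneg _).trans (hdD i j))
        _ = _ := by
            rw [Finset.sum_const, Finset.card_univ, Fintype.card_fin, nsmul_eq_mul]
            push_cast
            ring
    have h2 := hQU i τ hτ
    rw [abs_sub_comm] at h2
    rw [hw'Q, add_sub_right_comm]
    refine (abs_add_le _ _).trans ?_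
    rw [hE, add_mul]
    exact add_le_add h2 h1
  have hE0 : 0 ≤ E := by positivity
  choose w hw0 hw using fun i => exists_primitive_of_continuousOn (hΔ0 i)
    (hw'cont i).continuousOn
  have hder : ∀ i, ∀ τ ∈ Set.Icc 0 (Δ i), HasDerivWithinAt (fun τ => u (a i) + w i τ) (w' i τ)
      (Set.Icc 0 (Δ i)) τ := fun i τ hτ => (hw i τ hτ).const_add _
  refine ⟨fun i τ => u (a i) + w i τ, w', fun r => hasJet_polynomial hΔ hc'bdd r, hw'cont, hder,
    fun i => by simp [hw0], hw'node, fun i m => ?_, E, hE0, fun i τ hτ => ?_⟩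
  · obtain ⟨q, hq, hqw⟩ := hw'poly i
    have h1 := integral_relNode hq (Δ i) m
    simp only [hqw, hw'node] at h1
    have hsub : Set.Icc 0 (relNode p (Δ i) m) ⊆ Set.Icc 0 (Δ i) :=
      Set.Icc_subset_Icc_right (relNode_mem (hΔ0 i) m).2
    rw [integral_eq_sub_of_hasDerivWithinAt (relNode_mem (hΔ0 i) m).1
      (fun τ hτ => (hw i τ (hsub hτ)).mono hsub) (hw'cont i).continuousOn, hw0, sub_zero] at h1
    simp only
    rw [h1]
  -- Both curves start at `u (a i)` and their derivatives differ by `O(Δ^(p+1))`; integration gains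
  -- the last power.
  · have h1 := (convex_Icc 0 (Δ i)).norm_image_sub_le_of_norm_hasDerivWithin_le
      (f := fun τ => (u (a i) + w i τ) - u (a i + τ)) (C := E * Δ i ^ (p + 1))
      (fun τ hτ => (hder i τ hτ).sub
        (hasDerivWithinAt_solution hu (hstep i).left (hstep i).right hτ))
      (fun τ hτ => hw'U i τ hτ) ⟨le_rfl, hΔ0 i⟩ hτ
    simp only [hw0, add_zero, sub_self, sub_zero, Real.norm_eq_abs, abs_of_nonneg hτ.1] at h1
    refine h1.trans ?_
    calc E * Δ i ^ (p + 1) * τ ≤ E * Δ i ^ (p + 1) * Δ i :=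
          mul_le_mul_of_nonneg_left hτ.2 (mul_nonneg hE0 (pow_nonneg (hΔ0 i) _))
      _ = _ := by ring

/-- The error at the end of a step of a curve that satisfies the differential equation
approximately at the Gauss-Radau points. -/
lemma exists_superconvergence_le (hp : 1 ≤ p)
    (hf : ContDiff ℝ (2 * p + 1 : ℕ) (Function.uncurry f))
    (hu : ∀ s ∈ Set.Icc 0 T, HasDerivWithinAt u (f s (u s)) (Set.Icc 0 T) s)
    (hstep : ∀ i, IsSubstep T (a i) (Δ i)) {w w' : ι → ℝ → ℝ} (hjet : ∀ r, HasJet Δ r w')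
    (hw'c : ∀ i, Continuous (w' i))
    (hw : ∀ i, ∀ τ ∈ Set.Icc 0 (Δ i), HasDerivWithinAt (w i) (w' i τ) (Set.Icc 0 (Δ i)) τ)
    (hw0 : ∀ i, w i 0 = u (a i)) {C D : ℝ} (hC0 : 0 ≤ C) (hD0 : 0 ≤ D) {s : ℕ}
    (hwu : ∀ i, ∀ τ ∈ Set.Icc 0 (Δ i), |w i τ - u (a i + τ)| ≤ C * Δ i ^ (p + 2))
    (hres : ∀ i j, |w' i (relNode p (Δ i) j) - f (a i + relNode p (Δ i) j)
      (w i (relNode p (Δ i) j))| ≤ D * Δ i ^ s) :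
    ∃ C', 0 ≤ C' ∧ ∀ i, |w i (Δ i) - u (a i + Δ i)| ≤ C' * Δ i ^ (min (2 * p + 2) s) := by
  have hΔ0 : ∀ i, 0 ≤ Δ i := fun i => (hstep i).pos.le
  have hΔ : ∀ i, Δ i ≤ 1 := fun i => (hstep i).le_one
  obtain ⟨M, hM⟩ := exists_abs_solution_le hu
  have hMU : ∀ i, ∀ τ ∈ Set.Icc 0 (Δ i), a i + τ ∈ Set.Icc 0 T := fun i τ hτ =>
    ⟨by linarith [(hstep i).left, hτ.1], by linarith [(hstep i).right, hτ.2]⟩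
  have ha : ∃ B, ∀ i, |a i| ≤ B := ⟨T, fun i => by
    rw [abs_of_nonneg (hstep i).left]; linarith [hΔ0 i, (hstep i).right]⟩
  have hw0' : ∃ B, ∀ i, |w i 0| ≤ B := ⟨M, fun i => by
    rw [hw0]
    exact hM _ ⟨(hstep i).left, by linarith [hΔ0 i, (hstep i).right]⟩⟩
  -- A quadratic linearisation error requires `f` to be `C²`, which is where `1 ≤ p` enters.
  obtain ⟨L, hL0, hL⟩ := exists_taylor_on_box
    (hf.of_le (by exact_mod_cast (by omega : 2 ≤ 2 * p + 1))) T (M + C)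
  have hwc : ∀ i, ContinuousOn (w i) (Set.Icc 0 (Δ i)) := fun i τ hτ =>
    (hw i τ hτ).continuousWithinAt
  have huc : ∀ i, ContinuousOn (fun τ => u (a i + τ)) (Set.Icc 0 (Δ i)) := fun i =>
    continuousOn_solution hu (hstep i).left (hstep i).right
  -- the defect of `w`
  set d : ι → ℝ → ℝ := fun i τ => w' i τ - f (a i + τ) (w i τ) with hd
  have hdjet : HasJet Δ (2 * p + 1) d := (hjet _).sub
    (HasJet.comp hΔ ha hw hw0' (F := Function.uncurry f) hf (hjet _))
  have hdc : ∀ i, ContinuousOn (d i) (Set.Icc 0 (Δ i)) := fun i =>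
    (hw'c i).continuousOn.sub (hf.continuous.comp_continuousOn
      ((continuousOn_const.add continuousOn_id).prodMk (hwc i)))
  -- the integrating factor
  set α : ι → ℝ → ℝ := fun i τ => partialSnd f (a i + τ) (u (a i + τ)) with hα
  have hpS : ContDiff ℝ (2 * p : ℕ) (Function.uncurry (partialSnd f)) := contDiff_partialSnd hf
  -- One derivative of `f` is lost here, but `E` depends on a primitive of `α` and recovers the
  -- order `2 p + 1` needed for the quadrature.
  have hαjet : HasJet Δ (2 * p) α := hasJet_solution_comp hf hu (fun i => (hstep i).left) hΔ0 hΔ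
    (fun i => (hstep i).right) (by omega) hpS
  have hαc : ∀ i, ContinuousOn (α i) (Set.Icc 0 (Δ i)) := fun i =>
    continuousOn_solution_comp hpS.continuous hu (hstep i).left (hstep i).right
  choose b hb0 hb using fun i => exists_primitive_of_continuousOn (hΔ0 i) (hαc i)
  have hb0' : ∃ B, ∀ i, |b i 0| ≤ B := ⟨0, fun i => by rw [hb0, abs_zero]⟩
  obtain ⟨B, hB⟩ := (hαjet.of_hasDerivWithinAt hb hb0').bounded hΔ
  set E : ι → ℝ → ℝ := fun i τ => Real.exp (-b i τ) with hE
  have hEjet : HasJet Δ (2 * p + 1) E := HasJet.comp hΔ ha hb hb0'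
    (F := fun q => Real.exp (-q.2)) (Real.contDiff_exp.comp contDiff_snd.neg) hαjet
  have hEd : ∀ i, ∀ τ ∈ Set.Icc 0 (Δ i),
      HasDerivWithinAt (E i) (-(α i τ * E i τ)) (Set.Icc 0 (Δ i)) τ := by
    intro i τ hτ
    refine ((hb i τ hτ).neg.exp).congr_deriv ?_
    simp only [hE, Pi.neg_apply]
    ring
  have hEc : ∀ i, ContinuousOn (E i) (Set.Icc 0 (Δ i)) := fun i τ hτ =>
    (hEd i τ hτ).continuousWithinAt
  have hEB : ∀ i, ∀ τ ∈ Set.Icc 0 (Δ i), |E i τ| ≤ Real.exp B := by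
    intro i τ hτ
    rw [abs_of_pos (Real.exp_pos _), Real.exp_le_exp]
    linarith [(abs_le.mp (hB i τ hτ)).1]
  -- quadrature of the defect
  obtain ⟨C₁, hC₁⟩ := (hEjet.mul hΔ hdjet).abs_integral_sub_le (fun i => (hEc i).mul (hdc i)) hΔ0
    (α := fun j => radauWeight p j / 2) (σ := fun i j => relNode p (Δ i) j)
    (fun i j => relNode_mem (hΔ0 i) j) (θ := Δ) (fun i => ⟨hΔ0 i, le_rfl⟩) (fun i q hq => by
      rw [integral_step (natDegree_le_of_degree_le (Order.le_of_lt_succ (by exact_mod_cast hq)))]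
      simp only [div_mul_eq_mul_div, ← Finset.sum_div]
      ring)
  set Ω : ℝ := ∑ j, radauWeight p j / 2 with hΩ
  have hΩ0 : 0 ≤ Ω := Finset.sum_nonneg fun j _ => by linarith [radauWeight_pos j]
  have hsum : ∀ i, |∑ j, radauWeight p j / 2 * (E i (relNode p (Δ i) j)
      * d i (relNode p (Δ i) j))| ≤ Ω * (Real.exp B * (D * Δ i ^ s)) := by
    intro i
    rw [hΩ, Finset.sum_mul]
    refine (Finset.abs_sum_le_sum_abs _ _).trans (Finset.sum_le_sum fun j _ => ?_)
    have hω := radauWeight_pos j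
    rw [abs_mul, abs_of_pos (by positivity), abs_mul]
    refine mul_le_mul_of_nonneg_left ?_ (by positivity)
    exact mul_le_mul (hEB i _ (relNode_mem (hΔ0 i) j)) (hres i j) (abs_nonneg _)
      (Real.exp_pos _).le
  -- the integrated error equation
  have hftc : ∀ i, ∫ τ in (0 : ℝ)..Δ i, E i τ
      * (w' i τ - f (a i + τ) (u (a i + τ)) - α i τ * (w i τ - u (a i + τ)))
      = E i (Δ i) * (w i (Δ i) - u (a i + Δ i)) := by
    intro i
    rw [integral_eq_sub_of_hasDerivWithinAt
      (φ := fun τ => E i τ * (w i τ - u (a i + τ))) (hΔ0 i)]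
    · simp [hw0]
    · intro τ hτ
      refine ((hEd i τ hτ).mul ((hw i τ hτ).sub (hasDerivWithinAt_solution hu (hstep i).left
        (hstep i).right hτ))).congr_deriv ?_
      simp only [Pi.sub_apply]
      ring
    · exact (hEc i).mul (((hw'c i).continuousOn.sub (continuousOn_solution_comp hf.continuous hu
        (hstep i).left (hstep i).right)).sub ((hαc i).mul ((hwc i).sub (huc i))))
  -- The integrands differ by `E` times the linearisation remainder of `f`, which is quadratic in `w
  -- - u = O(Δ^(p+2))`.
  have hrem : ∀ i, |(∫ τ in (0 : ℝ)..Δ i, E i τ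
      * (w' i τ - f (a i + τ) (u (a i + τ)) - α i τ * (w i τ - u (a i + τ))))
      - ∫ τ in (0 : ℝ)..Δ i, E i τ * d i τ| ≤ Real.exp B * (L * C ^ 2) * Δ i ^ (2 * p + 2) := by
    intro i
    have hI : Set.uIcc 0 (Δ i) = Set.Icc 0 (Δ i) := Set.uIcc_of_le (hΔ0 i)
    rw [← intervalIntegral.integral_sub]
    · have h1 := intervalIntegral.norm_integral_le_of_norm_le_const (a := 0) (b := Δ i)
        (f := fun τ => E i τ * (w' i τ - f (a i + τ) (u (a i + τ))
          - α i τ * (w i τ - u (a i + τ))) - E i τ * d i τ)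
        (C := Real.exp B * (L * (C * Δ i ^ (p + 2)) ^ 2)) (fun τ hτ => by
          have hτ' : τ ∈ Set.Icc 0 (Δ i) := hI ▸ Set.uIoc_subset_uIcc hτ
          rw [show E i τ * (w' i τ - f (a i + τ) (u (a i + τ)) - α i τ * (w i τ - u (a i + τ)))
            - E i τ * d i τ = E i τ * (f (a i + τ) (w i τ) - f (a i + τ) (u (a i + τ))
              - α i τ * (w i τ - u (a i + τ))) by simp only [hd]; ring, norm_mul]
          refine mul_le_mul (hEB i τ hτ') ?_ (norm_nonneg _) (Real.exp_pos _).le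
          have h2 := hM _ (hMU i τ hτ')
          have h3 := hwu i τ hτ'
          have h4 : |w i τ - u (a i + τ)| ≤ C :=
            h3.trans (mul_le_of_le_one_right hC0 (pow_le_one₀ (hΔ0 i) (hΔ i)))
          rw [abs_le] at h2 h4
          refine (hL _ (hMU i τ hτ') (u (a i + τ)) ?_ (w i τ) ?_).trans ?_
          · constructor <;> linarith [h2.1, h2.2]
          · constructor <;> linarith [h2.1, h2.2, h4.1, h4.2]
          · gcongr)
      rw [Real.norm_eq_abs, sub_zero, abs_of_nonneg (hΔ0 i)] at h1
      refine h1.trans ?_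
      calc Real.exp B * (L * (C * Δ i ^ (p + 2)) ^ 2) * Δ i
          = Real.exp B * (L * C ^ 2) * Δ i ^ (2 * p + 5) := by ring
        _ ≤ _ := mul_le_mul_of_nonneg_left
            (pow_le_pow_of_le_one (hΔ0 i) (hΔ i) (by omega)) (by positivity)
    · apply ContinuousOn.intervalIntegrable
      rw [hI]
      exact (hEc i).mul (((hw'c i).continuousOn.sub (continuousOn_solution_comp hf.continuous hu
        (hstep i).left (hstep i).right)).sub ((hαc i).mul ((hwc i).sub (huc i))))
    · apply ContinuousOn.intervalIntegrable
      rw [hI]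
      exact (hEc i).mul (hdc i)
  set C₂ : ℝ := Real.exp B * (L * C ^ 2) + |C₁| + Ω * (Real.exp B * D) with hC₂
  refine ⟨Real.exp B * C₂, by positivity, fun i => ?_⟩
  have h1 := hrem i
  rw [hftc] at h1
  have h2 := hC₁ i
  have h3 := hsum i
  have hq1 : Δ i ^ (2 * p + 2) ≤ Δ i ^ (min (2 * p + 2) s) :=
    pow_le_pow_of_le_one (hΔ0 i) (hΔ i) (by omega)
  -- Giving away the surplus power costs nothing later: the distance between stages and polynomial
  -- is itself only bounded by `Δ^s`.
  have hq2 : Δ i ^ (s + 1) ≤ Δ i ^ (min (2 * p + 2) s) :=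
    pow_le_pow_of_le_one (hΔ0 i) (hΔ i) (by omega)
  have h4 : |E i (Δ i) * (w i (Δ i) - u (a i + Δ i))| ≤ C₂ * Δ i ^ (min (2 * p + 2) s) := by
    have h5 : |Δ i * ∑ j, radauWeight p j / 2 * (E i (relNode p (Δ i) j)
        * d i (relNode p (Δ i) j))| ≤ Ω * (Real.exp B * D) * Δ i ^ (s + 1) := by
      rw [abs_mul, abs_of_nonneg (hΔ0 i)]
      refine (mul_le_mul_of_nonneg_left h3 (hΔ0 i)).trans (le_of_eq ?_)
      ring
    have h6 : C₁ * Δ i ^ (2 * p + 1 + 1) ≤ |C₁| * Δ i ^ (min (2 * p + 2) s) :=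
      mul_le_mul (le_abs_self _) hq1 (pow_nonneg (hΔ0 i) _) (abs_nonneg _)
    have h7 : Real.exp B * (L * C ^ 2) * Δ i ^ (2 * p + 2)
        ≤ Real.exp B * (L * C ^ 2) * Δ i ^ (min (2 * p + 2) s) := by gcongr
    have h8 : Ω * (Real.exp B * D) * Δ i ^ (s + 1)
        ≤ Ω * (Real.exp B * D) * Δ i ^ (min (2 * p + 2) s) := by gcongr
    rw [abs_le] at h1 h2 h5 ⊢
    rw [hC₂]
    constructor <;> linarith [h1.1, h1.2, h2.1, h2.2, h5.1, h5.2]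
  have h9 : Real.exp (-B) ≤ E i (Δ i) := by
    rw [hE, Real.exp_le_exp]
    linarith [(abs_le.mp (hB i (Δ i) ⟨hΔ0 i, le_rfl⟩)).2]
  rw [abs_mul, abs_of_pos (Real.exp_pos _)] at h4
  have h10 : Real.exp (-B) * |w i (Δ i) - u (a i + Δ i)| ≤ C₂ * Δ i ^ (min (2 * p + 2) s) :=
    (mul_le_mul_of_nonneg_right h9 (abs_nonneg _)).trans h4
  calc |w i (Δ i) - u (a i + Δ i)|
      = Real.exp B * (Real.exp (-B) * |w i (Δ i) - u (a i + Δ i)|) := by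
        rw [← mul_assoc, ← Real.exp_add]; simp
    _ ≤ Real.exp B * (C₂ * Δ i ^ (min (2 * p + 2) s)) :=
        mul_le_mul_of_nonneg_left h10 (Real.exp_pos _).le
    _ = _ := by ring

/-- Approximate collocation solutions are superconvergent at the end of the step. -/
lemma exists_colloc_last_error_le (hp : 1 ≤ p)
    (hf : ContDiff ℝ (2 * p + 1 : ℕ) (Function.uncurry f))
    (hu : ∀ s ∈ Set.Icc 0 T, HasDerivWithinAt u (f s (u s)) (Set.Icc 0 T) s)
    (hstep : ∀ i, IsSubstep T (a i) (Δ i)) {W : ι → Fin (p + 1) → ℝ} {C₁ C₂ : ℝ} (hC₁ : 0 ≤ C₁)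
    (hC₂ : 0 ≤ C₂) {s : ℕ}
    (hW : ∀ i j, |W i j - u (a i + relNode p (Δ i) j)| ≤ C₁ * Δ i ^ (p + 2))
    (hres : ∀ i m, |W i m - u (a i) - Δ i / 2 * ∑ j, collocMatrix p m j
      * f (a i + relNode p (Δ i) j) (W i j)| ≤ C₂ * Δ i ^ s) :
    ∃ C, 0 ≤ C ∧ ∀ i, |W i (Fin.last p) - u (a i + Δ i)| ≤ C * Δ i ^ (min (2 * p + 2) s) := by
  have hΔ0 : ∀ i, 0 ≤ Δ i := fun i => (hstep i).pos.le
  have hΔ : ∀ i, Δ i ≤ 1 := fun i => (hstep i).le_one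
  obtain ⟨w, w', hjet, hw'c, hw, hw0, hw'node, hwnode, C, hC0, hwu⟩ :=
    exists_colloc_polynomial (by omega) hf hu hstep hC₁ hW
  obtain ⟨M, hM⟩ := exists_abs_solution_le hu
  obtain ⟨L, hL0, hL⟩ := exists_lipschitz_on_box
    (hf.of_le (by exact_mod_cast (by omega : 1 ≤ 2 * p + 1))) T (M + C₁ + C)
  -- By construction of `w`, the residual of the collocation equations is the nodal difference `W -
  -- w`; the Lipschitz bound therefore controls the nodal defect `f(W) - f(w)`.
  have hWw : ∀ i m, |W i m - w i (relNode p (Δ i) m)| ≤ C₂ * Δ i ^ s := by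
    intro i m
    rw [hwnode, sub_add_eq_sub_sub]
    exact hres i m
  obtain ⟨C', hC'0, hC'⟩ := exists_superconvergence_le (D := L * C₂) hp hf hu hstep hjet hw'c hw
    hw0 hC0 (by positivity) (s := s) hwu (fun i j => by
      have h1 := hM _ ((hstep i).node_mem j)
      have h2 : |W i j - u (a i + relNode p (Δ i) j)| ≤ C₁ :=
        (hW i j).trans (mul_le_of_le_one_right hC₁ (pow_le_one₀ (hΔ0 i) (hΔ i)))
      have h3 : |w i (relNode p (Δ i) j) - u (a i + relNode p (Δ i) j)| ≤ C :=
        (hwu i _ (relNode_mem (hΔ0 i) j)).trans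
          (mul_le_of_le_one_right hC0 (pow_le_one₀ (hΔ0 i) (hΔ i)))
      rw [abs_le] at h1 h2 h3
      rw [hw'node]
      refine (hL _ ((hstep i).node_mem j) (W i j) ?_ _ ?_).trans ?_
      · constructor <;> linarith [h1.1, h1.2, h2.1, h2.2]
      · constructor <;> linarith [h1.1, h1.2, h3.1, h3.2]
      · rw [mul_assoc]
        exact mul_le_mul_of_nonneg_left (hWw i j) hL0)
  refine ⟨C₂ + C', by positivity, fun i => ?_⟩
  have h1 := hWw i (Fin.last p)
  rw [relNode_last] at h1
  have h2 := abs_add_le (W i (Fin.last p) - w i (Δ i)) (w i (Δ i) - u (a i + Δ i))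
  rw [sub_add_sub_cancel] at h2
  have h3 : C₂ * Δ i ^ s ≤ C₂ * Δ i ^ (min (2 * p + 2) s) :=
    mul_le_mul_of_nonneg_left (pow_le_pow_of_le_one (hΔ0 i) (hΔ i) (by omega)) hC₂
  linarith [hC' i]

end Superconvergence

/-! ### The local error. -/

section Local

variable {f f' : ℝ → ℝ → ℝ} {T L M R : ℝ} {u : ℝ → ℝ} {p K : ℕ} {g v : Version}

/-- The local error of a step that starts on the solution. -/
lemma exists_local_error_le (hf : ContDiff ℝ (2 * p + 1 : ℕ) (Function.uncurry f))
    (hu : ∀ s ∈ Set.Icc 0 T, HasDerivWithinAt u (f s (u s)) (Set.Icc 0 T) s)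
    (hL : ∀ t y z, |f' t y - f' t z| ≤ L * |y - z|) (hL0 : 0 ≤ L)
    (hf' : ∀ t ∈ Set.Icc 0 T, ∀ y ∈ Set.Icc (-R) R, f' t y = f t y)
    (hM : ∀ t ∈ Set.Icc 0 T, |u t| ≤ M) (hMR : M < R) :
    ∃ C h₀, 0 ≤ C ∧ 0 < h₀ ∧ ∀ (a Δ : ℝ) (W : Fin (K + 1) → Fin (p + 1) → ℝ),
      IsSubstep T a Δ → Δ ≤ h₀ → L * stepBound p g v * Δ ≤ 1 / 2 →
      IsStep g v p K f' a Δ (u a) W →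
      |W (Fin.last K) (Fin.last p) - u (a + Δ)| ≤ C * Δ ^ (min (2 * p + 1) (K + 1) + 1) := by
  have hfu : ∀ t ∈ Set.Icc 0 T, f' t (u t) = f t (u t) := fun t ht => hf' t ht _ (by
    have := abs_le.mp (hM t ht)
    constructor <;> linarith [this.1, this.2])
  obtain ⟨C, hC0, hC⟩ := exists_stage_error_le (K := K) (p := p) (g := g) (v := v) (by omega) hf hu hL hL0
    hfu
  -- Outside this case the stage error suffices: its exponent is `K + 2` if `K ≤ p`, and `2` if `p =
  -- 0`, in both cases at least `r + 1`.
  by_cases hcase : p < K ∧ 1 ≤ p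
  · obtain ⟨hpK, hp⟩ := hcase
    obtain ⟨C₂, hC₂0, hC₂⟩ := exists_residual_le (K := K) (p := p) (g := g) (v := v) (by omega) hf hu hL hL0
      hfu (by omega)
    -- For such `Δ` the stage error is at most `C Δ ≤ R - M`, so the last iterate lies in `[-R, R]`,
    -- where `f'` agrees with `f`.
    have hh : 0 < (R - M) / (C + 1) := div_pos (by linarith) (by linarith)
    set ι := {q : (ℝ × ℝ) × (Fin (K + 1) → Fin (p + 1) → ℝ) // IsSubstep T q.1.1 q.1.2 ∧
      q.1.2 ≤ (R - M) / (C + 1) ∧ L * stepBound p g v * q.1.2 ≤ 1 / 2 ∧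
      IsStep g v p K f' q.1.1 q.1.2 (u q.1.1) q.2}
    have hstage : ∀ (i : ι) (j : Fin (p + 1)), |i.1.2 (Fin.last K) j
        - u (i.1.1.1 + relNode p i.1.1.2 j)| ≤ C * i.1.1.2 ^ (p + 2) := by
      intro i j
      have h1 := hC (Fin.last K) _ _ _ i.2.1 i.2.2.2.1 i.2.2.2.2
      rw [Fin.val_last, min_eq_right hpK.le] at h1
      refine le_trans ?_ h1
      exact norm_le_pi_norm (i.1.2 (Fin.last K) - fun m => u (i.1.1.1 + relNode p i.1.1.2 m)) j
    have hbox : ∀ (i : ι) (j : Fin (p + 1)), i.1.2 (Fin.last K) j ∈ Set.Icc (-R) R := by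
      intro i j
      have h1 := hstage i j
      have h2 := abs_le.mp (hM _ (i.2.1.node_mem j))
      have h3 : C * i.1.1.2 ^ (p + 2) ≤ C * i.1.1.2 := mul_le_mul_of_nonneg_left
        (pow_le_of_le_one i.2.1.pos.le i.2.1.le_one (by omega)) hC0
      have h4 := (le_div_iff₀ (by linarith)).mp i.2.2.1
      have h5 := i.2.1.pos
      have h6 := abs_le.mp h1
      constructor <;> nlinarith [h6.1, h6.2, h2.1, h2.2]
    obtain ⟨C₃, hC₃0, hC₃⟩ := exists_colloc_last_error_le hp hf hu
      (a := fun i : ι => i.1.1.1) (Δ := fun i : ι => i.1.1.2)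
      (W := fun i : ι => i.1.2 (Fin.last K)) (fun i => i.2.1) hC0 hC₂0 hstage (s := K + 2)
      (fun i m => by
        have h1 := hC₂ _ _ _ i.2.1 i.2.2.2.1 i.2.2.2.2 m
        have h2 : ∀ j, f' (i.1.1.1 + relNode p i.1.1.2 j) (i.1.2 (Fin.last K) j)
            = f (i.1.1.1 + relNode p i.1.1.2 j) (i.1.2 (Fin.last K) j) := fun j =>
          hf' _ (i.2.1.node_mem j) _ (hbox i j)
        simpa only [h2] using h1)
    refine ⟨C₃, _, hC₃0, hh, fun a Δ W h1 h2 h3 h4 => ?_⟩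
    have h5 := hC₃ ⟨((a, Δ), W), h1, h2, h3, h4⟩
    rwa [show min (2 * p + 1) (K + 1) + 1 = min (2 * p + 2) (K + 2) by omega]
  · refine ⟨C, 1, hC0, one_pos, fun a Δ W h1 _ h3 h4 => ?_⟩
    have h5 := hC (Fin.last K) a Δ W h1 h3 h4
    have h6 := norm_le_pi_norm (W (Fin.last K) - fun m => u (a + relNode p Δ m)) (Fin.last p)
    simp only [Pi.sub_apply, relNode_last, Real.norm_eq_abs] at h6
    refine (h6.trans h5).trans (mul_le_mul_of_nonneg_left
      (pow_le_pow_of_le_one h1.pos.le h1.le_one ?_) hC0)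
    rw [Fin.val_last]
    omega

end Local

/-! ### Meshes and the discrete Gronwall inequality. -/

section Mesh

variable {T : ℝ} {N : ℕ} {t : Fin (N + 1) → ℝ}

lemma meshWidth_nonneg (ht : IsPartition T t) : 0 ≤ meshWidth t :=
  Real.iSup_nonneg fun n => sub_nonneg.mpr (ht.strictMono.monotone n.castSucc_lt_succ.le)

lemma le_meshWidth (t : Fin (N + 1) → ℝ) (n : Fin N) :
    t n.succ - t n.castSucc ≤ meshWidth t :=
  le_ciSup (f := fun n : Fin N => t n.succ - t n.castSucc) (Set.finite_range _).bddAbove n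

lemma IsPartition.mem_Icc (ht : IsPartition T t) (n : Fin (N + 1)) : t n ∈ Set.Icc 0 T :=
  ⟨ht.first ▸ ht.strictMono.monotone (Fin.zero_le n),
    ht.last ▸ ht.strictMono.monotone (Fin.le_last n)⟩

lemma IsPartition.isSubstep (ht : IsPartition T t) (h1 : meshWidth t ≤ 1) (n : Fin N) :
    IsSubstep T (t n.castSucc) (t n.succ - t n.castSucc) where
  left := (ht.mem_Icc _).1
  pos := sub_pos.mpr (ht.strictMono n.castSucc_lt_succ)
  le_one := (le_meshWidth t n).trans h1
  right := by rw [add_sub_cancel]; exact (ht.mem_Icc _).2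

lemma IsPartition.stepNode_mem (ht : IsPartition T t) (n : Fin N) {p : ℕ} (m : Fin (p + 1)) :
    stepNode p (t n.castSucc) (t n.succ - t n.castSucc) m ∈ Set.Icc 0 T := by
  have h1 := relNode_mem (sub_nonneg.mpr (ht.strictMono.monotone n.castSucc_lt_succ.le)) m
  rw [stepNode_eq]
  exact ⟨by linarith [(ht.mem_Icc n.castSucc).1, h1.1],
    by linarith [(ht.mem_Icc n.succ).2, h1.2]⟩

/-- The discrete Gronwall inequality on a mesh. -/
lemma IsPartition.gronwall (ht : IsPartition T t) {c B : ℝ} (hc : 0 ≤ c) (hB : 0 ≤ B)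
    {e : Fin (N + 1) → ℝ} (he0 : e 0 ≤ 0)
    (he : ∀ n : Fin N, e n.succ ≤ (1 + c * (t n.succ - t n.castSucc)) * e n.castSucc
      + B * (t n.succ - t n.castSucc)) (n : Fin (N + 1)) :
    e n ≤ B * T * Real.exp (c * T) := by
  -- The induction needs the sharper bound with the current time `t n` in place of `T`.
  suffices h : e n ≤ B * t n * Real.exp (c * t n) by
    have h1 := ht.mem_Icc n
    refine h.trans ?_
    have h2 : c * t n ≤ c * T := mul_le_mul_of_nonneg_left h1.2 hc
    have h3 := Real.exp_le_exp.mpr h2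
    have h4 : 0 ≤ T := h1.1.trans h1.2
    have h5 := h1.2
    gcongr
  induction n using Fin.induction with
  | zero => simpa [ht.first] using he0
  | succ n ih =>
    set Δ := t n.succ - t n.castSucc with hΔ
    have hΔ0 : 0 ≤ Δ := sub_nonneg.mpr (ht.strictMono.monotone n.castSucc_lt_succ.le)
    have htn := (ht.mem_Icc n.castSucc).1
    have h1 : t n.succ = t n.castSucc + Δ := by rw [hΔ]; ring
    have h2 : 1 + c * Δ ≤ Real.exp (c * Δ) := by linarith [Real.add_one_le_exp (c * Δ)]
    have h3 : Real.exp (c * t n.succ) = Real.exp (c * Δ) * Real.exp (c * t n.castSucc) := by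
      rw [← Real.exp_add, h1]; ring_nf
    have h4 : (1 : ℝ) ≤ Real.exp (c * t n.succ) :=
      Real.one_le_exp (mul_nonneg hc (ht.mem_Icc n.succ).1)
    calc e n.succ ≤ (1 + c * Δ) * e n.castSucc + B * Δ := he n
      _ ≤ (1 + c * Δ) * (B * t n.castSucc * Real.exp (c * t n.castSucc)) + B * Δ := by
          gcongr
      _ ≤ Real.exp (c * Δ) * (B * t n.castSucc * Real.exp (c * t n.castSucc)) + B * Δ * 1 := by
          rw [mul_one]; gcongr
      _ ≤ Real.exp (c * Δ) * (B * t n.castSucc * Real.exp (c * t n.castSucc))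
          + B * Δ * Real.exp (c * t n.succ) := by gcongr
      _ = B * t n.succ * Real.exp (c * t n.succ) := by rw [h3, h1]; ring

end Mesh

/-! ### Global error, clamping and bounded runs. -/

section Global

variable {f f' : ℝ → ℝ → ℝ} {T L M R u₀ : ℝ} {u : ℝ → ℝ} {p K : ℕ} {g v : Version}

/-- Global errors for a right-hand side that is globally Lipschitz continuous. -/
lemma exists_global_error_le (hf : ContDiff ℝ (2 * p + 1 : ℕ) (Function.uncurry f))
    (hT : 0 < T) (hu₀ : u 0 = u₀)
    (hu : ∀ s ∈ Set.Icc 0 T, HasDerivWithinAt u (f s (u s)) (Set.Icc 0 T) s)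
    (hL : ∀ t y z, |f' t y - f' t z| ≤ L * |y - z|) (hL0 : 0 ≤ L)
    (hf' : ∀ t ∈ Set.Icc 0 T, ∀ y ∈ Set.Icc (-R) R, f' t y = f t y)
    (hM : ∀ t ∈ Set.Icc 0 T, |u t| ≤ M) (hMR : M < R) :
    ∃ C h₀, 0 ≤ C ∧ 0 < h₀ ∧ ∀ (N : ℕ) (t : Fin (N + 1) → ℝ), IsPartition T t →
      meshWidth t ≤ h₀ → ∀ U : Fin N → Fin (K + 1) → Fin (p + 1) → ℝ,
      IsSDGRun g v p K f' u₀ t U →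
      (∀ n, |meshValue u₀ U n - u (t n)| ≤ C * meshWidth t ^ min (2 * p + 1) (K + 1)) ∧
      ∀ n k m, |U n k m - u (stepNode p (t n.castSucc) (t n.succ - t n.castSucc) m)|
        ≤ C * meshWidth t := by
  have hβ := stepBound_nonneg p g v
  have hfu : ∀ t ∈ Set.Icc 0 T, f' t (u t) = f t (u t) := fun t ht => hf' t ht _ (by
    have := abs_le.mp (hM t ht)
    constructor <;> linarith [this.1, this.2])
  obtain ⟨C₁, h₁, hC₁0, hh₁, hC₁⟩ := exists_local_error_le (K := K) (g := g) (v := v) hf hu hL hL0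
    hf' hM hMR
  obtain ⟨C₂, hC₂0, hC₂⟩ := exists_stage_error_le (K := K) (p := p) (g := g) (v := v) (by omega) hf hu hL
    hL0 hfu
  set r := min (2 * p + 1) (K + 1) with hr
  set c := 2 * (3 + 2 * K) * (L * stepBound p g v) with hc
  have hc0 : 0 ≤ c := by positivity
  set G := C₁ * T * Real.exp (c * T) with hG
  have hG0 : 0 ≤ G := by positivity
  -- This mesh size gives `L * stepBound p g v * Δ ≤ 1/2` on every step; the `+ 1` only avoids a
  -- zero denominator.
  have hb : 0 < 1 / (2 * (L * stepBound p g v + 1)) := by positivity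
  -- `G` serves the mesh values. For the stages, `(3 + 2 K) G` comes from the propagated error of
  -- the starting value and `C₂` from the step that starts on the solution.
  refine ⟨G + ((3 + 2 * K) * G + C₂), min (min 1 h₁) (1 / (2 * (L * stepBound p g v + 1))),
    by positivity, lt_min (lt_min one_pos hh₁) hb, fun N t ht hh U hU => ?_⟩
  have hw1 : meshWidth t ≤ 1 := hh.trans ((min_le_left _ _).trans (min_le_left _ _))
  have hwh : meshWidth t ≤ h₁ := hh.trans ((min_le_left _ _).trans (min_le_right _ _))
  have hw0 := meshWidth_nonneg ht
  have hsub := fun n => ht.isSubstep hw1 n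
  have hsmall : ∀ n : Fin N, L * stepBound p g v * (t n.succ - t n.castSucc) ≤ 1 / 2 := by
    intro n
    have h1 := ((le_meshWidth t n).trans hh).trans (min_le_right _ _)
    rw [le_div_iff₀ (by positivity)] at h1
    have h2 := (hsub n).pos
    nlinarith
  have hstep := isSDGRun_iff.mp hU
  -- the steps that start on the solution
  have hex : ∀ n : Fin N, ∃ W : Fin (K + 1) → Fin (p + 1) → ℝ, IsStep g v p K f'
      (t n.castSucc) (t n.succ - t n.castSucc) (u (t n.castSucc)) W := fun n =>
    (existsUnique_isStep (existsUnique_isEulerGuess hL hL0 (hsub n).pos.le (hsmall n) _)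
      (existsUnique_isSDGIteration hL hL0 (hsub n).pos.le (hsmall n) _)).exists
  choose W hW using hex
  -- Each error splits into the propagated previous error, with factor `1 + c Δ`, and a local error
  -- `C₁ Δ^(r+1) ≤ C₁ h^r Δ`.
  have hglob : ∀ n, |meshValue u₀ U n - u (t n)| ≤ G * meshWidth t ^ r := by
    have h := ht.gronwall (e := fun n => |meshValue u₀ U n - u (t n)|) hc0
      (B := C₁ * meshWidth t ^ r) (by positivity) (by
        rw [ht.first, hu₀]
        change |u₀ - u₀| ≤ 0
        simp) (fun n => by
        have h1 := (hstep n).abs_last_sub_le hL hL0 (hsub n).pos.le (hsmall n) (hW n) (Fin.last p)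
        have h2 := hC₁ _ _ _ (hsub n) ((le_meshWidth t n).trans hwh) (hsmall n) (hW n)
        rw [add_sub_cancel] at h2
        have h3 : C₁ * (t n.succ - t n.castSucc) ^ (r + 1)
            ≤ C₁ * meshWidth t ^ r * (t n.succ - t n.castSucc) := by
          rw [pow_succ, ← mul_assoc]
          have h4 := (hsub n).pos.le
          have h5 := le_meshWidth t n
          gcongr
        have h6 := abs_add_le (U n (Fin.last K) (Fin.last p) - W n (Fin.last K) (Fin.last p))
          (W n (Fin.last K) (Fin.last p) - u (t n.succ))
        rw [sub_add_sub_cancel] at h6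
        change |U n (Fin.last K) (Fin.last p) - u (t n.succ)| ≤ _
        linarith)
    intro n
    refine (h n).trans (le_of_eq ?_)
    rw [hG]; ring
  have hwr : meshWidth t ^ r ≤ meshWidth t := pow_le_of_le_one hw0 hw1 (by omega)
  refine ⟨fun n => (hglob n).trans ?_, fun n k m => ?_⟩
  · gcongr
    have : 0 ≤ (3 + 2 * K) * G + C₂ := by positivity
    linarith
  · have h1 := (hstep n).norm_sub_le hL hL0 (hsub n).pos.le (hsmall n) (hW n) k
    have h2 := hC₂ k _ _ _ (hsub n) (hsmall n) (hW n)
    have h3 : (t n.succ - t n.castSucc) ^ (min (k : ℕ) p + 2) ≤ meshWidth t :=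
      (pow_le_of_le_one (hsub n).pos.le (hsub n).le_one (by omega)).trans (le_meshWidth t n)
    have h4 := norm_le_pi_norm (U n k - W n k) m
    have h5 := norm_le_pi_norm (W n k - fun m => u (t n.castSucc
      + relNode p (t n.succ - t n.castSucc) m)) m
    simp only [Pi.sub_apply, Real.norm_eq_abs] at h4 h5
    have h6 := abs_add_le (U n k m - W n k m)
      (W n k m - u (t n.castSucc + relNode p (t n.succ - t n.castSucc) m))
    rw [sub_add_sub_cancel] at h6
    have hk : (k : ℝ) ≤ K := by exact_mod_cast Nat.lt_succ_iff.mp k.2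
    have h7 : (3 + 2 * (k : ℝ)) * |meshValue u₀ U n.castSucc - u (t n.castSucc)|
        ≤ (3 + 2 * K) * (G * meshWidth t) := by
      have h8 := (hglob n.castSucc).trans (mul_le_mul_of_nonneg_left hwr hG0)
      gcongr
    have h9 := mul_le_mul_of_nonneg_left h3 hC₂0
    have h10 : 0 ≤ G * meshWidth t := by positivity
    rw [stepNode_eq]
    linarith

/-- The right-hand side with its arguments projected to `[0, T]` and `[-R, R]`. -/
def clampRhs (f : ℝ → ℝ → ℝ) (T R t y : ℝ) : ℝ := f (max 0 (min T t)) (max (-R) (min R y))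

lemma clampRhs_eq {t y : ℝ} (ht : t ∈ Set.Icc 0 T) (hy : y ∈ Set.Icc (-R) R) :
    clampRhs f T R t y = f t y := by
  rw [clampRhs, min_eq_right ht.2, max_eq_right ht.1, min_eq_right hy.2, max_eq_right hy.1]

/-- Projection onto an interval does not increase distances, and `f` is Lipschitz in its second
variable on the box. -/
lemma exists_lipschitz_clampRhs (hf : ContDiff ℝ (2 * p + 1 : ℕ) (Function.uncurry f))
    (hT : 0 ≤ T) (hR : 0 ≤ R) : ∃ L, 0 ≤ L ∧
      ∀ t y z, |clampRhs f T R t y - clampRhs f T R t z| ≤ L * |y - z| := by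
  obtain ⟨L, hL0, hL⟩ := exists_lipschitz_on_box
    (hf.of_le (by exact_mod_cast (by omega : 1 ≤ 2 * p + 1))) T R
  refine ⟨L, hL0, fun t y z => ?_⟩
  have hmem : ∀ x, max (-R) (min R x) ∈ Set.Icc (-R) R := fun x =>
    ⟨le_max_left _ _, max_le (by linarith) (min_le_left _ _)⟩
  refine (hL _ ⟨le_max_left _ _, max_le hT (min_le_left _ _)⟩ _ (hmem y) _ (hmem z)).trans
    (mul_le_mul_of_nonneg_left ?_ hL0)
  have h1 := abs_max_sub_max_le_max (-R) (min R y) (-R) (min R z)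
  have h2 := abs_min_sub_min_le_max R y R z
  rw [sub_self, abs_zero, max_eq_right (abs_nonneg (_ : ℝ))] at h1 h2
  exact h1.trans h2

/-- A run depends only on the right-hand side near the values of the run. -/
lemma IsSDGRun.congr_on_box {N : ℕ} {t : Fin (N + 1) → ℝ} (ht : IsPartition T t)
    (hff : ∀ t ∈ Set.Icc 0 T, ∀ y ∈ Set.Icc (-R) R, f t y = f' t y) (hu₀ : |u₀| ≤ R)
    {U : Fin N → Fin (K + 1) → Fin (p + 1) → ℝ} (hU : IsSDGRun g v p K f u₀ t U)
    (hUR : ∀ n k m, |U n k m| ≤ R) : IsSDGRun g v p K f' u₀ t U := by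
  refine isSDGRun_iff.mpr fun n => (isSDGRun_iff.mp hU n).congr
    (hff _ (ht.mem_Icc _) _ (abs_le.mp ?_))
    (fun k j => hff _ (ht.stepNode_mem n j) _ (abs_le.mp (hUR n k j)))
  exact Fin.cases (motive := fun n => |meshValue u₀ U n| ≤ R) hu₀ (fun n => hUR n _ _) n.castSucc

lemma existsUnique_isSDGRun_of_lipschitz (hL : ∀ t y z, |f t y - f t z| ≤ L * |y - z|)
    (hL0 : 0 ≤ L) {N : ℕ} {t : Fin (N + 1) → ℝ} (ht : IsPartition T t)
    (hh : meshWidth t ≤ 1 / (2 * (L * stepBound p g v + 1))) :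
    ∃! U : Fin N → Fin (K + 1) → Fin (p + 1) → ℝ, IsSDGRun g v p K f u₀ t U := by
  have hβ := stepBound_nonneg p g v
  refine existsUnique_isSDGRun u₀ fun n y => ?_
  have hΔ : 0 ≤ t n.succ - t n.castSucc :=
    sub_nonneg.mpr (ht.strictMono.monotone n.castSucc_lt_succ.le)
  have hsmall : L * stepBound p g v * (t n.succ - t n.castSucc) ≤ 1 / 2 := by
    have h1 := (le_meshWidth t n).trans hh
    rw [le_div_iff₀ (by positivity)] at h1
    nlinarith
  exact existsUnique_isStep (existsUnique_isEulerGuess hL hL0 hΔ hsmall y)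
    (existsUnique_isSDGIteration hL hL0 hΔ hsmall y)

/-- On fine meshes there is an accurate run. -/
lemma exists_accurate_run (hf : ContDiff ℝ (2 * p + 1 : ℕ) (Function.uncurry f))
    (hT : 0 < T) (hu₀ : u 0 = u₀)
    (hu : ∀ s ∈ Set.Icc 0 T, HasDerivWithinAt u (f s (u s)) (Set.Icc 0 T) s)
    (hM : ∀ t ∈ Set.Icc 0 T, |u t| ≤ M) (K : ℕ) (g v : Version) :
    ∃ C h₀, 0 ≤ C ∧ 0 < h₀ ∧ ∀ (N : ℕ) (t : Fin (N + 1) → ℝ), IsPartition T t →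
      meshWidth t ≤ h₀ → ∃ U : Fin N → Fin (K + 1) → Fin (p + 1) → ℝ,
      IsSDGRun g v p K f u₀ t U ∧
      (∀ n, |meshValue u₀ U n - u (t n)| ≤ C * meshWidth t ^ min (2 * p + 1) (K + 1)) ∧
      ∀ n k m, |U n k m| ≤ M + C * meshWidth t := by
  have hM₀ : |u₀| ≤ M := hu₀ ▸ hM 0 ⟨le_rfl, hT.le⟩
  have hM0 : 0 ≤ M := (abs_nonneg _).trans hM₀
  have hβ := stepBound_nonneg p g v
  -- The fixed radius `M + 1` keeps the final constant `C` independent of the interval `[-R, R]` in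
  -- which solutions are later sought.
  obtain ⟨L, hL0, hL⟩ := exists_lipschitz_clampRhs hf hT.le (by linarith : 0 ≤ M + 1)
  obtain ⟨C, h₀, hC0, hh₀, hC⟩ := exists_global_error_le (K := K) (g := g) (v := v) hf hT hu₀ hu
    hL hL0 (fun t ht y hy => clampRhs_eq ht hy) hM (lt_add_one M)
  -- The bound `1 / (C + 1)` ensures `C h ≤ 1`, so the clamped run stays in `[-(M + 1), M + 1]` and
  -- is a run for `f`.
  refine ⟨C, min h₀ (min (1 / (C + 1)) (1 / (2 * (L * stepBound p g v + 1)))), hC0,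
    lt_min hh₀ (lt_min (by positivity) (by positivity)), fun N t ht hh => ?_⟩
  obtain ⟨U, hU, -⟩ := existsUnique_isSDGRun_of_lipschitz (K := K) (u₀ := u₀) (g := g) (v := v)
    hL hL0 ht (hh.trans ((min_le_right _ _).trans (min_le_right _ _)))
  obtain ⟨h1, h2⟩ := hC N t ht (hh.trans (min_le_left _ _)) U hU
  have h3 : ∀ n k m, |U n k m| ≤ M + C * meshWidth t := by
    intro n k m
    have h4 := hM _ (ht.stepNode_mem n m)
    have h5 := abs_add_le (U n k m - u (stepNode p (t n.castSucc) (t n.succ - t n.castSucc) m))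
      (u (stepNode p (t n.castSucc) (t n.succ - t n.castSucc) m))
    rw [sub_add_cancel] at h5
    linarith [h2 n k m]
  refine ⟨U, hU.congr_on_box (R := M + 1) ht (fun t ht y hy => clampRhs_eq ht hy) (by linarith)
    fun n k m => (h3 n k m).trans ?_, h1, h3⟩
  have h6 := hh.trans ((min_le_right _ _).trans (min_le_left _ _))
  rw [le_div_iff₀ (by positivity)] at h6
  linarith [meshWidth_nonneg ht]

/-- On fine meshes there is at most one run with values in a given interval. -/
lemma exists_unique_bounded_run (hf : ContDiff ℝ (2 * p + 1 : ℕ) (Function.uncurry f))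
    (hT : 0 ≤ T) (hR : |u₀| ≤ R) (K : ℕ) (g v : Version) :
    ∃ h₀, 0 < h₀ ∧ ∀ (N : ℕ) (t : Fin (N + 1) → ℝ), IsPartition T t →
      meshWidth t ≤ h₀ → ∀ U U' : Fin N → Fin (K + 1) → Fin (p + 1) → ℝ,
      IsSDGRun g v p K f u₀ t U → (∀ n k m, |U n k m| ≤ R) →
      IsSDGRun g v p K f u₀ t U' → (∀ n k m, |U' n k m| ≤ R) → U = U' := by
  have hβ := stepBound_nonneg p g v
  -- Clamping at `R` leaves both runs unchanged, while the clamped problem has only one run. Through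
  -- `L` the threshold depends on `R`.
  obtain ⟨L, hL0, hL⟩ := exists_lipschitz_clampRhs hf hT ((abs_nonneg _).trans hR)
  refine ⟨1 / (2 * (L * stepBound p g v + 1)), by positivity,
    fun N t ht hh U U' hU hUR hU' hUR' => ?_⟩
  exact (existsUnique_isSDGRun_of_lipschitz (K := K) (u₀ := u₀) (g := g) (v := v)
    hL hL0 ht hh).unique
    (hU.congr_on_box ht (fun t ht y hy => (clampRhs_eq ht hy).symm) hR hUR)
    (hU'.congr_on_box ht (fun t ht y hy => (clampRhs_eq ht hy).symm) hR hUR')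

end Global

end SDG

theorem mainTheorem1 (p K : ℕ) (f : ℝ → ℝ → ℝ)
    (hf : ContDiff ℝ ((2 * p + 1 : ℕ) : WithTop ℕ∞) (Function.uncurry f))
    (T : ℝ) (hT : 0 < T) (u₀ : ℝ) (u : ℝ → ℝ) (hu₀ : u 0 = u₀)
    (hu : ∀ s ∈ Set.Icc 0 T, HasDerivWithinAt u (f s (u s)) (Set.Icc 0 T) s) :
    -- the explicit method, started by the explicit Euler method
    (∃ C h₀ : ℝ, 0 < h₀ ∧
      ∀ (N : ℕ) (t : Fin (N + 1) → ℝ), SDG.IsPartition T t → SDG.meshWidth t ≤ h₀ →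
        (∃! U : Fin N → Fin (K + 1) → Fin (p + 1) → ℝ,
          SDG.IsSDGRun .explicit .explicit p K f u₀ t U) ∧
        ∀ U : Fin N → Fin (K + 1) → Fin (p + 1) → ℝ,
          SDG.IsSDGRun .explicit .explicit p K f u₀ t U →
          ∀ n, |SDG.meshValue u₀ U n - u (t n)|
            ≤ C * SDG.meshWidth t ^ min (2 * p + 1) (K + 1)) ∧
    -- either method, started by either Euler method; implicit equations are solved in `[-R, R]`
    (∀ g v : SDG.Version, ∃ C : ℝ, ∀ R : ℝ, (∀ s ∈ Set.Icc 0 T, |u s| < R) →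
      ∃ h₀ : ℝ, 0 < h₀ ∧
      ∀ (N : ℕ) (t : Fin (N + 1) → ℝ), SDG.IsPartition T t → SDG.meshWidth t ≤ h₀ →
        (∃! U : Fin N → Fin (K + 1) → Fin (p + 1) → ℝ,
          SDG.IsSDGRun g v p K f u₀ t U ∧ ∀ n k m, |U n k m| ≤ R) ∧
        ∀ U : Fin N → Fin (K + 1) → Fin (p + 1) → ℝ,
          SDG.IsSDGRun g v p K f u₀ t U → (∀ n k m, |U n k m| ≤ R) →
          ∀ n, |SDG.meshValue u₀ U n - u (t n)|
            ≤ C * SDG.meshWidth t ^ min (2 * p + 1) (K + 1)) := by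

  -- The maximum of `|u|` is attained, so the pointwise bound `|u s| < R` leaves a positive margin
  -- `R - |u σ|`.
  obtain ⟨σ, hσ, hmax⟩ := isCompact_Icc.exists_isMaxOn (Set.nonempty_Icc.mpr hT.le)
    (ContinuousOn.abs fun s hs => (hu s hs).continuousWithinAt)
  have hM : ∀ s ∈ Set.Icc 0 T, |u s| ≤ |u σ| := fun s hs => hmax hs
  refine ⟨?_, fun g v => ?_⟩
  · obtain ⟨C, h₀, -, hh₀, hC⟩ := SDG.exists_accurate_run hf hT hu₀ hu hM K .explicit .explicit
    refine ⟨C, h₀, hh₀, fun N t ht hh => ?_⟩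
    have huniq : ∃! U : Fin N → Fin (K + 1) → Fin (p + 1) → ℝ,
        SDG.IsSDGRun .explicit .explicit p K f u₀ t U :=
      SDG.existsUnique_isSDGRun u₀ fun n y => SDG.existsUnique_isStep
        (SDG.existsUnique_isEulerGuess_explicit p f _ _ y)
        (SDG.existsUnique_isSDGIteration_explicit p f _ _ y)
    obtain ⟨U, hU, hUu, -⟩ := hC N t ht hh
    exact ⟨huniq, fun U' hU' => huniq.unique hU hU' ▸ hUu⟩
  · obtain ⟨C, h₁, hC0, hh₁, hC⟩ := SDG.exists_accurate_run hf hT hu₀ hu hM K g v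
    refine ⟨C, fun R hR => ?_⟩
    have hσR : |u σ| < R := hR σ hσ
    have hR₀ : |u₀| ≤ R := hu₀ ▸ (hR 0 ⟨le_rfl, hT.le⟩).le
    obtain ⟨h₂, hh₂, huniq⟩ := SDG.exists_unique_bounded_run hf hT.le hR₀ K g v
    have hC1 : 0 < C + 1 := by linarith
    -- The last term makes `C h` at most the margin, so the accurate run lies in `[-R, R]`; by
    -- uniqueness there it is the only candidate.
    refine ⟨min (min h₁ h₂) ((R - |u σ|) / (C + 1)),
      lt_min (lt_min hh₁ hh₂) (div_pos (by linarith) hC1), fun N t ht hh => ?_⟩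
    have hhl := hh.trans (min_le_left _ _)
    obtain ⟨U, hU, hUu, hUM⟩ := hC N t ht (hhl.trans (min_le_left _ _))
    have hUR : ∀ n k m, |U n k m| ≤ R := fun n k m => by
      have h1 := (le_div_iff₀ hC1).mp (hh.trans (min_le_right _ _))
      linarith [hUM n k m, SDG.meshWidth_nonneg ht]
    have heq : ∀ U' : Fin N → Fin (K + 1) → Fin (p + 1) → ℝ, SDG.IsSDGRun g v p K f u₀ t U' →
        (∀ n k m, |U' n k m| ≤ R) → U' = U := fun U' hU' hUR' =>
      huniq N t ht (hhl.trans (min_le_right _ _)) U' U hU' hUR' hU hUR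
    refine ⟨⟨U, ⟨hU, hUR⟩, fun U' h => heq U' h.1 h.2⟩, fun U' hU' hUR' => ?_⟩
    rw [heq U' hU' hUR']
    exact hUu
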